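/- Let $K$ be a number of encoders, $\mathcal K=\{1,\dots,K\}$, and let $P=P_{X,Y_0,Y_1,\dots,Y_K}$ be a pmf on a finite alphabet $\mathcal X\times\mathcal Y_0\times\mathcal Y_1\times\dots\times\mathcal Y_K$ under which $Y_1,\dots,Y_K$ are conditionally independent given $(X,Y_0)$. Given $n$ i.i.d. copies of $(X,Y_0,Y_1,\dots,Y_K)$, one tests $$H_0:\ P_{X,Y_0,Y_1,\dots,Y_K}=P_{X,Y_0}\prod_{k=1}^K P_{Y_k|X,Y_0}\qquad\text{against}\qquad H_1:\ Q_{X,Y_0,Y_1,\dots,Y_K}=P_{Y_0}P_{X|Y_0}P_{Y_1,\dots,Y_K|Y_0}.$$ Encoder $k$ observes $Y_k^n$ and sends $\phi_k(Y_k^n)\in\{1,\dots,M_k\}$; the detector accepts $H_0$ iff $(\phi_1(Y_1^n),\dots,\phi_K(Y_K^n),X^n,Y_0^n)$ lies in an acceptance region $\mathcal A_n$. A tuple $(R_1,\dots,R_K,E)$ is achievable at level $\epsilon$ if for every $\delta>0$ and all sufficiently large $n$ there are encoders, an acceptance region and $\beta>0$ such that the probability of $\mathcal A_n^c$ under $H_0$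 is at most $\epsilon$, the probability of $\mathcal A_n$ under $H_1$ is at most $\beta$, $\frac1n\log M_k\le R_k+\delta$ for all $k\in\mathcal K$, and $-\frac1n\log\beta\ge E-\delta$. The rate-exponent region $\mathcal R_{\mathrm{HT}}$ is the set of non-negative tuples $(R_1,\dots,R_K,E)$ that are achievable at every level $\epsilon\in(0,1]$. Then $\mathcal R_{\mathrm{HT}}$ equals the set of all non-negative tuples $(R_1,\dots,R_K,E)$ for which there are random variables $U_1,\dots,U_K,Q$ with finite alphabets and joint pmf $$P_{X,Y_0,Y_{\mathcal K},U_{\mathcal K},Q}=P_Q\,P_{X,Y_0}\prod_{k=1}^K P_{Y_k|X,Y_0}\prod_{k=1}^K P_{U_k|Y_k,Q}\qquad(*)$$ such that, for every $\mathcal S\subseteq\mathcal K$ (with $\mathcal S^c=\mathcal K\setminus\mathcal S$ and $U_{\mathcal S}=(U_k)_{k\in\mathcal S}$), $$E\le I(U_{\mathcal S^c};X|Y_0,Q)+\sum_{k\in\mathcal S}\bigl(R_k-I(Y_k;U_k|X,Y_0,Q)\bigr).$$ Moreover, $\mathcal R_{\mathrm{HT}}$ equals the rate-exponent region of the Quantize-Bin-Test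 scheme of Rahman and Wagner, that is, the set of all non-negative tuples $(R_1,\dots,R_K,E)$ for which there are $U_1,\dots,U_K,Q$ as in $(*)$ with $\sum_{k\in\mathcal S}R_k\ge I(U_{\mathcal S};Y_{\mathcal S}|U_{\mathcal S^c},Y_0,Q)$ for every $\mathcal S\subseteq\mathcal K$ and $E\le I(U_{\mathcal K};X|Y_0)$; so this scheme is optimal. -/

import Mathlib

namespace DistHT

noncomputable section

/-! ### Finite probability spaces and information measures

A pmf on a finite sample space `Ω` is an element of `stdSimplex ℝ Ω`; a random variable is a
function on `Ω`. Logarithms are natural. -/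

section Information

variable {Ω α β γ : Type*} [Fintype Ω]

open Classical in
/-- Probability of an event under the pmf `p`. -/
def prob (p : Ω → ℝ) (s : Set Ω) : ℝ := ∑ ω with ω ∈ s, p ω

/-- The pmf `P_A` of the random variable `A`. -/
def pmfOf (p : Ω → ℝ) (A : Ω → α) (a : α) : ℝ := prob p {ω | A ω = a}

/-- The conditional pmf `P_{A|C}(a|c)` (zero when `P_C(c) = 0`). -/
def condPmf (p : Ω → ℝ) (A : Ω → α) (C : Ω → γ) (a : α) (c : γ) : ℝ :=
  pmfOf p (fun ω => (A ω, C ω)) (a, c) / pmfOf p C c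

/-- The conditional mutual information
`I(A;B|C) = ∑ P(a,b,c) log (P(a,b,c) P(c) / (P(a,c) P(b,c)))`. -/
def condMutualInfo [Fintype α] [Fintype β] [Fintype γ]
    (p : Ω → ℝ) (A : Ω → α) (B : Ω → β) (C : Ω → γ) : ℝ :=
  ∑ a, ∑ b, ∑ c,
    pmfOf p (fun ω => (A ω, B ω, C ω)) (a, b, c) *
      Real.log (pmfOf p (fun ω => (A ω, B ω, C ω)) (a, b, c) * pmfOf p C c /
        (pmfOf p (fun ω => (A ω, C ω)) (a, c) * pmfOf p (fun ω => (B ω, C ω)) (b, c)))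

end Information

/-! ### The source and the two hypotheses -/

/-- A letter `(x, y₀, (y₁, …, y_K))` of the source. -/
abbrev Letter {K : ℕ} (𝒳 𝒴₀ : Type*) (𝒴 : Fin K → Type*) := 𝒳 × 𝒴₀ × (∀ k, 𝒴 k)

section Model

variable {K : ℕ} {𝒳 𝒴₀ : Type*} {𝒴 : Fin K → Type*}
variable [Fintype 𝒳] [Fintype 𝒴₀] [∀ k, Fintype (𝒴 k)]

/-- Under the null hypothesis the `Y_k` are conditionally independent given `(X, Y₀)`:
`P(x,y₀,y) = P(x,y₀) ∏ₖ P(yₖ|x,y₀)`. -/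
def CondIndepObservations (P : Letter 𝒳 𝒴₀ 𝒴 → ℝ) : Prop :=
  ∀ x y₀ y, P (x, y₀, y) =
    pmfOf P (fun w => (w.1, w.2.1)) (x, y₀) *
      ∏ k, condPmf P (fun w => w.2.2 k) (fun w => (w.1, w.2.1)) (y k) (x, y₀)

/-- The alternate hypothesis `Q(x,y₀,y) = P(y₀) P(x|y₀) P(y|y₀)`. -/
def altPmf (P : Letter 𝒳 𝒴₀ 𝒴 → ℝ) : Letter 𝒳 𝒴₀ 𝒴 → ℝ := fun w =>
  pmfOf P (fun v => v.2.1) w.2.1 *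
    condPmf P (fun v => v.1) (fun v => v.2.1) w.1 w.2.1 *
    condPmf P (fun v => v.2.2) (fun v => v.2.1) w.2.2 w.2.1

/-- The pmf of `n` independent copies. -/
def iidPmf {Ω : Type*} (p : Ω → ℝ) (n : ℕ) : (Fin n → Ω) → ℝ := fun w => ∏ i, p (w i)

/-- What the detector sees, `(φ₁(Y₁ⁿ), …, φ_K(Y_Kⁿ), Xⁿ, Y₀ⁿ)`. -/
def detectorInput {n : ℕ} {M : Fin K → ℕ} (φ : ∀ k, (Fin n → 𝒴 k) → Fin (M k))
    (w : Fin n → Letter 𝒳 𝒴₀ 𝒴) : (∀ k, Fin (M k)) × (Fin n → 𝒳) × (Fin n → 𝒴₀) :=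
  (fun k => φ k (fun i => (w i).2.2 k), fun i => (w i).1, fun i => (w i).2.1)

/-- Achievability of `(R₁, …, R_K, E)` at Type I error level `ε`: for every `δ > 0` and all
sufficiently large `n` there are encoders `φₖ` and an acceptance region `A` of the null hypothesis
with Type I error at most `ε`, Type II error at most `β`, `(1/n) log Mₖ ≤ Rₖ + δ` and
`-(1/n) log β ≥ E - δ`. -/
def IsAchievable (P : Letter 𝒳 𝒴₀ 𝒴 → ℝ) (ε : ℝ) (R : Fin K → ℝ) (E : ℝ) : Prop :=
  ∀ δ : ℝ, 0 < δ → ∀ᶠ n : ℕ in Filter.atTop,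
    ∃ (M : Fin K → ℕ) (φ : ∀ k, (Fin n → 𝒴 k) → Fin (M k))
      (A : Set ((∀ k, Fin (M k)) × (Fin n → 𝒳) × (Fin n → 𝒴₀))) (β : ℝ),
      0 < β ∧
      prob (iidPmf P n) {w | detectorInput φ w ∉ A} ≤ ε ∧
      prob (iidPmf (altPmf P) n) {w | detectorInput φ w ∈ A} ≤ β ∧
      (∀ k, 1 / (n : ℝ) * Real.log (M k) ≤ R k + δ) ∧
      -(1 / (n : ℝ)) * Real.log β ≥ E - δ

/-- The rate-exponent region: the non-negative tuples that are achievable at every level `ε`. -/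
def rateExponentRegion (P : Letter 𝒳 𝒴₀ 𝒴 → ℝ) : Set ((Fin K → ℝ) × ℝ) :=
  {RE | (∀ k, 0 ≤ RE.1 k) ∧ 0 ≤ RE.2 ∧ ∀ ε ∈ Set.Ioc (0 : ℝ) 1, IsAchievable P ε RE.1 RE.2}

/-! ### Auxiliary random variables -/

/-- Finite alphabets and distributions of the auxiliary variables `U₁, …, U_K` and `Q`. -/
structure Auxiliary {K : ℕ} (𝒴 : Fin K → Type*) where
  /-- the alphabet of `U_k` is `Fin (cardU k)` -/
  cardU : Fin K → ℕ
  /-- the alphabet of `Q` is `Fin cardQ` -/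
  cardQ : ℕ
  /-- the pmf of the time-sharing variable -/
  pQ : Fin cardQ → ℝ
  /-- the test channels: `pU k y q u` is the conditional probability of `U_k = u`
  given `Y_k = y`, `Q = q` -/
  pU : ∀ k, 𝒴 k → Fin cardQ → Fin (cardU k) → ℝ
  pQ_mem : pQ ∈ stdSimplex ℝ (Fin cardQ)
  pU_mem : ∀ k y q, pU k y q ∈ stdSimplex ℝ (Fin (cardU k))

namespace Auxiliary

/-- The joint sample space of `((X, Y₀, Y), U, Q)`. -/
abbrev Space (𝒳 𝒴₀ : Type*) (a : Auxiliary 𝒴) :=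
  Letter 𝒳 𝒴₀ 𝒴 × (∀ k, Fin (a.cardU k)) × Fin a.cardQ

/-- The joint pmf `P_Q(q) P(x,y₀,y) ∏ₖ P(uₖ|yₖ,q)`; here `P(x,y₀,y)` is
`P(x,y₀) ∏ₖ P(yₖ|x,y₀)` by conditional independence. -/
def joint (a : Auxiliary 𝒴) (P : Letter 𝒳 𝒴₀ 𝒴 → ℝ) : a.Space 𝒳 𝒴₀ → ℝ := fun w =>
  a.pQ w.2.2 * P w.1 * ∏ k, a.pU k (w.1.2.2 k) w.2.2 (w.2.1 k)

variable (a : Auxiliary 𝒴)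

/-- The random variable `X`. -/
def rvX (w : a.Space 𝒳 𝒴₀) : 𝒳 := w.1.1
/-- The random variable `Y₀`. -/
def rvY₀ (w : a.Space 𝒳 𝒴₀) : 𝒴₀ := w.1.2.1
/-- The random variable `Y_k`. -/
def rvY (k : Fin K) (w : a.Space 𝒳 𝒴₀) : 𝒴 k := w.1.2.2 k
/-- The random variable `U_k`. -/
def rvU (k : Fin K) (w : a.Space 𝒳 𝒴₀) : Fin (a.cardU k) := w.2.1 k
/-- The random variable `Q`. -/
def rvQ (w : a.Space 𝒳 𝒴₀) : Fin a.cardQ := w.2.2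
/-- The tuple `Y_S = (Y_k)_{k ∈ S}`. -/
def rvYs (S : Finset (Fin K)) (w : a.Space 𝒳 𝒴₀) : ∀ k : S, 𝒴 k := fun k => a.rvY k w
/-- The tuple `U_S = (U_k)_{k ∈ S}`. -/
def rvUs (S : Finset (Fin K)) (w : a.Space 𝒳 𝒴₀) : ∀ k : S, Fin (a.cardU k) :=
  fun k => a.rvU k w

end Auxiliary

/-- The single-letter region: non-negative tuples with, for some auxiliary variables and all `S`,
`E ≤ I(U_{Sᶜ};X|Y₀,Q) + ∑_{k ∈ S} (Rₖ - I(Yₖ;Uₖ|X,Y₀,Q))`. -/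
def singleLetterRegion (P : Letter 𝒳 𝒴₀ 𝒴 → ℝ) : Set ((Fin K → ℝ) × ℝ) :=
  {RE | (∀ k, 0 ≤ RE.1 k) ∧ 0 ≤ RE.2 ∧ ∃ a : Auxiliary 𝒴, ∀ S : Finset (Fin K),
    RE.2 ≤ condMutualInfo (a.joint P) (a.rvUs Sᶜ) a.rvX (fun w => (a.rvY₀ w, a.rvQ w)) +
      ∑ k ∈ S, (RE.1 k - condMutualInfo (a.joint P) (a.rvY k) (a.rvU k)
        (fun w => (a.rvX w, a.rvY₀ w, a.rvQ w)))}

/-- The region of the Quantize-Bin-Test scheme: non-negative tuples with, for some auxiliary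
variables, `∑_{k ∈ S} Rₖ ≥ I(U_S;Y_S|U_{Sᶜ},Y₀,Q)` for all `S` and `E ≤ I(U_𝒦;X|Y₀)`. -/
def quantizeBinTestRegion (P : Letter 𝒳 𝒴₀ 𝒴 → ℝ) : Set ((Fin K → ℝ) × ℝ) :=
  {RE | (∀ k, 0 ≤ RE.1 k) ∧ 0 ≤ RE.2 ∧ ∃ a : Auxiliary 𝒴,
    (∀ S : Finset (Fin K),
      ∑ k ∈ S, RE.1 k ≥ condMutualInfo (a.joint P) (a.rvUs S) (a.rvYs S)
        (fun w => (a.rvUs Sᶜ w, a.rvY₀ w, a.rvQ w))) ∧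
    RE.2 ≤ condMutualInfo (a.joint P) (a.rvUs Finset.univ) a.rvX a.rvY₀}

end Model

end

end DistHT

/-! For test channels `W` put v(S) = I(U_{Sᶜ};X|Y₀) - ∑_{k∈S} I(Y_k;U_k|X,Y₀) (`tradeoff`). Time
sharing amounts to passing to the convex hull C of these vectors, and the single-letter region asks
for some v ∈ C with E ≤ v(S) + ∑_{k∈S} R_k for all S. A Carathéodory argument bounds the alphabets
(`tradeoff_mem_tradeoffSet`), so C is compact.

Equality with the Quantize-Bin-Test region. Conditional independence gives I(U_S;Y_S|U_{Sᶜ},Y₀) =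
v(∅) - v(S) (`binningRate_eq_sub`), so that scheme asks for E ≤ v(∅) and v(∅) - v(S) ≤ ∑_{k∈S} R_k;
these add up to the single-letter constraints. Conversely the test channels may have to change
(`mem_binningSet_of_tradeoff`). A tuple outside the closed convex set of supported tuples is
strictly separated from it by a functional ∑ c_k R_k - μE with c, μ ≥ 0. Since I(U_T;X|Y₀) is
submodular in T (`relevance_submodular`), silencing the encoders with c_k > μ and taking the greedy
vertex in decreasing order of price gives a supported tuple whose cost is at most a linear
functional of v. Weak duality bounds the cost of the given tuple below by the same functional, a
contradiction. The conditioning on Q is dropped by letting every U_k carry Q, which is independent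
of (X,Y₀).

Converse. The encoders form a deterministic channel on blocks. Data processing bounds the exponent
by the block value of v(∅) (`le_relevance_encoderChannel`), and v(∅) - v(S) is at most the total
message length of S (`tradeoff_empty_sub_le`). Splitting off one letter at a time dominates the
block vector by n times a point of C (`tradeoff_tensor_le`, `exists_le_of_mem_tradeoffSet_block`).
Compactness of C removes the vanishing errors.

Direct part. Single-letter tuples are achieved without decoding. Each encoder selects a codeword by
rejection sampling from a random codebook and sends its bin; the detector accepts if some tuple of
codewords in the bins passes a likelihood test on (u, x, y₀). Under the alternative, tuples in which
exactly the encoders of S contribute a bin-mate of their selected codeword have acceptance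
probability of exponent about v(S) + ∑_{k∈S} R_k, and the test allows at most e^{-nE} for every S
(`exists_code`, `exists_block_code`). -/

namespace DistHT

noncomputable section

/-! ### Expectations, masses and mutual information on finite spaces. -/

section Basics

variable {Ω Ω' α β γ : Type*} [Fintype Ω] [Fintype Ω']

open Classical in
/-- The indicator of a proposition, as a real number. -/
def ind (a : Prop) : ℝ := if a then 1 else 0

lemma ind_true {a : Prop} (h : a) : ind a = 1 := by simp [ind, h]

lemma ind_false {a : Prop} (h : ¬a) : ind a = 0 := by simp [ind, h]

lemma ind_nonneg (a : Prop) : 0 ≤ ind a := by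
  by_cases h : a <;> simp [ind, h]

lemma ind_le_one (a : Prop) : ind a ≤ 1 := by
  by_cases h : a <;> simp [ind, h]

lemma ind_and (a b : Prop) : ind (a ∧ b) = ind a * ind b := by
  by_cases h : a <;> by_cases h' : b <;> simp [ind, h, h']

lemma ind_congr {a b : Prop} (h : a ↔ b) : ind a = ind b := by rw [propext h]

lemma ind_mono {a b : Prop} (h : a → b) : ind a ≤ ind b := by
  by_cases h' : a
  · rw [ind_true h', ind_true (h h')]
  · rw [ind_false h']; exact ind_nonneg b

lemma ind_not (a : Prop) : ind (¬a) = 1 - ind a := by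
  by_cases h : a <;> simp [ind, h]

lemma ind_forall {ι : Type*} [Fintype ι] (a : ι → Prop) : ind (∀ i, a i) = ∏ i, ind (a i) := by
  by_cases h : ∀ i, a i
  · rw [ind_true h, Finset.prod_eq_one fun i _ => ind_true (h i)]
  · rw [ind_false h]
    push Not at h
    obtain ⟨i, hi⟩ := h
    exact (Finset.prod_eq_zero (Finset.mem_univ i) (ind_false hi)).symm

lemma sum_mul_ind [Fintype α] (a : α) (f : α → ℝ) : ∑ b, f b * ind (b = a) = f a := by
  classical
  simp [ind]

lemma sum_mul_ind' [Fintype α] (a : α) (f : α → ℝ) : ∑ b, f b * ind (a = b) = f a := by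
  classical
  simp [ind]

lemma prob_eq (p : Ω → ℝ) (s : Set Ω) : prob p s = ∑ ω, p ω * ind (ω ∈ s) := by
  classical
  simp [prob, ind, Finset.sum_filter]

lemma pmfOf_eq (p : Ω → ℝ) (A : Ω → α) (a : α) : pmfOf p A a = ∑ ω, p ω * ind (A ω = a) := by
  rw [pmfOf, prob_eq]; rfl

lemma pmfOf_nonneg {p : Ω → ℝ} (hp : ∀ ω, 0 ≤ p ω) (A : Ω → α) (a : α) : 0 ≤ pmfOf p A a := by
  rw [pmfOf_eq]
  exact Finset.sum_nonneg fun ω _ => mul_nonneg (hp ω) (ind_nonneg _)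

/-- Expectations of functions of a random variable. -/
lemma sum_pmfOf_mul [Fintype α] (p : Ω → ℝ) (A : Ω → α) (f : α → ℝ) :
    ∑ a, pmfOf p A a * f a = ∑ ω, p ω * f (A ω) := by
  simp_rw [pmfOf_eq, Finset.sum_mul]
  rw [Finset.sum_comm]
  refine Finset.sum_congr rfl fun ω _ => ?_
  rw [← sum_mul_ind' (A ω) (fun a => p ω * f a)]
  exact Finset.sum_congr rfl fun a _ => by ring

lemma sum_pmfOf [Fintype α] (p : Ω → ℝ) (A : Ω → α) : ∑ a, pmfOf p A a = ∑ ω, p ω := by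
  simpa using sum_pmfOf_mul p A (fun _ => 1)

lemma pmfOf_pmfOf [Fintype α] (p : Ω → ℝ) (f : Ω → α) (A : α → β) (b : β) :
    pmfOf (pmfOf p f) A b = pmfOf p (fun ω => A (f ω)) b := by
  rw [pmfOf_eq, sum_pmfOf_mul p f (fun a => ind (A a = b)), pmfOf_eq]

lemma pmfOf_fst_eq_sum [Fintype β] (p : Ω → ℝ) (A : Ω → α) (B : Ω → β) (a : α) :
    pmfOf p A a = ∑ b, pmfOf p (fun ω => (A ω, B ω)) (a, b) := by
  simp_rw [pmfOf_eq]
  rw [Finset.sum_comm]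
  refine Finset.sum_congr rfl fun ω _ => ?_
  rw [← sum_mul_ind' (B ω) (fun _ => p ω * ind (A ω = a))]
  refine Finset.sum_congr rfl fun b _ => ?_
  rw [mul_assoc, ← ind_and]
  simp

lemma sum_pmfOf_fst [Fintype β] (p : Ω → ℝ) (B : Ω → β) (A : Ω → α) (a : α) :
    ∑ b, pmfOf p (fun ω => (B ω, A ω)) (b, a) = pmfOf p A a := by
  rw [pmfOf_fst_eq_sum p A B]
  refine Finset.sum_congr rfl fun d _ => ?_
  rw [pmfOf_eq, pmfOf_eq]
  exact Finset.sum_congr rfl fun ω _ => by congr 1; apply ind_congr; simp [and_comm]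

/-- The probability of the event `A = A ω`. -/
def mass (p : Ω → ℝ) (A : Ω → α) (ω : Ω) : ℝ := pmfOf p A (A ω)

lemma mass_eq (p : Ω → ℝ) (A : Ω → α) (ω : Ω) : mass p A ω = ∑ ω', p ω' * ind (A ω' = A ω) :=
  pmfOf_eq p A _

lemma le_mass {p : Ω → ℝ} (hp : ∀ ω, 0 ≤ p ω) (A : Ω → α) (ω : Ω) : p ω ≤ mass p A ω := by
  rw [mass_eq]
  calc p ω = p ω * ind (A ω = A ω) := by rw [ind_true rfl, mul_one]
    _ ≤ _ := Finset.single_le_sum (f := fun ω' => p ω' * ind (A ω' = A ω))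
      (fun ω' _ => mul_nonneg (hp ω') (ind_nonneg _)) (Finset.mem_univ ω)

lemma mass_pos {p : Ω → ℝ} (hp : ∀ ω, 0 ≤ p ω) (A : Ω → α) {ω : Ω} (h : p ω ≠ 0) :
    0 < mass p A ω :=
  lt_of_lt_of_le (lt_of_le_of_ne (hp ω) h.symm) (le_mass hp A ω)

/-- Masses depend on a random variable only through its level sets on the support. This is how
rearrangements of tuples are handled throughout. -/
lemma mass_congr {p : Ω → ℝ} {A : Ω → α} {B : Ω → β} {ω : Ω}
    (h : ∀ ω', p ω' ≠ 0 → (A ω' = A ω ↔ B ω' = B ω)) : mass p A ω = mass p B ω := by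
  rw [mass_eq, mass_eq]
  refine Finset.sum_congr rfl fun ω' _ => ?_
  by_cases h0 : p ω' = 0
  · simp [h0]
  · rw [ind_congr (h ω' h0)]

lemma mass_mono {p : Ω → ℝ} (hp : ∀ ω, 0 ≤ p ω) {A : Ω → α} {B : Ω → β} {ω : Ω}
    (h : ∀ ω', A ω' = A ω → B ω' = B ω) : mass p A ω ≤ mass p B ω := by
  rw [mass_eq, mass_eq]
  exact Finset.sum_le_sum fun ω' _ => mul_le_mul_of_nonneg_left (ind_mono (h ω')) (hp ω')

/-- Conditional mutual information as the expectation of the information density. -/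
lemma condMutualInfo_eq_sum [Fintype α] [Fintype β] [Fintype γ] (p : Ω → ℝ)
    (A : Ω → α) (B : Ω → β) (C : Ω → γ) :
    condMutualInfo p A B C = ∑ ω, p ω * Real.log (mass p (fun ω => (A ω, B ω, C ω)) ω *
      mass p C ω / (mass p (fun ω => (A ω, C ω)) ω * mass p (fun ω => (B ω, C ω)) ω)) := by
  have := sum_pmfOf_mul p (fun ω => (A ω, B ω, C ω)) (fun t =>
    Real.log (pmfOf p (fun ω => (A ω, B ω, C ω)) t * pmfOf p C t.2.2 /
        (pmfOf p (fun ω => (A ω, C ω)) (t.1, t.2.2) *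
          pmfOf p (fun ω => (B ω, C ω)) (t.2.1, t.2.2))))
  unfold mass
  rw [← this, condMutualInfo, Fintype.sum_prod_type]
  simp_rw [Fintype.sum_prod_type]

lemma condMutualInfo_pmfOf {Ω'' : Type*} [Fintype Ω''] [Fintype α] [Fintype β] [Fintype γ]
    (p : Ω → ℝ) (f : Ω → Ω'')
    (A : Ω'' → α) (B : Ω'' → β) (C : Ω'' → γ) :
    condMutualInfo (pmfOf p f) A B C =
      condMutualInfo p (fun ω => A (f ω)) (fun ω => B (f ω)) (fun ω => C (f ω)) := by
  simp_rw [condMutualInfo, pmfOf_pmfOf]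

lemma condMutualInfo_congr {α' β' γ' : Type*} [Fintype α] [Fintype β] [Fintype γ] [Fintype α']
    [Fintype β'] [Fintype γ'] {p : Ω → ℝ} {A : Ω → α} {B : Ω → β} {C : Ω → γ} {A' : Ω → α'}
    {B' : Ω → β'} {C' : Ω → γ'} (hA : ∀ ω ω', A ω = A ω' ↔ A' ω = A' ω')
    (hB : ∀ ω ω', B ω = B ω' ↔ B' ω = B' ω') (hC : ∀ ω ω', C ω = C ω' ↔ C' ω = C' ω') :
    condMutualInfo p A B C = condMutualInfo p A' B' C' := by
  rw [condMutualInfo_eq_sum, condMutualInfo_eq_sum]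
  refine Finset.sum_congr rfl fun ω _ => ?_
  rw [mass_congr (A := fun ω => (A ω, B ω, C ω)) (B := fun ω => (A' ω, B' ω, C' ω)),
    mass_congr (A := C) (B := C'),
    mass_congr (A := fun ω => (A ω, C ω)) (B := fun ω => (A' ω, C' ω)),
    mass_congr (A := fun ω => (B ω, C ω)) (B := fun ω => (B' ω, C' ω))]
  all_goals intro ω' _; simp [hA, hB, hC]

/-- The law of `(f, g)` is a mixture of the laws `r q` with weights `c q`, and the mixture survives
processing of the first component. -/
lemma pmfOf_mixture {Ω'' Q δ : Type*} [Fintype Ω''] [Fintype Q] {p : Ω → ℝ} {f : Ω → Ω''}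
    {g : Ω → Q} {c : Q → ℝ} {r : Q → Ω'' → ℝ}
    (h : ∀ ω q, pmfOf p (fun w => (f w, g w)) (ω, q) = c q * r q ω) (D : Ω'' → δ) (d : δ) (q : Q) :
    pmfOf p (fun w => (D (f w), g w)) (d, q) = c q * pmfOf (r q) D d := by
  have h1 := pmfOf_pmfOf p (fun w => (f w, g w)) (fun v => (D v.1, v.2)) (d, q)
  rw [← h1, pmfOf_eq, Fintype.sum_prod_type, pmfOf_eq, Finset.mul_sum]
  refine Finset.sum_congr rfl fun ω _ => ?_
  rw [← mul_assoc, ← h, ← sum_mul_ind q (fun q' => pmfOf p (fun w => (f w, g w)) (ω, q') *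
    ind (D ω = d))]
  refine Finset.sum_congr rfl fun q' _ => ?_
  rw [mul_assoc, ← ind_and]; simp

lemma pmfOf_mixture_pair {Ω'' Q δ : Type*} [Fintype Ω''] [Fintype Q] {p : Ω → ℝ} {f : Ω → Ω''}
    {g : Ω → Q} {c : Q → ℝ} {r : Q → Ω'' → ℝ}
    (h : ∀ ω q, pmfOf p (fun w => (f w, g w)) (ω, q) = c q * r q ω) (D : Ω'' → δ) (C : Ω'' → γ)
    (d : δ) (c' : γ) (q : Q) :
    pmfOf p (fun w => (D (f w), (C (f w), g w))) (d, (c', q)) =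
      c q * pmfOf (r q) (fun w => (D w, C w)) (d, c') := by
  rw [← pmfOf_mixture h (fun w => (D w, C w)) (d, c') q, pmfOf_eq, pmfOf_eq]
  refine Finset.sum_congr rfl fun ω _ => ?_
  congr 1; apply ind_congr; simp; tauto

/-- Conditioning additionally on a mixture variable averages the conditional mutual information. -/
lemma condMutualInfo_mixture {Ω'' Q : Type*} [Fintype Ω''] [Fintype Q] [Fintype α] [Fintype β]
    [Fintype γ] (p : Ω → ℝ) (f : Ω → Ω'') (g : Ω → Q) (c : Q → ℝ) (r : Q → Ω'' → ℝ)
    (h : ∀ ω q, pmfOf p (fun w => (f w, g w)) (ω, q) = c q * r q ω)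
    (A : Ω'' → α) (B : Ω'' → β) (C : Ω'' → γ) :
    condMutualInfo p (fun w => A (f w)) (fun w => B (f w)) (fun w => (C (f w), g w)) =
      ∑ q, c q * condMutualInfo (r q) A B C := by
  have key3 : ∀ a b c' q, pmfOf p (fun w => (A (f w), B (f w), (C (f w), g w))) (a, b, (c', q)) =
      c q * pmfOf (r q) (fun w => (A w, B w, C w)) (a, b, c') := by
    intro a b c' q
    rw [← pmfOf_mixture h (fun w => (A w, B w, C w)) (a, b, c') q, pmfOf_eq, pmfOf_eq]
    refine Finset.sum_congr rfl fun ω _ => ?_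
    congr 1; apply ind_congr; simp; tauto
  simp_rw [condMutualInfo, Fintype.sum_prod_type, key3, pmfOf_mixture_pair h,
    pmfOf_mixture h, Finset.mul_sum]
  have : ∀ (F : α → β → γ → Q → ℝ), ∑ a, ∑ b, ∑ c', ∑ q, F a b c' q =
      ∑ q, ∑ a, ∑ b, ∑ c', F a b c' q := by
    intro F
    symm
    rw [Finset.sum_comm]
    refine Finset.sum_congr rfl fun a _ => ?_
    rw [Finset.sum_comm]
    exact Finset.sum_congr rfl fun b _ => Finset.sum_comm
  rw [this]
  refine Finset.sum_congr rfl fun q _ => Finset.sum_congr rfl fun a _ =>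
    Finset.sum_congr rfl fun b _ => Finset.sum_congr rfl fun c' _ => ?_
  -- The weight `c q` occurs twice in the numerator and twice in the denominator of the logarithm
  -- and cancels, unless it vanishes and kills the whole term.
  by_cases hq : c q = 0
  · simp [hq]
  rw [mul_assoc]
  congr 3
  rw [show ∀ x y z w : ℝ, c q * x * (c q * y) / (c q * z * (c q * w)) =
    (c q * c q) * (x * y) / ((c q * c q) * (z * w)) by intros; ring_nf,
    mul_div_mul_left _ _ (mul_ne_zero hq hq)]

end Basics

/-! ### Entropy calculus. -/

section Entropy

variable {Ω α β γ : Type*} [Fintype Ω]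

/-- The entropy of the random variable `A`, as an expectation over the sample space. -/
def ent (p : Ω → ℝ) (A : Ω → α) : ℝ := -∑ ω, p ω * Real.log (mass p A ω)

lemma ent_congr {p : Ω → ℝ} {A : Ω → α} {B : Ω → β}
    (h : ∀ ω ω', p ω ≠ 0 → p ω' ≠ 0 → (A ω' = A ω ↔ B ω' = B ω)) : ent p A = ent p B := by
  unfold ent
  congr 1
  refine Finset.sum_congr rfl fun ω _ => ?_
  by_cases h0 : p ω = 0
  · simp [h0]
  · rw [mass_congr fun ω' h' => h ω ω' h0 h']

/-- On the support all four masses are positive, so the logarithm splits; off the support the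
integrand is zero. -/
lemma condMutualInfo_eq_ent [Fintype α] [Fintype β] [Fintype γ] {p : Ω → ℝ} (hp : ∀ ω, 0 ≤ p ω)
    (A : Ω → α) (B : Ω → β) (C : Ω → γ) :
    condMutualInfo p A B C = ent p (fun ω => (A ω, C ω)) + ent p (fun ω => (B ω, C ω)) -
      ent p (fun ω => (A ω, B ω, C ω)) - ent p C := by
  rw [condMutualInfo_eq_sum]
  unfold ent
  rw [show ∀ a b c d : ℝ, -a + -b - -c - -d = c + d - (a + b) by intros; ring,
    ← Finset.sum_add_distrib, ← Finset.sum_add_distrib, ← Finset.sum_sub_distrib]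
  refine Finset.sum_congr rfl fun ω _ => ?_
  by_cases h0 : p ω = 0
  · simp [h0]
  rw [Real.log_div, Real.log_mul, Real.log_mul]
  · ring
  all_goals first | exact mul_ne_zero (mass_pos hp _ h0).ne' (mass_pos hp _ h0).ne' |
    exact (mass_pos hp _ h0).ne'

lemma ent_eq_sum_negMulLog [Fintype α] (p : Ω → ℝ) (A : Ω → α) :
    ent p A = ∑ a, Real.negMulLog (pmfOf p A a) := by
  have := sum_pmfOf_mul p A (fun a => Real.log (pmfOf p A a))
  unfold ent mass
  rw [← this, ← Finset.sum_neg_distrib]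
  exact Finset.sum_congr rfl fun a _ => by simp [Real.negMulLog]

/-- If `P(A) = P(B) c` on the support then `H(A) = H(B) - 𝔼 log c`. -/
lemma ent_eq_sub_of_mass {p : Ω → ℝ} (hp : ∀ ω, 0 ≤ p ω) {A : Ω → α} {B : Ω → β} {c : Ω → ℝ}
    (h : ∀ ω, p ω ≠ 0 → mass p A ω = mass p B ω * c ω) :
    ent p A = ent p B - ∑ ω, p ω * Real.log (c ω) := by
  unfold ent
  rw [← neg_add', ← Finset.sum_add_distrib]
  congr 1
  refine Finset.sum_congr rfl fun ω _ => ?_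
  by_cases h0 : p ω = 0
  · simp [h0]
  have hA := (mass_pos hp A h0).ne'
  have hB := (mass_pos hp B h0).ne'
  have hc : c ω ≠ 0 := fun hc => hA (by rw [h ω h0, hc, mul_zero])
  rw [h ω h0, Real.log_mul hB hc]; ring

/-- The form in which independence enters entropy computations: a product identity between masses
becomes an additive one between entropies. -/
lemma ent_add_eq_of_mass {δ : Type*} {p : Ω → ℝ} (hp : ∀ ω, 0 ≤ p ω) {A : Ω → α} {B : Ω → β}
    {C : Ω → γ} {D : Ω → δ}
    (h : ∀ ω, p ω ≠ 0 → mass p A ω * mass p B ω = mass p C ω * mass p D ω) :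
    ent p A + ent p B = ent p C + ent p D := by
  unfold ent
  rw [← neg_add, ← neg_add, ← Finset.sum_add_distrib, ← Finset.sum_add_distrib]
  congr 1
  refine Finset.sum_congr rfl fun ω _ => ?_
  by_cases h0 : p ω = 0
  · simp [h0]
  rw [← mul_add, ← mul_add, ← Real.log_mul, ← Real.log_mul, h ω h0]
  all_goals exact (mass_pos hp _ h0).ne'

/-- The level sets of a function of `B` are larger, hence have larger mass. -/
lemma ent_le_of_kernel {p : Ω → ℝ} (hp : ∀ ω, 0 ≤ p ω) {A : Ω → α} {B : Ω → β}
    (h : ∀ ω ω', B ω' = B ω → A ω' = A ω) : ent p A ≤ ent p B := by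
  unfold ent
  rw [neg_le_neg_iff]
  refine Finset.sum_le_sum fun ω _ => ?_
  by_cases h0 : p ω = 0
  · simp [h0]
  exact mul_le_mul_of_nonneg_left (Real.log_le_log (mass_pos hp _ h0) (mass_mono hp (h ω))) (hp ω)

/-- The inequality log x ≥ 1 - 1/x is applied to each term, and the resulting lower bounds add up to
zero. -/
lemma condMutualInfo_nonneg [Fintype α] [Fintype β] [Fintype γ] {p : Ω → ℝ} (hp : ∀ ω, 0 ≤ p ω)
    (A : Ω → α) (B : Ω → β) (C : Ω → γ) : 0 ≤ condMutualInfo p A B C := by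
  have hterm : ∀ a b c,
      pmfOf p (fun ω => (A ω, B ω, C ω)) (a, b, c) -
        pmfOf p (fun ω => (A ω, C ω)) (a, c) * pmfOf p (fun ω => (B ω, C ω)) (b, c) /
          pmfOf p C c ≤
      pmfOf p (fun ω => (A ω, B ω, C ω)) (a, b, c) *
      Real.log (pmfOf p (fun ω => (A ω, B ω, C ω)) (a, b, c) * pmfOf p C c /
        (pmfOf p (fun ω => (A ω, C ω)) (a, c) * pmfOf p (fun ω => (B ω, C ω)) (b, c))) := by
    intro a b c
    have h1 := pmfOf_nonneg hp (fun ω => (A ω, B ω, C ω)) (a, b, c)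
    have h2 := pmfOf_nonneg hp (fun ω => (A ω, C ω)) (a, c)
    have h3 := pmfOf_nonneg hp (fun ω => (B ω, C ω)) (b, c)
    have h4 := pmfOf_nonneg hp C c
    rcases h1.eq_or_lt with h0 | h0
    · rw [← h0]; simp only [zero_sub, zero_mul, Left.neg_nonpos_iff]; positivity
    -- A triple of positive probability is hit by a point of the support, which makes the pairwise
    -- masses positive as well.
    obtain ⟨ω, hω, hpω⟩ : ∃ ω, (A ω = a ∧ B ω = b ∧ C ω = c) ∧ p ω ≠ 0 := by
      by_contra hcon
      push Not at hcon
      rw [pmfOf_eq, Finset.sum_eq_zero] at h0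
      · exact lt_irrefl _ h0
      intro ω _
      by_cases hω : A ω = a ∧ B ω = b ∧ C ω = c
      · rw [hcon ω hω, zero_mul]
      · rw [ind_false (by simpa using hω), mul_zero]
    obtain ⟨rfl, rfl, rfl⟩ := hω
    have h2' := mass_pos hp (fun ω => (A ω, C ω)) hpω
    have h3' := mass_pos hp (fun ω => (B ω, C ω)) hpω
    have h4' := mass_pos hp C hpω
    unfold mass at h2' h3' h4'
    have hpos : 0 < pmfOf p (fun ω => (A ω, B ω, C ω)) (A ω, B ω, C ω) * pmfOf p C (C ω) /
        (pmfOf p (fun ω => (A ω, C ω)) (A ω, C ω) *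
          pmfOf p (fun ω => (B ω, C ω)) (B ω, C ω)) := by positivity
    have := Real.one_sub_inv_le_log_of_pos hpos
    calc _ = pmfOf p (fun ω => (A ω, B ω, C ω)) (A ω, B ω, C ω) * (1 -
        (pmfOf p (fun ω => (A ω, B ω, C ω)) (A ω, B ω, C ω) * pmfOf p C (C ω) /
        (pmfOf p (fun ω => (A ω, C ω)) (A ω, C ω) *
          pmfOf p (fun ω => (B ω, C ω)) (B ω, C ω)))⁻¹) := by field_simp
      _ ≤ _ := mul_le_mul_of_nonneg_left this h1
  have hsum : ∑ a, ∑ b, ∑ c, (pmfOf p (fun ω => (A ω, B ω, C ω)) (a, b, c) -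
        pmfOf p (fun ω => (A ω, C ω)) (a, c) * pmfOf p (fun ω => (B ω, C ω)) (b, c) /
          pmfOf p C c) = 0 := by
    simp_rw [Finset.sum_sub_distrib]
    have e1 : ∑ a, ∑ b, ∑ c, pmfOf p (fun ω => (A ω, B ω, C ω)) (a, b, c) = ∑ ω, p ω := by
      rw [← sum_pmfOf p (fun ω => (A ω, B ω, C ω)), Fintype.sum_prod_type]
      simp_rw [Fintype.sum_prod_type]
    have e3 : ∑ a, ∑ b, ∑ c, pmfOf p (fun ω => (A ω, C ω)) (a, c) *
        pmfOf p (fun ω => (B ω, C ω)) (b, c) / pmfOf p C c = ∑ ω, p ω := by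
      rw [← sum_pmfOf p C]
      rw [Finset.sum_congr rfl fun a _ => Finset.sum_comm, Finset.sum_comm]
      refine Finset.sum_congr rfl fun c _ => ?_
      simp_rw [mul_div_assoc, ← Finset.mul_sum, ← Finset.sum_div, sum_pmfOf_fst p B, ← Finset.sum_mul, sum_pmfOf_fst p A]
      by_cases hc : pmfOf p C c = 0
      · simp [hc]
      · field_simp
    rw [e1, e3, sub_self]
  rw [← hsum]
  exact Finset.sum_le_sum fun a _ => Finset.sum_le_sum fun b _ => Finset.sum_le_sum fun c _ =>
    hterm a b c

/-- Submodularity of entropy. -/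
lemma ent_submodular [Finite α] [Finite β] [Finite γ] {p : Ω → ℝ} (hp : ∀ ω, 0 ≤ p ω)
    (A : Ω → α) (B : Ω → β) (C : Ω → γ) :
    ent p (fun ω => (A ω, B ω, C ω)) + ent p C ≤
      ent p (fun ω => (A ω, C ω)) + ent p (fun ω => (B ω, C ω)) := by
  cases nonempty_fintype α
  cases nonempty_fintype β
  cases nonempty_fintype γ
  have h1 := condMutualInfo_nonneg hp A B C
  rw [condMutualInfo_eq_ent hp] at h1
  linarith

lemma ent_const_eq_zero {p : Ω → ℝ} (h1 : ∑ ω, p ω = 1) {A : Ω → α}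
    (hA : ∀ ω ω', A ω = A ω') : ent p A = 0 := by
  unfold ent
  rw [neg_eq_zero]
  refine Finset.sum_eq_zero fun ω _ => ?_
  rw [mass_eq, Finset.sum_congr rfl (fun ω' _ => by rw [ind_true (hA ω' ω), mul_one]), h1]
  simp

lemma ent_le_log_card [Fintype α] {p : Ω → ℝ} (hp : ∀ ω, 0 ≤ p ω) (h1 : ∑ ω, p ω = 1)
    (A : Ω → α) : ent p A ≤ Real.log (Fintype.card α) := by
  have hα : 0 < Fintype.card α := by
    rw [Fintype.card_pos_iff]
    by_contra hc
    rw [not_nonempty_iff] at hc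
    have : IsEmpty Ω := ⟨fun ω => hc.false (A ω)⟩
    simp at h1
  have hN : (0 : ℝ) < Fintype.card α := by exact_mod_cast hα
  have h2 : ∑ a, (1 / (Fintype.card α : ℝ) - pmfOf p A a) = 0 := by
    rw [Finset.sum_sub_distrib, sum_pmfOf, h1]
    simp [hN.ne']
  -- Gibbs' inequality against the uniform law, term by term; the correction 1/N - P(a) has total
  -- zero.
  have h3 : ∀ a, Real.negMulLog (pmfOf p A a) ≤ pmfOf p A a * Real.log (Fintype.card α) +
      (1 / (Fintype.card α : ℝ) - pmfOf p A a) := by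
    intro a
    rcases (pmfOf_nonneg hp A a).eq_or_lt with h0 | h0
    · rw [← h0]; simp
    have := Real.one_sub_inv_le_log_of_pos (mul_pos h0 hN)
    rw [Real.log_mul h0.ne' hN.ne'] at this
    have h4 := mul_le_mul_of_nonneg_left this h0.le
    have h5 : pmfOf p A a * (1 - (pmfOf p A a * (Fintype.card α : ℝ))⁻¹) =
      pmfOf p A a - 1 / (Fintype.card α : ℝ) := by field_simp
    rw [h5] at h4
    unfold Real.negMulLog
    linarith
  rw [ent_eq_sum_negMulLog]
  calc _ ≤ ∑ a, (pmfOf p A a * Real.log (Fintype.card α) +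
      (1 / (Fintype.card α : ℝ) - pmfOf p A a)) := Finset.sum_le_sum fun a _ => h3 a
    _ = _ := by rw [Finset.sum_add_distrib, h2, ← Finset.sum_mul, sum_pmfOf, h1]; ring

end Entropy

end

end DistHT

namespace DistHT

noncomputable section

/-! ### Sources with conditionally independent observations, followed by local channels. -/

section Channels

variable {K : ℕ} {𝒳 𝒴₀ : Type*} {𝒴 𝒰 : Fin K → Type*}

/-- The source with marginal `p₀` of `(X, Y₀)` and conditionally independent observations with
transition kernels `κ k`. -/
def source (p₀ : 𝒳 × 𝒴₀ → ℝ) (κ : ∀ k, 𝒳 × 𝒴₀ → 𝒴 k → ℝ) : Letter 𝒳 𝒴₀ 𝒴 → ℝ := fun w =>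
  p₀ (w.1, w.2.1) * ∏ k, κ k (w.1, w.2.1) (w.2.2 k)

/-- The joint pmf of `((X, Y₀, Y), U)` when `U_k` is produced from `Y_k` by the channel `W k`. -/
def channelJoint (P : Letter 𝒳 𝒴₀ 𝒴 → ℝ) (W : ∀ k, 𝒴 k → 𝒰 k → ℝ) :
    Letter 𝒳 𝒴₀ 𝒴 × (∀ k, 𝒰 k) → ℝ := fun w =>
  P w.1 * ∏ k, W k (w.1.2.2 k) (w.2 k)

variable [Fintype 𝒳] [Fintype 𝒴₀] [∀ k, Fintype (𝒴 k)] [∀ k, Fintype (𝒰 k)]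

/-- The data of a source are stochastic. -/
structure IsSource (p₀ : 𝒳 × 𝒴₀ → ℝ) (κ : ∀ k, 𝒳 × 𝒴₀ → 𝒴 k → ℝ) : Prop where
  base_mem : p₀ ∈ stdSimplex ℝ (𝒳 × 𝒴₀)
  kernel_mem : ∀ k z, κ k z ∈ stdSimplex ℝ (𝒴 k)

/-- Each `W k` is a stochastic matrix. -/
def IsChannel (W : ∀ k, 𝒴 k → 𝒰 k → ℝ) : Prop := ∀ k y, W k y ∈ stdSimplex ℝ (𝒰 k)

lemma sum_pi_prod {K : ℕ} {α : Fin K → Type*} [∀ k, Fintype (α k)] (f : ∀ k, α k → ℝ) :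
    ∑ a : ∀ k, α k, ∏ k, f k (a k) = ∏ k, ∑ a, f k a := by
  classical
  rw [Finset.prod_univ_sum, Fintype.piFinset_univ]

omit [Fintype 𝒳] [Fintype 𝒴₀] in
lemma sum_pi_pi_prod (f : ∀ k, 𝒴 k → 𝒰 k → ℝ) :
    ∑ y : ∀ k, 𝒴 k, ∑ u : ∀ k, 𝒰 k, ∏ k, f k (y k) (u k) = ∏ k, ∑ y, ∑ u, f k y u := by
  rw [← sum_pi_prod]
  exact Finset.sum_congr rfl fun y _ => sum_pi_prod _

/-- Expectations of products of functions of `(X, Y₀)` and of the pairs `(Y_k, U_k)`. -/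
lemma sum_channelJoint_mul (p₀ : 𝒳 × 𝒴₀ → ℝ) (κ : ∀ k, 𝒳 × 𝒴₀ → 𝒴 k → ℝ)
    (W : ∀ k, 𝒴 k → 𝒰 k → ℝ) (h : 𝒳 × 𝒴₀ → ℝ) (g : ∀ k, 𝒴 k → 𝒰 k → ℝ) :
    ∑ ω, channelJoint (source p₀ κ) W ω *
      (h (ω.1.1, ω.1.2.1) * ∏ k, g k (ω.1.2.2 k) (ω.2 k)) =
    ∑ z, p₀ z * h z * ∏ k, ∑ y, ∑ u, κ k z y * W k y u * g k y u := by
  rw [Fintype.sum_prod_type, Fintype.sum_prod_type, Fintype.sum_prod_type]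
  refine Finset.sum_congr rfl fun x _ => ?_
  rw [Fintype.sum_prod_type]
  refine Finset.sum_congr rfl fun y₀ _ => ?_
  rw [← sum_pi_pi_prod, Finset.mul_sum]
  refine Finset.sum_congr rfl fun y _ => ?_
  rw [Finset.mul_sum]
  refine Finset.sum_congr rfl fun u _ => ?_
  simp only [channelJoint, source, Finset.prod_mul_distrib]
  ring

/-- The output kernel of the channel: the conditional pmf of `U_k` given `(X, Y₀)`. -/
def outputKernel (κ : ∀ k, 𝒳 × 𝒴₀ → 𝒴 k → ℝ) (W : ∀ k, 𝒴 k → 𝒰 k → ℝ) (k : Fin K)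
    (z : 𝒳 × 𝒴₀) (u : 𝒰 k) : ℝ := ∑ y, κ k z y * W k y u

/-- The joint pmf of `(U_T, Y₀)`. -/
def outputMarginal (p₀ : 𝒳 × 𝒴₀ → ℝ) (κ : ∀ k, 𝒳 × 𝒴₀ → 𝒴 k → ℝ) (W : ∀ k, 𝒴 k → 𝒰 k → ℝ)
    (T : Finset (Fin K)) (u : ∀ k, 𝒰 k) (y₀ : 𝒴₀) : ℝ :=
  ∑ x, p₀ (x, y₀) * ∏ k ∈ T, outputKernel κ W k (x, y₀) (u k)

section Local

variable {p₀ : 𝒳 × 𝒴₀ → ℝ} {κ : ∀ k, 𝒳 × 𝒴₀ → 𝒴 k → ℝ} {W : ∀ k, 𝒴 k → 𝒰 k → ℝ}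

lemma channelJoint_nonneg (hs : IsSource p₀ κ) (hW : IsChannel W)
    (ω : Letter 𝒳 𝒴₀ 𝒴 × (∀ k, 𝒰 k)) : 0 ≤ channelJoint (source p₀ κ) W ω :=
  mul_nonneg (mul_nonneg (hs.base_mem.1 _) (Finset.prod_nonneg fun k _ => (hs.kernel_mem k _).1 _))
    (Finset.prod_nonneg fun k _ => (hW k _).1 _)

lemma sum_local_none (hs : IsSource p₀ κ) (hW : IsChannel W) (k : Fin K) (z : 𝒳 × 𝒴₀) :
    ∑ y, ∑ u, κ k z y * W k y u = 1 := by
  simp_rw [← Finset.mul_sum, (hW k _).2, mul_one, (hs.kernel_mem k z).2]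

lemma sum_channelJoint (hs : IsSource p₀ κ) (hW : IsChannel W) :
    ∑ ω, channelJoint (source p₀ κ) W ω = 1 := by
  have := sum_channelJoint_mul p₀ κ W (fun _ => 1) (fun _ _ _ => 1)
  simp only [mul_one, Finset.prod_const_one, sum_local_none hs hW] at this
  rw [this, hs.base_mem.2]

open Classical in
/-- The factor that encoder `k` contributes to the probability of `(Y_S, U_T) = (y, u)`
given `(X, Y₀) = z`. -/
def localFactor (κ : ∀ k, 𝒳 × 𝒴₀ → 𝒴 k → ℝ) (W : ∀ k, 𝒴 k → 𝒰 k → ℝ) (S T : Set (Fin K))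
    (y : ∀ k, 𝒴 k) (u : ∀ k, 𝒰 k) (z : 𝒳 × 𝒴₀) (k : Fin K) : ℝ :=
  if k ∈ S then (if k ∈ T then κ k z (y k) * W k (y k) (u k) else κ k z (y k))
  else (if k ∈ T then outputKernel κ W k z (u k) else 1)

/-- Unobserved coordinates are summed out: rows of `κ` and `W` have total one, and an observed
output with unobserved input leaves the output kernel. -/
lemma sum_local_eq (hs : IsSource p₀ κ) (hW : IsChannel W) (S T : Set (Fin K))
    (y : ∀ k, 𝒴 k) (u : ∀ k, 𝒰 k) (z : 𝒳 × 𝒴₀) (k : Fin K) :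
    ∑ y', ∑ u', κ k z y' * W k y' u' * ind ((k ∈ S → y' = y k) ∧ (k ∈ T → u' = u k)) =
      localFactor κ W S T y u z k := by
  unfold localFactor
  by_cases hS : k ∈ S <;> by_cases hT : k ∈ T <;>
    simp only [hS, hT, true_imp_iff, false_imp_iff, and_true, true_and, if_true, if_false,
      ind_true trivial, mul_one]
  · simp_rw [ind_and, mul_comm (ind (_ = y k)), ← mul_assoc, ← Finset.sum_mul]
    rw [sum_mul_ind (y k) (fun y' => ∑ u', κ k z y' * W k y' u' * ind (u' = u k)),
      sum_mul_ind (u k) (fun u' => κ k z (y k) * W k (y k) u')]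
  · simp_rw [← Finset.sum_mul]
    rw [sum_mul_ind (y k) (fun y' => ∑ u', κ k z y' * W k y' u'), ← Finset.mul_sum, (hW k _).2,
      mul_one]
  · rw [Finset.sum_comm]
    simp_rw [← Finset.sum_mul]
    rw [sum_mul_ind (u k) (fun u' => ∑ y', κ k z y' * W k y' u')]
    rfl
  · exact sum_local_none hs hW k z

/-- The probability of a value of a function of `(X, Y₀)` together with `(Y_S, U_T)`. -/
lemma mass_channelJoint {α : Type*} (hs : IsSource p₀ κ) (hW : IsChannel W) (S T : Set (Fin K))
    (A : Letter 𝒳 𝒴₀ 𝒴 × (∀ k, 𝒰 k) → α) (ω : Letter 𝒳 𝒴₀ 𝒴 × (∀ k, 𝒰 k))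
    (H : 𝒳 × 𝒴₀ → Prop)
    (hA : ∀ ω', A ω' = A ω ↔ H (ω'.1.1, ω'.1.2.1) ∧
      ∀ k, (k ∈ S → ω'.1.2.2 k = ω.1.2.2 k) ∧ (k ∈ T → ω'.2 k = ω.2 k)) :
    mass (channelJoint (source p₀ κ) W) A ω =
      ∑ z, p₀ z * ind (H z) * ∏ k, localFactor κ W S T ω.1.2.2 ω.2 z k := by
  rw [mass_eq]
  simp_rw [fun ω' => ind_congr (hA ω'), ind_and, ind_forall]
  have := sum_channelJoint_mul p₀ κ W (fun z => ind (H z)) (fun k y' u' =>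
    ind ((k ∈ S → y' = ω.1.2.2 k) ∧ (k ∈ T → u' = ω.2 k)))
  simp_rw [sum_local_eq hs hW] at this
  exact this

lemma mass_channelJoint_pair {α : Type*} (hs : IsSource p₀ κ) (hW : IsChannel W)
    (S T : Set (Fin K)) (A : Letter 𝒳 𝒴₀ 𝒴 × (∀ k, 𝒰 k) → α)
    (ω : Letter 𝒳 𝒴₀ 𝒴 × (∀ k, 𝒰 k))
    (hA : ∀ ω', A ω' = A ω ↔ (ω'.1.1 = ω.1.1 ∧ ω'.1.2.1 = ω.1.2.1) ∧
      ∀ k, (k ∈ S → ω'.1.2.2 k = ω.1.2.2 k) ∧ (k ∈ T → ω'.2 k = ω.2 k)) :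
    mass (channelJoint (source p₀ κ) W) A ω =
      p₀ (ω.1.1, ω.1.2.1) * ∏ k, localFactor κ W S T ω.1.2.2 ω.2 (ω.1.1, ω.1.2.1) k := by
  rw [mass_channelJoint hs hW S T A ω (fun z => z = (ω.1.1, ω.1.2.1))
    (fun ω' => by rw [hA, Prod.mk.injEq])]
  rw [← sum_mul_ind (ω.1.1, ω.1.2.1) (fun z => p₀ z *
    ∏ k, localFactor κ W S T ω.1.2.2 ω.2 z k)]
  exact Finset.sum_congr rfl fun z _ => by ring

lemma mass_channelJoint_side {α : Type*} (hs : IsSource p₀ κ) (hW : IsChannel W)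
    (S T : Set (Fin K)) (A : Letter 𝒳 𝒴₀ 𝒴 × (∀ k, 𝒰 k) → α)
    (ω : Letter 𝒳 𝒴₀ 𝒴 × (∀ k, 𝒰 k))
    (hA : ∀ ω', A ω' = A ω ↔ ω'.1.2.1 = ω.1.2.1 ∧
      ∀ k, (k ∈ S → ω'.1.2.2 k = ω.1.2.2 k) ∧ (k ∈ T → ω'.2 k = ω.2 k)) :
    mass (channelJoint (source p₀ κ) W) A ω =
      ∑ x, p₀ (x, ω.1.2.1) * ∏ k, localFactor κ W S T ω.1.2.2 ω.2 (x, ω.1.2.1) k := by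
  rw [mass_channelJoint hs hW S T A ω (fun z => z.2 = ω.1.2.1) hA, Fintype.sum_prod_type]
  refine Finset.sum_congr rfl fun x _ => ?_
  rw [← sum_mul_ind (ω.1.2.1) (fun y₀ => p₀ (x, y₀) *
    ∏ k, localFactor κ W S T ω.1.2.2 ω.2 (x, y₀) k)]
  exact Finset.sum_congr rfl fun z _ => by ring

omit [Fintype 𝒳] [Fintype 𝒴₀] [∀ k, Fintype (𝒰 k)] in
lemma prod_localFactor_empty (T : Finset (Fin K)) (y : ∀ k, 𝒴 k) (u : ∀ k, 𝒰 k) (z : 𝒳 × 𝒴₀) :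
    ∏ k, localFactor κ W ∅ T y u z k = ∏ k ∈ T, outputKernel κ W k z (u k) := by
  classical
  simp [localFactor, Finset.prod_ite_mem]

omit [Fintype 𝒳] [Fintype 𝒴₀] [∀ k, Fintype (𝒰 k)] in
lemma prod_localFactor_singleton (k : Fin K) (T : Set (Fin K)) (hT : T ⊆ {k})
    (y : ∀ k, 𝒴 k) (u : ∀ k, 𝒰 k) (z : 𝒳 × 𝒴₀) :
    ∏ l, localFactor κ W {k} T y u z l = localFactor κ W {k} T y u z k := by
  refine Finset.prod_eq_single k (fun l _ hl => ?_) (by simp)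
  have : l ∉ T := fun h => hl (hT h)
  simp [localFactor, hl, this]

end Local

end Channels

end

end DistHT

namespace DistHT

noncomputable section

/-! ### The tradeoff vector, its relation to binning, and submodularity. -/

section Tradeoff

variable {K : ℕ} {𝒳 𝒴₀ : Type*} {𝒴 𝒰 : Fin K → Type*}
variable [Fintype 𝒳] [Fintype 𝒴₀] [∀ k, Fintype (𝒴 k)] [∀ k, Fintype (𝒰 k)]

/-- `I(U_T; X | Y₀)`. -/
def relevance (P : Letter 𝒳 𝒴₀ 𝒴 → ℝ) (W : ∀ k, 𝒴 k → 𝒰 k → ℝ) (T : Finset (Fin K)) : ℝ :=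
  condMutualInfo (channelJoint P W) (fun w (k : T) => w.2 k) (fun w => w.1.1) (fun w => w.1.2.1)

/-- `I(Y_k; U_k | X, Y₀)`. -/
def excessRate (P : Letter 𝒳 𝒴₀ 𝒴 → ℝ) (W : ∀ k, 𝒴 k → 𝒰 k → ℝ) (k : Fin K) : ℝ :=
  condMutualInfo (channelJoint P W) (fun w => w.1.2.2 k) (fun w => w.2 k)
    (fun w => (w.1.1, w.1.2.1))

/-- `I(U_{Sᶜ}; X | Y₀) - ∑_{k ∈ S} I(Y_k; U_k | X, Y₀)`. -/
def tradeoff (P : Letter 𝒳 𝒴₀ 𝒴 → ℝ) (W : ∀ k, 𝒴 k → 𝒰 k → ℝ) (S : Finset (Fin K)) : ℝ :=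
  relevance P W Sᶜ - ∑ k ∈ S, excessRate P W k

/-- `I(U_S; Y_S | U_{Sᶜ}, Y₀)`. -/
def binningRate (P : Letter 𝒳 𝒴₀ 𝒴 → ℝ) (W : ∀ k, 𝒴 k → 𝒰 k → ℝ) (S : Finset (Fin K)) : ℝ :=
  condMutualInfo (channelJoint P W) (fun w (k : S) => w.2 k) (fun w (k : S) => w.1.2.2 k)
    (fun w => (fun k : (Sᶜ : Finset (Fin K)) => w.2 k, w.1.2.1))

/-- The integrand of `tradeoff`. -/
def tradeoffDensity (p₀ : 𝒳 × 𝒴₀ → ℝ) (κ : ∀ k, 𝒳 × 𝒴₀ → 𝒴 k → ℝ) (W : ∀ k, 𝒴 k → 𝒰 k → ℝ)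
    (S : Finset (Fin K)) (ω : Letter 𝒳 𝒴₀ 𝒴 × (∀ k, 𝒰 k)) : ℝ :=
  Real.log ((∏ k ∈ Sᶜ, outputKernel κ W k (ω.1.1, ω.1.2.1) (ω.2 k)) *
      outputMarginal p₀ κ W ∅ ω.2 ω.1.2.1 / outputMarginal p₀ κ W Sᶜ ω.2 ω.1.2.1) -
    ∑ k ∈ S, Real.log (W k (ω.1.2.2 k) (ω.2 k) / outputKernel κ W k (ω.1.1, ω.1.2.1) (ω.2 k))

variable {p₀ : 𝒳 × 𝒴₀ → ℝ} {κ : ∀ k, 𝒳 × 𝒴₀ → 𝒴 k → ℝ} {W : ∀ k, 𝒴 k → 𝒰 k → ℝ}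

section Masses

variable (hs : IsSource p₀ κ) (hW : IsChannel W) (ω : Letter 𝒳 𝒴₀ 𝒴 × (∀ k, 𝒰 k))
include hs hW

lemma mass_outputs_pair (T : Finset (Fin K)) :
    mass (channelJoint (source p₀ κ) W) (fun w => (fun k : T => w.2 k, w.1.1, w.1.2.1)) ω =
      p₀ (ω.1.1, ω.1.2.1) * ∏ k ∈ T, outputKernel κ W k (ω.1.1, ω.1.2.1) (ω.2 k) := by
  rw [mass_channelJoint_pair hs hW ∅ T _ ω, prod_localFactor_empty]
  intro ω'
  simp only [Prod.mk.injEq, funext_iff, Subtype.forall, Set.mem_empty_iff_false, false_imp_iff,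
    true_and, Finset.mem_coe]
  tauto

lemma mass_outputs_side (T : Finset (Fin K)) :
    mass (channelJoint (source p₀ κ) W) (fun w => (fun k : T => w.2 k, w.1.2.1)) ω =
      outputMarginal p₀ κ W T ω.2 ω.1.2.1 := by
  rw [mass_channelJoint_side hs hW ∅ T _ ω]
  · simp_rw [prod_localFactor_empty]; rfl
  intro ω'
  simp only [Prod.mk.injEq, funext_iff, Subtype.forall, Set.mem_empty_iff_false, false_imp_iff,
    true_and, Finset.mem_coe]
  tauto

lemma mass_side :
    mass (channelJoint (source p₀ κ) W) (fun w => w.1.2.1) ω =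
      outputMarginal p₀ κ W ∅ ω.2 ω.1.2.1 := by
  rw [← mass_outputs_side hs hW ω ∅]
  exact mass_congr fun ω' _ => by simp [funext_iff]

lemma mass_pair :
    mass (channelJoint (source p₀ κ) W) (fun w => (w.1.1, w.1.2.1)) ω = p₀ (ω.1.1, ω.1.2.1) := by
  have := mass_outputs_pair hs hW ω ∅
  rw [Finset.prod_empty, mul_one] at this
  rw [← this]
  exact mass_congr fun ω' _ => by simp [funext_iff]

lemma mass_obs_output_pair (k : Fin K) :
    mass (channelJoint (source p₀ κ) W) (fun w => (w.1.2.2 k, w.2 k, w.1.1, w.1.2.1)) ω =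
      p₀ (ω.1.1, ω.1.2.1) * (κ k (ω.1.1, ω.1.2.1) (ω.1.2.2 k) * W k (ω.1.2.2 k) (ω.2 k)) := by
  rw [mass_channelJoint_pair hs hW {k} {k} _ ω, prod_localFactor_singleton k _ subset_rfl]
  · simp [localFactor]
  · intro ω'
    simp only [Prod.mk.injEq, Set.mem_singleton_iff, forall_and, forall_eq]
    tauto

lemma mass_obs_pair (k : Fin K) :
    mass (channelJoint (source p₀ κ) W) (fun w => (w.1.2.2 k, w.1.1, w.1.2.1)) ω =
      p₀ (ω.1.1, ω.1.2.1) * κ k (ω.1.1, ω.1.2.1) (ω.1.2.2 k) := by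
  rw [mass_channelJoint_pair hs hW {k} ∅ _ ω, prod_localFactor_singleton k _ (by simp)]
  · simp [localFactor]
  · intro ω'
    simp only [Prod.mk.injEq, Set.mem_singleton_iff, forall_and, forall_eq]
    simp
    tauto

lemma mass_output_pair (k : Fin K) :
    mass (channelJoint (source p₀ κ) W) (fun w => (w.2 k, w.1.1, w.1.2.1)) ω =
      p₀ (ω.1.1, ω.1.2.1) * outputKernel κ W k (ω.1.1, ω.1.2.1) (ω.2 k) := by
  have := mass_outputs_pair hs hW ω {k}
  rw [Finset.prod_singleton] at this
  rw [← this]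
  exact mass_congr fun ω' _ => by simp [funext_iff]

-- On the support every factor is positive, so logarithms of products and quotients may be split
-- freely.
omit ω in
lemma factors_pos {ω : Letter 𝒳 𝒴₀ 𝒴 × (∀ k, 𝒰 k)}
    (h : channelJoint (source p₀ κ) W ω ≠ 0) :
    0 < p₀ (ω.1.1, ω.1.2.1) ∧ (∀ k, 0 < κ k (ω.1.1, ω.1.2.1) (ω.1.2.2 k)) ∧
      (∀ k, 0 < W k (ω.1.2.2 k) (ω.2 k)) ∧
      (∀ k, 0 < outputKernel κ W k (ω.1.1, ω.1.2.1) (ω.2 k)) ∧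
      (∀ T, 0 < outputMarginal p₀ κ W T ω.2 ω.1.2.1) := by
  have hp := channelJoint_nonneg hs hW
  have h0 : 0 < p₀ (ω.1.1, ω.1.2.1) := by
    rw [← mass_pair hs hW]; exact mass_pos hp _ h
  refine ⟨h0, fun k => ?_, fun k => ?_, fun k => ?_, fun T => ?_⟩
  · have := mass_pos hp (fun w => (w.1.2.2 k, w.1.1, w.1.2.1)) h
    rw [mass_obs_pair hs hW] at this
    exact pos_of_mul_pos_right this h0.le
  · refine lt_of_le_of_ne ((hW k _).1 _) fun h' => h ?_
    rw [channelJoint, Finset.prod_eq_zero (Finset.mem_univ k) h'.symm, mul_zero]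
  · have := mass_pos hp (fun w => (w.2 k, w.1.1, w.1.2.1)) h
    rw [mass_output_pair hs hW] at this
    exact pos_of_mul_pos_right this h0.le
  · rw [← mass_outputs_side hs hW]; exact mass_pos hp _ h

end Masses

section Identities

variable (hs : IsSource p₀ κ) (hW : IsChannel W)
include hs hW

lemma relevance_eq_sum (T : Finset (Fin K)) :
    relevance (source p₀ κ) W T = ∑ ω, channelJoint (source p₀ κ) W ω *
      Real.log ((∏ k ∈ T, outputKernel κ W k (ω.1.1, ω.1.2.1) (ω.2 k)) *
      outputMarginal p₀ κ W ∅ ω.2 ω.1.2.1 / outputMarginal p₀ κ W T ω.2 ω.1.2.1) := by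
  rw [relevance, condMutualInfo_eq_sum]
  refine Finset.sum_congr rfl fun ω _ => ?_
  by_cases h0 : channelJoint (source p₀ κ) W ω = 0
  · simp [h0]
  obtain ⟨hp0, -, -, hV, hG⟩ := factors_pos hs hW h0
  rw [mass_outputs_pair hs hW, mass_side hs hW, mass_outputs_side hs hW, mass_pair hs hW]
  congr 2
  have := (hG T).ne'
  field_simp

lemma excessRate_eq_sum (k : Fin K) :
    excessRate (source p₀ κ) W k = ∑ ω, channelJoint (source p₀ κ) W ω *
      Real.log (W k (ω.1.2.2 k) (ω.2 k) / outputKernel κ W k (ω.1.1, ω.1.2.1) (ω.2 k)) := by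
  rw [excessRate, condMutualInfo_eq_sum]
  refine Finset.sum_congr rfl fun ω _ => ?_
  by_cases h0 : channelJoint (source p₀ κ) W ω = 0
  · simp [h0]
  obtain ⟨hp0, hκ, -, hV, -⟩ := factors_pos hs hW h0
  rw [mass_obs_output_pair hs hW, mass_obs_pair hs hW, mass_output_pair hs hW, mass_pair hs hW]
  congr 2
  have := (hV k).ne'
  have := (hκ k).ne'
  field_simp

lemma tradeoff_eq_sum (S : Finset (Fin K)) :
    tradeoff (source p₀ κ) W S =
      ∑ ω, channelJoint (source p₀ κ) W ω * tradeoffDensity p₀ κ W S ω := by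
  simp_rw [tradeoff, tradeoffDensity, mul_sub, Finset.sum_sub_distrib, Finset.mul_sum]
  rw [Finset.sum_comm (s := Finset.univ), relevance_eq_sum hs hW]
  simp_rw [excessRate_eq_sum hs hW]

/-- The identity holds between the integrands. Given Y_S, the outputs U_S are produced by their
channels independently of everything else, so both sides reduce to the logarithm of ∏_{k∈S} W_k ·
P(u_{Sᶜ},y₀) / P(u,y₀). -/
lemma binningRate_eq_sub (S : Finset (Fin K)) :
    binningRate (source p₀ κ) W S = tradeoff (source p₀ κ) W ∅ - tradeoff (source p₀ κ) W S := by
  classical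
  rw [tradeoff_eq_sum hs hW, tradeoff_eq_sum hs hW, ← Finset.sum_sub_distrib, binningRate,
    condMutualInfo_eq_sum]
  refine Finset.sum_congr rfl fun ω _ => ?_
  by_cases h0 : channelJoint (source p₀ κ) W ω = 0
  · simp [h0]
  rw [← mul_sub]
  congr 1
  obtain ⟨hp0, hκ, hw, hV, hG⟩ := factors_pos hs hW h0
  have hp := channelJoint_nonneg hs hW
  -- The Markov property: once Y_S is known, the further observation of U_S multiplies the mass by
  -- the channel probabilities.
  have hM : mass (channelJoint (source p₀ κ) W) (fun ω => (fun k : S => ω.2 k,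
      fun k : S => ω.1.2.2 k, fun k : (Sᶜ : Finset (Fin K)) => ω.2 k, ω.1.2.1)) ω =
      mass (channelJoint (source p₀ κ) W) (fun ω => (fun k : S => ω.1.2.2 k,
        fun k : (Sᶜ : Finset (Fin K)) => ω.2 k, ω.1.2.1)) ω *
        ∏ k ∈ S, W k (ω.1.2.2 k) (ω.2 k) := by
    rw [mass_channelJoint_side hs hW S Set.univ _ ω,
      mass_channelJoint_side hs hW S ((Sᶜ : Finset (Fin K)) : Set (Fin K)) _ ω, Finset.sum_mul]
    · refine Finset.sum_congr rfl fun x _ => ?_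
      rw [mul_assoc]
      congr 1
      rw [← Finset.prod_mul_prod_compl S, ← Finset.prod_mul_prod_compl S, mul_right_comm,
        ← Finset.prod_mul_distrib]
      congr 1
      · refine Finset.prod_congr rfl fun k hk => ?_
        simp [localFactor, hk]
      · refine Finset.prod_congr rfl fun k hk => ?_
        rw [Finset.mem_compl] at hk
        simp [localFactor, hk]
    · intro ω'
      simp only [Prod.mk.injEq, funext_iff, Subtype.forall, Finset.mem_coe, Finset.mem_compl,
        forall_and]
      tauto
    · intro ω'
      simp only [Prod.mk.injEq, funext_iff, Subtype.forall, Finset.mem_coe, Finset.mem_compl,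
        Set.mem_univ, true_imp_iff, forall_and]
      refine ⟨fun h => ⟨h.2.2.2, h.2.1, fun k => ?_⟩, fun h => ⟨fun k _ => h.2.2 k, h.2.1,
        fun k _ => h.2.2 k, h.1⟩⟩
      by_cases hk : k ∈ S
      · exact h.1 k hk
      · exact h.2.2.1 k hk
  have hM2 : mass (channelJoint (source p₀ κ) W) (fun ω => (fun k : S => ω.2 k,
      fun k : (Sᶜ : Finset (Fin K)) => ω.2 k, ω.1.2.1)) ω =
      outputMarginal p₀ κ W Finset.univ ω.2 ω.1.2.1 := by
    rw [← mass_outputs_side hs hW ω]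
    refine mass_congr fun ω' _ => ?_
    simp only [Prod.mk.injEq, funext_iff, Subtype.forall, Finset.mem_compl, Finset.mem_univ,
      true_imp_iff]
    refine ⟨fun h => ⟨fun k => ?_, h.2.2⟩, fun h => ⟨fun k _ => h.1 k, fun k _ => h.1 k, h.2⟩⟩
    by_cases hk : k ∈ S
    · exact h.1 k hk
    · exact h.2.1 k hk
  have hpos := (mass_pos hp (fun ω => (fun k : S => ω.1.2.2 k,
        fun k : (Sᶜ : Finset (Fin K)) => ω.2 k, ω.1.2.1)) h0).ne'
  rw [hM, hM2, mass_outputs_side hs hW]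
  have hpr : (∏ k ∈ S, W k (ω.1.2.2 k) (ω.2 k)) ≠ 0 :=
    Finset.prod_ne_zero_iff.2 fun k _ => (hw k).ne'
  have hVp : ∀ T : Finset (Fin K),
      (∏ k ∈ T, outputKernel κ W k (ω.1.1, ω.1.2.1) (ω.2 k)) ≠ 0 :=
    fun T => Finset.prod_ne_zero_iff.2 fun k _ => (hV k).ne'
  have hG' : ∀ T, outputMarginal p₀ κ W T ω.2 ω.1.2.1 ≠ 0 := fun T => (hG T).ne'
  have e1 : ∑ k ∈ S, Real.log (W k (ω.1.2.2 k) (ω.2 k) /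
      outputKernel κ W k (ω.1.1, ω.1.2.1) (ω.2 k)) =
      Real.log (∏ k ∈ S, W k (ω.1.2.2 k) (ω.2 k)) -
      Real.log (∏ k ∈ S, outputKernel κ W k (ω.1.1, ω.1.2.1) (ω.2 k)) := by
    rw [Real.log_prod (fun k _ => (hw k).ne'), Real.log_prod (fun k _ => (hV k).ne'),
      ← Finset.sum_sub_distrib]
    exact Finset.sum_congr rfl fun k _ => Real.log_div (hw k).ne' (hV k).ne'
  have e2 : Real.log (∏ k, outputKernel κ W k (ω.1.1, ω.1.2.1) (ω.2 k)) =
      Real.log (∏ k ∈ S, outputKernel κ W k (ω.1.1, ω.1.2.1) (ω.2 k)) +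
      Real.log (∏ k ∈ Sᶜ, outputKernel κ W k (ω.1.1, ω.1.2.1) (ω.2 k)) := by
    rw [← Real.log_mul (hVp _) (hVp _), Finset.prod_mul_prod_compl]
  unfold tradeoffDensity
  rw [e1, Finset.compl_empty, Finset.sum_empty]
  rw [Real.log_div (mul_ne_zero (mul_ne_zero hpos hpr) (hG' _)) (mul_ne_zero (hG' _) hpos),
    Real.log_mul (mul_ne_zero hpos hpr) (hG' _), Real.log_mul hpos hpr,
    Real.log_mul (hG' _) hpos, Real.log_div (mul_ne_zero (hVp _) (hG' _)) (hG' _),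
    Real.log_div (mul_ne_zero (hVp _) (hG' _)) (hG' _), Real.log_mul (hVp _) (hG' _),
    Real.log_mul (hVp _) (hG' _), e2]
  ring

/-- In the entropy expansion of I(U_T;X|Y₀) the term H(U_T,X,Y₀) is modular in T, because the
outputs are conditionally independent given (X,Y₀); the term H(U_T,Y₀) is submodular. -/
lemma relevance_submodular (A B : Finset (Fin K)) :
    relevance (source p₀ κ) W (A ∪ B) + relevance (source p₀ κ) W (A ∩ B) ≤
      relevance (source p₀ κ) W A + relevance (source p₀ κ) W B := by
  classical
  have hp := channelJoint_nonneg hs hW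
  set p := channelJoint (source p₀ κ) W with hpdef
  have hmod : ∀ T : Finset (Fin K), ent p (fun w => (fun k : T => w.2 k, w.1.1, w.1.2.1)) =
      ent p (fun w => (w.1.1, w.1.2.1)) - ∑ k ∈ T, ∑ ω, p ω *
        Real.log (outputKernel κ W k (ω.1.1, ω.1.2.1) (ω.2 k)) := by
    intro T
    rw [ent_eq_sub_of_mass hp (B := fun w => (w.1.1, w.1.2.1))
      (c := fun ω => ∏ k ∈ T, outputKernel κ W k (ω.1.1, ω.1.2.1) (ω.2 k))
      (fun ω _ => by rw [hpdef, mass_outputs_pair hs hW, mass_pair hs hW]), Finset.sum_comm]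
    congr 1
    refine Finset.sum_congr rfl fun ω _ => ?_
    by_cases h0 : p ω = 0
    · simp [h0]
    obtain ⟨-, -, -, hV, -⟩ := factors_pos hs hW h0
    rw [Real.log_prod (fun k _ => (hV k).ne'), Finset.mul_sum]
  have hsum := Finset.sum_union_inter (s₁ := A) (s₂ := B) (f := fun k => ∑ ω, p ω *
        Real.log (outputKernel κ W k (ω.1.1, ω.1.2.1) (ω.2 k)))
  have hsub := ent_submodular hp (fun w (k : A) => w.2 k) (fun w (k : B) => w.2 k)
    (fun w => (fun k : (A ∩ B : Finset (Fin K)) => w.2 k, w.1.2.1))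
  have hA : ent p (fun w => (fun k : A => w.2 k, fun k : (A ∩ B : Finset (Fin K)) => w.2 k,
      w.1.2.1)) = ent p (fun w => (fun k : A => w.2 k, w.1.2.1)) := by
    refine ent_congr fun ω ω' _ _ => ?_
    simp only [Prod.mk.injEq, funext_iff, Subtype.forall, Finset.mem_inter]
    tauto
  have hB : ent p (fun w => (fun k : B => w.2 k, fun k : (A ∩ B : Finset (Fin K)) => w.2 k,
      w.1.2.1)) = ent p (fun w => (fun k : B => w.2 k, w.1.2.1)) := by
    refine ent_congr fun ω ω' _ _ => ?_
    simp only [Prod.mk.injEq, funext_iff, Subtype.forall, Finset.mem_inter]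
    tauto
  have hAB : ent p (fun w => (fun k : A => w.2 k, fun k : B => w.2 k,
      fun k : (A ∩ B : Finset (Fin K)) => w.2 k, w.1.2.1)) =
      ent p (fun w => (fun k : (A ∪ B : Finset (Fin K)) => w.2 k, w.1.2.1)) := by
    refine ent_congr fun ω ω' _ _ => ?_
    simp only [Prod.mk.injEq, funext_iff, Subtype.forall, Finset.mem_inter, Finset.mem_union,
      or_imp, forall_and]
    tauto
  rw [hA, hB, hAB] at hsub
  simp only [relevance, ← hpdef]
  simp_rw [condMutualInfo_eq_ent hp, hmod]
  linarith

omit hs hW in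
lemma excessRate_nonneg (hs : IsSource p₀ κ) (hW : IsChannel W) (k : Fin K) :
    0 ≤ excessRate (source p₀ κ) W k :=
  condMutualInfo_nonneg (channelJoint_nonneg hs hW) _ _ _

end Identities

end Tradeoff

end

end DistHT

namespace DistHT

noncomputable section

set_option linter.unusedSectionVars false

/-! ### Invariance under relabelling, merging and padding of alphabets. -/

section Relabelling

variable {K : ℕ} {𝒳 𝒴₀ 𝒳' 𝒴₀' : Type*} {𝒴 𝒴' 𝒰 𝒰' : Fin K → Type*}
variable [Fintype 𝒳] [Fintype 𝒴₀] [∀ k, Fintype (𝒴 k)] [∀ k, Fintype (𝒰 k)] [∀ k, Fintype (𝒰' k)]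
variable [Fintype 𝒳'] [Fintype 𝒴₀'] [∀ k, Fintype (𝒴' k)]

/-- Local processing of the outputs pushes the joint pmf forward. -/
lemma pmfOf_channelJoint_map (P : Letter 𝒳 𝒴₀ 𝒴 → ℝ) (W : ∀ k, 𝒴 k → 𝒰 k → ℝ)
    (W' : ∀ k, 𝒴 k → 𝒰' k → ℝ) (e : ∀ k, 𝒰 k → 𝒰' k)
    (h : ∀ k y u', W' k y u' = ∑ u, W k y u * ind (e k u = u')) :
    pmfOf (channelJoint P W) (fun w => (w.1, fun k => e k (w.2 k))) = channelJoint P W' := by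
  funext ⟨v, u'⟩
  rw [pmfOf_eq, Fintype.sum_prod_type]
  simp only [channelJoint, Prod.mk.injEq, ind_and, h]
  rw [← sum_pi_prod, Finset.mul_sum, Finset.sum_comm]
  refine Finset.sum_congr rfl fun u _ => ?_
  simp_rw [funext_iff, ind_forall, Finset.prod_mul_distrib]
  rw [← sum_mul_ind v (fun x => P x * ((∏ k, W k (x.2.2 k) (u k)) * ∏ k, ind (e k (u k) = u' k)))]
  exact Finset.sum_congr rfl fun x _ => by ring

/-- One statement for two uses: with `T' = T` it covers renaming of outputs, and with smaller `T'`
it covers outputs replaced by constants, which carry no information. -/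
lemma relevance_map (P : Letter 𝒳 𝒴₀ 𝒴 → ℝ) (W : ∀ k, 𝒴 k → 𝒰 k → ℝ)
    (W' : ∀ k, 𝒴 k → 𝒰' k → ℝ) (e : ∀ k, 𝒰 k → 𝒰' k)
    (h : ∀ k y u', W' k y u' = ∑ u, W k y u * ind (e k u = u')) (T T' : Finset (Fin K))
    (hinj : ∀ k ∈ T', Function.Injective (e k)) (hT : T' ⊆ T)
    (hconst : ∀ k ∈ T, k ∉ T' → ∀ u u', e k u = e k u') :
    relevance P W' T = relevance P W T' := by
  unfold relevance
  rw [← pmfOf_channelJoint_map P W W' e h, condMutualInfo_pmfOf]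
  refine condMutualInfo_congr (fun ω ω' => ?_) (fun _ _ => Iff.rfl) (fun _ _ => Iff.rfl)
  simp only [funext_iff, Subtype.forall]
  refine ⟨fun H k hk => hinj k hk (H k (hT hk)), fun H k hk => ?_⟩
  by_cases hk' : k ∈ T'
  · rw [H k hk']
  · exact hconst k hk hk' _ _

lemma excessRate_map (P : Letter 𝒳 𝒴₀ 𝒴 → ℝ) (W : ∀ k, 𝒴 k → 𝒰 k → ℝ)
    (W' : ∀ k, 𝒴 k → 𝒰' k → ℝ) (e : ∀ k, 𝒰 k → 𝒰' k)
    (h : ∀ k y u', W' k y u' = ∑ u, W k y u * ind (e k u = u')) (k : Fin K)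
    (hinj : Function.Injective (e k)) : excessRate P W' k = excessRate P W k := by
  unfold excessRate
  rw [← pmfOf_channelJoint_map P W W' e h, condMutualInfo_pmfOf]
  exact condMutualInfo_congr (fun ω ω' => Iff.rfl) (fun _ _ => hinj.eq_iff) (fun _ _ => Iff.rfl)

lemma condMutualInfo_const_right {Ω α β γ : Type*} [Fintype Ω] [Fintype α] [Fintype β] [Fintype γ]
    {p : Ω → ℝ} (hp : ∀ ω, 0 ≤ p ω) (A : Ω → α) (B : Ω → β) (C : Ω → γ)
    (hB : ∀ ω ω', B ω = B ω') : condMutualInfo p A B C = 0 := by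
  rw [condMutualInfo_eq_ent hp, ent_congr (A := fun ω => (A ω, B ω, C ω))
    (B := fun ω => (A ω, C ω)), ent_congr (A := fun ω => (B ω, C ω)) (B := C)]
  · ring
  · intro ω ω' _ _; simp [hB ω' ω]
  · intro ω ω' _ _; simp [hB ω' ω]

lemma excessRate_map_const {P : Letter 𝒳 𝒴₀ 𝒴 → ℝ} {W : ∀ k, 𝒴 k → 𝒰 k → ℝ}
    (hnn : ∀ ω, 0 ≤ channelJoint P W ω)
    (W' : ∀ k, 𝒴 k → 𝒰' k → ℝ) (e : ∀ k, 𝒰 k → 𝒰' k)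
    (h : ∀ k y u', W' k y u' = ∑ u, W k y u * ind (e k u = u')) (k : Fin K)
    (hconst : ∀ u u', e k u = e k u') : excessRate P W' k = 0 := by
  unfold excessRate
  rw [← pmfOf_channelJoint_map P W W' e h, condMutualInfo_pmfOf]
  exact condMutualInfo_const_right hnn _ _ _ fun _ _ => hconst _ _

lemma tradeoff_map_injective (P : Letter 𝒳 𝒴₀ 𝒴 → ℝ) (W : ∀ k, 𝒴 k → 𝒰 k → ℝ)
    (W' : ∀ k, 𝒴 k → 𝒰' k → ℝ) (e : ∀ k, 𝒰 k → 𝒰' k)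
    (h : ∀ k y u', W' k y u' = ∑ u, W k y u * ind (e k u = u'))
    (hinj : ∀ k, Function.Injective (e k)) : tradeoff P W' = tradeoff P W := by
  funext S
  unfold tradeoff
  rw [relevance_map P W W' e h Sᶜ Sᶜ (fun k _ => hinj k) subset_rfl (fun k h h' => absurd h h')]
  simp_rw [fun k => excessRate_map P W W' e h k (hinj k)]

/-- Extending a channel by zero along injections of the output alphabets, or restricting it to
alphabets that contain its support, does not change the tradeoff. -/
lemma tradeoff_comp_injective (P : Letter 𝒳 𝒴₀ 𝒴 → ℝ) (W' : ∀ k, 𝒴 k → 𝒰' k → ℝ)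
    (e : ∀ k, 𝒰 k → 𝒰' k) (hinj : ∀ k, Function.Injective (e k))
    (hsupp : ∀ k y u', u' ∉ Set.range (e k) → W' k y u' = 0) :
    tradeoff P (fun k y u => W' k y (e k u)) = tradeoff P W' := by
  refine (tradeoff_map_injective P _ W' e (fun k y u' => ?_) hinj).symm
  by_cases hu : u' ∈ Set.range (e k)
  · obtain ⟨u, rfl⟩ := hu
    simp_rw [(hinj k).eq_iff]
    rw [sum_mul_ind u (fun u => W' k y (e k u))]
  · rw [hsupp k y u' hu]
    symm
    refine Finset.sum_eq_zero fun u _ => ?_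
    rw [ind_false (fun h => hu ⟨u, h⟩), mul_zero]

/-- Relabelling the source alphabets does not change the tradeoff. -/
lemma tradeoff_reindex (P : Letter 𝒳 𝒴₀ 𝒴 → ℝ) (P' : Letter 𝒳' 𝒴₀' 𝒴' → ℝ)
    (W : ∀ k, 𝒴 k → 𝒰 k → ℝ) (W' : ∀ k, 𝒴' k → 𝒰 k → ℝ)
    (eX : 𝒳 ≃ 𝒳') (e₀ : 𝒴₀ ≃ 𝒴₀') (eY : ∀ k, 𝒴 k ≃ 𝒴' k)
    (hP : ∀ x y₀ y, P' (eX x, e₀ y₀, fun k => eY k (y k)) = P (x, y₀, y))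
    (hW : ∀ k y u, W' k (eY k y) u = W k y u) : tradeoff P' W' = tradeoff P W := by
  have key : channelJoint P' W' = pmfOf (channelJoint P W) (fun w =>
      (((eX w.1.1, e₀ w.1.2.1, fun k => eY k (w.1.2.2 k)), w.2) :
        Letter 𝒳' 𝒴₀' 𝒴' × (∀ k, 𝒰 k))) := by
    funext ⟨⟨x', y₀', y'⟩, u⟩
    obtain ⟨x, rfl⟩ := eX.surjective x'
    obtain ⟨y₀, rfl⟩ := e₀.surjective y₀'
    obtain ⟨y, rfl⟩ : ∃ y : ∀ k, 𝒴 k, y' = fun k => eY k (y k) :=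
      ⟨fun k => (eY k).symm (y' k), by simp⟩
    rw [pmfOf_eq, ← sum_mul_ind (((x, y₀, y), u) : Letter 𝒳 𝒴₀ 𝒴 × (∀ k, 𝒰 k))
      (fun _ => channelJoint P' W' _)]
    refine Finset.sum_congr rfl fun w _ => ?_
    by_cases hw : w = ((x, y₀, y), u)
    · subst hw
      rw [ind_true rfl, ind_true rfl]
      simp [channelJoint, hP, hW]
    · rw [ind_false hw, ind_false, mul_zero, mul_zero]
      intro h
      apply hw
      obtain ⟨⟨a, b, c⟩, d⟩ := w
      simp only [Prod.mk.injEq, EmbeddingLike.apply_eq_iff_eq, funext_iff] at h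
      simp only [Prod.mk.injEq, funext_iff]
      exact h
  funext S
  simp only [tradeoff, relevance, excessRate, key, condMutualInfo_pmfOf]
  congr 1
  · apply condMutualInfo_congr <;> intro ω ω' <;> simp
  · refine Finset.sum_congr rfl fun k _ => ?_
    apply condMutualInfo_congr <;> intro ω ω' <;> simp

end Relabelling

/-! ### Auxiliary variables as mixtures of channels. -/

section Region

variable {K : ℕ} {𝒳 𝒴₀ : Type*} {𝒴 : Fin K → Type*}
variable [Fintype 𝒳] [Fintype 𝒴₀] [∀ k, Fintype (𝒴 k)]

/-- The channels of an auxiliary for a fixed value of the time-sharing variable. -/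
def Auxiliary.channel (a : Auxiliary 𝒴) (q : Fin a.cardQ) : ∀ k, 𝒴 k → Fin (a.cardU k) → ℝ :=
  fun k y u => a.pU k y q u

lemma Auxiliary.isChannel (a : Auxiliary 𝒴) (q : Fin a.cardQ) : IsChannel (a.channel q) :=
  fun k y => a.pU_mem k y q

lemma Auxiliary.pmfOf_joint (a : Auxiliary 𝒴) (P : Letter 𝒳 𝒴₀ 𝒴 → ℝ)
    (ω : Letter 𝒳 𝒴₀ 𝒴 × (∀ k, Fin (a.cardU k))) (q : Fin a.cardQ) :
    pmfOf (a.joint P) (fun w => ((w.1, w.2.1), w.2.2)) (ω, q) =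
      a.pQ q * channelJoint P (a.channel q) ω := by
  have := sum_mul_ind ((ω.1, ω.2, q) : a.Space 𝒳 𝒴₀) (a.joint P)
  rw [pmfOf_eq]
  refine Eq.trans (Finset.sum_congr rfl fun w _ => ?_) (this.trans ?_)
  · congr 1
    apply ind_congr
    obtain ⟨w, u, q'⟩ := w
    obtain ⟨ω, u'⟩ := ω
    simp only [Prod.mk.injEq]
    tauto
  · simp only [Auxiliary.joint, channelJoint, Auxiliary.channel]; ring

lemma Auxiliary.relevance_eq (a : Auxiliary 𝒴) (P : Letter 𝒳 𝒴₀ 𝒴 → ℝ) (T : Finset (Fin K)) :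
    condMutualInfo (a.joint P) (a.rvUs T) a.rvX (fun w => (a.rvY₀ w, a.rvQ w)) =
      ∑ q, a.pQ q * relevance P (a.channel q) T :=
  condMutualInfo_mixture (a.joint P) (fun w => (w.1, w.2.1)) (fun w => w.2.2) a.pQ
    (fun q => channelJoint P (a.channel q)) (a.pmfOf_joint P) (fun w (k : T) => w.2 k)
      (fun w => w.1.1) (fun w => w.1.2.1)

lemma Auxiliary.excessRate_eq (a : Auxiliary 𝒴) (P : Letter 𝒳 𝒴₀ 𝒴 → ℝ) (k : Fin K) :
    condMutualInfo (a.joint P) (a.rvY k) (a.rvU k) (fun w => (a.rvX w, a.rvY₀ w, a.rvQ w)) =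
      ∑ q, a.pQ q * excessRate P (a.channel q) k := by
  unfold excessRate
  rw [← condMutualInfo_mixture (a.joint P) (fun w => (w.1, w.2.1)) (fun w => w.2.2) a.pQ
    (fun q => channelJoint P (a.channel q)) (a.pmfOf_joint P) (fun w => w.1.2.2 k)
      (fun w => w.2 k) (fun w => (w.1.1, w.1.2.1))]
  refine condMutualInfo_congr (fun _ _ => Iff.rfl) (fun _ _ => Iff.rfl) (fun ω ω' => ?_)
  simp only [Prod.mk.injEq, Auxiliary.rvX, Auxiliary.rvY₀, Auxiliary.rvQ]
  tauto

lemma Auxiliary.binningRate_eq (a : Auxiliary 𝒴) (P : Letter 𝒳 𝒴₀ 𝒴 → ℝ) (S : Finset (Fin K)) :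
    condMutualInfo (a.joint P) (a.rvUs S) (a.rvYs S)
        (fun w => (a.rvUs Sᶜ w, a.rvY₀ w, a.rvQ w)) =
      ∑ q, a.pQ q * binningRate P (a.channel q) S := by
  unfold binningRate
  rw [← condMutualInfo_mixture (a.joint P) (fun w => (w.1, w.2.1)) (fun w => w.2.2) a.pQ
    (fun q => channelJoint P (a.channel q)) (a.pmfOf_joint P)]
  refine condMutualInfo_congr (fun _ _ => Iff.rfl) (fun _ _ => Iff.rfl) (fun ω ω' => ?_)
  simp only [Prod.mk.injEq, Auxiliary.rvY₀, Auxiliary.rvQ]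
  tauto

/-- The auxiliary variables enter the single-letter bounds only through the average over Q of their
tradeoff vectors. -/
lemma Auxiliary.tradeoff_eq (a : Auxiliary 𝒴) (P : Letter 𝒳 𝒴₀ 𝒴 → ℝ) (R : Fin K → ℝ)
    (S : Finset (Fin K)) :
    condMutualInfo (a.joint P) (a.rvUs Sᶜ) a.rvX (fun w => (a.rvY₀ w, a.rvQ w)) +
      ∑ k ∈ S, (R k - condMutualInfo (a.joint P) (a.rvY k) (a.rvU k)
        (fun w => (a.rvX w, a.rvY₀ w, a.rvQ w))) =
      ∑ q, a.pQ q * tradeoff P (a.channel q) S + ∑ k ∈ S, R k := by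
  simp_rw [a.relevance_eq, a.excessRate_eq, tradeoff, mul_sub, Finset.sum_sub_distrib,
    Finset.mul_sum]
  rw [Finset.sum_comm (s := S)]
  ring

end Region

end

end DistHT

/-! ### Cardinality bounds for the auxiliary alphabets. -/

namespace DistHT

noncomputable section

set_option linter.unusedSectionVars false

/-- Carathéodory's theorem for unnormalized weights. -/
lemma exists_sparse_weights {U E : Type*} [Fintype U] [AddCommGroup E] [Module ℝ E]
    [FiniteDimensional ℝ E] (c : U → E) :
    ∃ t : U → ℝ, (∀ u, 0 ≤ t u) ∧ ∑ u, t u • c u = ∑ u, c u ∧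
      ∃ F : Finset U, F.card ≤ Module.finrank ℝ E + 1 ∧ ∀ u ∉ F, t u = 0 := by
  classical
  rcases isEmpty_or_nonempty U with hU | hU
  · exact ⟨fun _ => 0, fun _ => le_rfl, by simp, ∅, by simp, fun _ _ => rfl⟩
  set N : ℝ := (Fintype.card U : ℝ) with hN
  have hNpos : 0 < N := by rw [hN]; exact_mod_cast Fintype.card_pos
  -- Scaling by `N` turns the plain sum into a barycentre with weights 1/N; the factor `N` returns
  -- in the final weights.
  have hx : ∑ u, c u ∈ convexHull ℝ (Set.range fun u => N • c u) := by
    have := (convex_convexHull ℝ (Set.range fun u => N • c u)).sum_mem (t := Finset.univ)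
      (w := fun _ : U => N⁻¹) (z := fun u => N • c u) (fun _ _ => by positivity)
      (by simp [hN]) (fun u _ => subset_convexHull ℝ _ ⟨u, rfl⟩)
    simpa [smul_smul, hNpos.ne'] using this
  obtain ⟨ι, hι, z, w, hz, haff, hw, hw1, hsum⟩ := eq_pos_convex_span_of_mem_convexHull hx
  choose g hg using fun i => hz ⟨i, rfl⟩
  have hginj : Function.Injective g := by
    intro i j hij
    apply haff.injective
    rw [← hg i, ← hg j, hij]
  refine ⟨fun u => N * ∑ i, w i * ind (g i = u), fun u => ?_, ?_, Finset.univ.image g, ?_, ?_⟩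
  · exact mul_nonneg hNpos.le (Finset.sum_nonneg fun i _ => mul_nonneg (hw i).le (ind_nonneg _))
  · rw [← hsum]
    simp_rw [← hg, Finset.mul_sum, Finset.sum_smul]
    rw [Finset.sum_comm]
    refine Finset.sum_congr rfl fun i _ => ?_
    rw [Finset.sum_eq_single (g i)]
    · rw [ind_true rfl, smul_smul]; ring_nf
    · intro u _ hu; rw [ind_false (Ne.symm hu)]; simp
    · simp
  · rw [Finset.card_image_of_injective _ hginj, Finset.card_univ]
    have := haff.card_le_finrank_succ
    exact this.trans (Nat.add_le_add_right (Submodule.finrank_le _) 1)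
  · intro u hu
    dsimp only
    rw [Finset.sum_eq_zero, mul_zero]
    intro i _
    rw [ind_false, mul_zero]
    rintro rfl
    exact hu (Finset.mem_image_of_mem _ (Finset.mem_univ i))

section Cardinality

variable {K : ℕ} {𝒳 𝒴₀ : Type*} {𝒴 𝒰 : Fin K → Type*}
variable [Fintype 𝒳] [Fintype 𝒴₀] [∀ k, Fintype (𝒴 k)] [∀ k, Fintype (𝒰 k)]
variable {p₀ : 𝒳 × 𝒴₀ → ℝ} {κ : ∀ k, 𝒳 × 𝒴₀ → 𝒴 k → ℝ} {W : ∀ k, 𝒴 k → 𝒰 k → ℝ}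

/-- The density contains only likelihood ratios, so factors depending on the outputs alone cancel.
Hence the tradeoff is linear in the column weights of a single encoder. -/
lemma tradeoffDensity_scale (W : ∀ k, 𝒴 k → 𝒰 k → ℝ) (s : ∀ k, 𝒰 k → ℝ) (S : Finset (Fin K))
    (ω : Letter 𝒳 𝒴₀ 𝒴 × (∀ k, 𝒰 k)) (h : ∀ k, s k (ω.2 k) ≠ 0) :
    tradeoffDensity p₀ κ (fun k y u => s k u * W k y u) S ω = tradeoffDensity p₀ κ W S ω := by
  have hV : ∀ k z u, outputKernel κ (fun k y u => s k u * W k y u) k z u =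
      s k u * outputKernel κ W k z u := by
    intro k z u
    simp only [outputKernel, Finset.mul_sum]
    exact Finset.sum_congr rfl fun y _ => by ring
  have hG : ∀ T u y₀, outputMarginal p₀ κ (fun k y u => s k u * W k y u) T u y₀ =
      (∏ k ∈ T, s k (u k)) * outputMarginal p₀ κ W T u y₀ := by
    intro T u y₀
    simp only [outputMarginal, hV, Finset.prod_mul_distrib, Finset.mul_sum]
    exact Finset.sum_congr rfl fun x _ => by ring
  have hpr : (∏ k ∈ Sᶜ, s k (ω.2 k)) ≠ 0 := Finset.prod_ne_zero_iff.2 fun k _ => h k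
  unfold tradeoffDensity
  simp only [hV, hG, Finset.prod_mul_distrib, Finset.prod_empty, one_mul]
  rw [mul_assoc, mul_div_mul_left _ _ hpr]
  simp_rw [fun k => mul_div_mul_left (W k (ω.1.2.2 k) (ω.2 k))
    (outputKernel κ W k (ω.1.1, ω.1.2.1) (ω.2 k)) (h k)]

lemma tradeoff_scale (hs : IsSource p₀ κ) (s : ∀ k, 𝒰 k → ℝ)
    (hsW : IsChannel fun k y u => s k u * W k y u) (S : Finset (Fin K)) :
    tradeoff (source p₀ κ) (fun k y u => s k u * W k y u) S =
      ∑ ω, (∏ k, s k (ω.2 k)) * (channelJoint (source p₀ κ) W ω * tradeoffDensity p₀ κ W S ω) := by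
  rw [tradeoff_eq_sum hs hsW]
  refine Finset.sum_congr rfl fun ω _ => ?_
  have h1 : channelJoint (source p₀ κ) (fun k y u => s k u * W k y u) ω =
      (∏ k, s k (ω.2 k)) * channelJoint (source p₀ κ) W ω := by
    simp only [channelJoint, Finset.prod_mul_distrib]; ring
  rw [h1, mul_assoc]
  by_cases h0 : ∏ k, s k (ω.2 k) = 0
  · rw [h0]; simp
  · rw [tradeoffDensity_scale]
    exact fun k => Finset.prod_ne_zero_iff.1 h0 k (Finset.mem_univ k)

/-- A bound on the alphabet sizes of the auxiliary variables. -/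
def alphabetBound (𝒴 : Fin K → Type*) [∀ k, Fintype (𝒴 k)] : ℕ :=
  ∑ k, Fintype.card (𝒴 k) + 2 ^ K + 1

/-- Reweighting the columns of channel `k₀` must respect card 𝒴_{k₀} row sums and 2^K tradeoff
values, all linear in the weights; Carathéodory gives a solution supported on at most one more
column than there are conditions. -/
lemma exists_sparse_step (hs : IsSource p₀ κ) (hW : IsChannel W) (k₀ : Fin K) :
    ∃ t : 𝒰 k₀ → ℝ, (∀ u, 0 ≤ t u) ∧
      IsChannel (fun k y u => Function.update (fun k (_ : 𝒰 k) => (1 : ℝ)) k₀ t k u * W k y u) ∧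
      tradeoff (source p₀ κ)
        (fun k y u => Function.update (fun k (_ : 𝒰 k) => (1 : ℝ)) k₀ t k u * W k y u) =
        tradeoff (source p₀ κ) W ∧
      ∃ F : Finset (𝒰 k₀), F.card ≤ alphabetBound 𝒴 ∧ ∀ u ∉ F, t u = 0 := by
  classical
  -- The vector attached to an output `u` collects what has to be preserved: its column, and the
  -- share of `u` in each entry of the tradeoff.
  obtain ⟨t, ht0, htsum, F, hF, hFt⟩ := exists_sparse_weights
    (fun u => ((fun y => W k₀ y u, fun S => ∑ ω, channelJoint (source p₀ κ) W ω *
      tradeoffDensity p₀ κ W S ω * ind (ω.2 k₀ = u)) :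
      (𝒴 k₀ → ℝ) × (Finset (Fin K) → ℝ)))
  have h1 : ∀ y, ∑ u, t u * W k₀ y u = 1 := by
    intro y
    have := congrFun (congrArg Prod.fst htsum) y
    simp only [Prod.fst_sum, Prod.smul_fst, Finset.sum_apply, Pi.smul_apply, smul_eq_mul] at this
    rw [this]; exact (hW k₀ y).2
  have h2 : ∀ S, ∑ u, t u * ∑ ω, channelJoint (source p₀ κ) W ω *
      tradeoffDensity p₀ κ W S ω * ind (ω.2 k₀ = u) = tradeoff (source p₀ κ) W S := by
    intro S
    have := congrFun (congrArg Prod.snd htsum) S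
    simp only [Prod.snd_sum, Prod.smul_snd, Finset.sum_apply, Pi.smul_apply, smul_eq_mul] at this
    rw [this, Finset.sum_comm, tradeoff_eq_sum hs hW]
    refine Finset.sum_congr rfl fun ω _ => ?_
    rw [sum_mul_ind' (ω.2 k₀) (fun _ => channelJoint (source p₀ κ) W ω *
      tradeoffDensity p₀ κ W S ω)]
  have hch : IsChannel (fun k y u =>
      Function.update (fun k (_ : 𝒰 k) => (1 : ℝ)) k₀ t k u * W k y u) := by
    intro k y
    by_cases hk : k = k₀
    · subst hk
      simp only [Function.update_self]
      exact ⟨fun u => mul_nonneg (ht0 u) ((hW k y).1 u), h1 y⟩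
    · simp only [Function.update_of_ne hk, one_mul]
      exact hW k y
  refine ⟨t, ht0, hch, ?_, F, hF.trans ?_, hFt⟩
  · funext S
    rw [tradeoff_scale hs _ hch, ← h2 S]
    simp_rw [Finset.mul_sum]
    rw [Finset.sum_comm]
    refine Finset.sum_congr rfl fun ω _ => ?_
    have hpr : ∏ k, Function.update (fun k (_ : 𝒰 k) => (1 : ℝ)) k₀ t k (ω.2 k) =
        t (ω.2 k₀) := by
      rw [Finset.prod_eq_single k₀]
      · simp
      · intro k _ hk; simp [Function.update_of_ne hk]
      · simp
    rw [hpr, ← sum_mul_ind' (ω.2 k₀) (fun u => t u * (channelJoint (source p₀ κ) W ω *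
      tradeoffDensity p₀ κ W S ω))]
    exact Finset.sum_congr rfl fun u _ => by ring
  · rw [Module.finrank_prod, Module.finrank_fintype_fun_eq_card,
      Module.finrank_fintype_fun_eq_card, Fintype.card_finset, Fintype.card_fin, alphabetBound]
    have := Finset.single_le_sum (f := fun k => Fintype.card (𝒴 k)) (fun _ _ => Nat.zero_le _)
      (Finset.mem_univ k₀)
    have h' : Fintype.card (𝒴 k₀) ≤ ∑ k, Fintype.card (𝒴 k) := this
    omega

lemma exists_sparse (hs : IsSource p₀ κ) (hW : IsChannel W) (A : Finset (Fin K)) :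
    ∃ W' : ∀ k, 𝒴 k → 𝒰 k → ℝ, IsChannel W' ∧
      tradeoff (source p₀ κ) W' = tradeoff (source p₀ κ) W ∧
      ∀ k ∈ A, ∃ F : Finset (𝒰 k), F.card ≤ alphabetBound 𝒴 ∧ ∀ y, ∀ u ∉ F, W' k y u = 0 := by
  classical
  induction A using Finset.induction_on with
  | empty => exact ⟨W, hW, rfl, by simp⟩
  | insert k₀ A _ ih =>
    obtain ⟨W', hW', htr, hF⟩ := ih
    obtain ⟨t, -, hch, htr', F, hFc, hFt⟩ := exists_sparse_step hs hW' k₀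
    refine ⟨_, hch, htr'.trans htr, fun k hk => ?_⟩
    by_cases hk' : k = k₀
    · subst hk'
      exact ⟨F, hFc, fun y u hu => by simp [hFt u hu]⟩
    · obtain ⟨F', hF', h0⟩ := hF k (Finset.mem_of_mem_insert_of_ne hk hk')
      exact ⟨F', hF', fun y u hu => by rw [h0 y u hu, mul_zero]⟩

lemma IsChannel.map {𝒰' : Fin K → Type*} [∀ k, Fintype (𝒰' k)] (hW : IsChannel W)
    (e : ∀ k, 𝒰 k → 𝒰' k) :
    IsChannel (fun k y (u' : 𝒰' k) => ∑ u, W k y u * ind (e k u = u')) := by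
  intro k y
  refine ⟨fun u' => Finset.sum_nonneg fun u _ => mul_nonneg ((hW k y).1 u) (ind_nonneg _), ?_⟩
  rw [Finset.sum_comm, ← (hW k y).2]
  exact Finset.sum_congr rfl fun u _ => sum_mul_ind' (e k u) (fun _ => W k y u)

/-- The tradeoff vectors of channels with output alphabets of bounded size. -/
def tradeoffSet (P : Letter 𝒳 𝒴₀ 𝒴 → ℝ) : Set (Finset (Fin K) → ℝ) :=
  {v | ∃ W : ∀ k, 𝒴 k → Fin (alphabetBound 𝒴) → ℝ, IsChannel W ∧ tradeoff P W = v}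

/-- After sparsification the supports of all encoders embed in one fixed alphabet, so channels with
arbitrary finite outputs yield nothing new. -/
lemma tradeoff_mem_tradeoffSet (hs : IsSource p₀ κ) (hW : IsChannel W) :
    tradeoff (source p₀ κ) W ∈ tradeoffSet (source p₀ κ) := by
  classical
  obtain ⟨W', hW', htr, hF⟩ := exists_sparse hs hW Finset.univ
  choose F hFc hF0 using fun k => hF k (Finset.mem_univ k)
  have hemb : ∀ k, Nonempty (F k ↪ Fin (alphabetBound 𝒴)) := fun k => by
    rw [Function.Embedding.nonempty_iff_card_le]
    simpa using hFc k
  let e := fun k => (hemb k).some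
  have hW'' : IsChannel (fun k y (u : F k) => W' k y u) := by
    intro k y
    refine ⟨fun u => (hW' k y).1 _, ?_⟩
    rw [← (hW' k y).2]
    refine (Finset.sum_coe_sort (F k) (fun u => W' k y u)).trans ?_
    exact Finset.sum_subset (Finset.subset_univ _) fun u _ hu => hF0 k y u hu
  refine ⟨_, hW''.map (fun k => e k), ?_⟩
  rw [tradeoff_map_injective (source p₀ κ) (fun k y (u : F k) => W' k y u) _ (fun k => e k)
    (fun _ _ _ => rfl) (fun k => (e k).injective), ← htr]
  exact tradeoff_comp_injective (source p₀ κ) W' (fun k (u : F k) => (u : 𝒰 k))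
    (fun k => Subtype.val_injective) fun k y u' hu => hF0 k y u' (by simpa using hu)

end Cardinality

/-- In finite dimension the convex hull of a compact set is compact. -/
lemma isCompact_convexHull_of_finiteDimensional {E : Type*} [NormedAddCommGroup E]
    [NormedSpace ℝ E] [FiniteDimensional ℝ E] {s : Set E} (hs : IsCompact s) :
    IsCompact (convexHull ℝ s) := by
  classical
  rcases s.eq_empty_or_nonempty with rfl | ⟨x₀, hx₀⟩
  · simp
  set d := Module.finrank ℝ E + 1
  have himg : convexHull ℝ s = (fun a : (Fin d → ℝ) × (Fin d → E) => ∑ i, a.1 i • a.2 i) ''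
      (stdSimplex ℝ (Fin d) ×ˢ Set.univ.pi fun _ => s) := by
    apply Set.Subset.antisymm
    · intro x hx
      obtain ⟨ι, hι, z, w, hz, haff, hw, hw1, hsum⟩ := eq_pos_convex_span_of_mem_convexHull hx
      have hcard : Fintype.card ι ≤ Fintype.card (Fin d) := by
        rw [Fintype.card_fin]
        exact haff.card_le_finrank_succ.trans (Nat.add_le_add_right (Submodule.finrank_le _) 1)
      obtain ⟨e⟩ := Function.Embedding.nonempty_of_card_le hcard
      -- Carathéodory may use fewer than `d` points; the spare slots get weight zero and the dummy
      -- point `x₀`.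
      refine ⟨(fun j => ∑ i, w i * ind (e i = j), fun j => if h : ∃ i, e i = j then z h.choose
        else x₀), ⟨⟨fun j => Finset.sum_nonneg fun i _ => mul_nonneg (hw i).le (ind_nonneg _), ?_⟩,
        fun j _ => ?_⟩, ?_⟩
      · rw [Finset.sum_comm, ← hw1]
        exact Finset.sum_congr rfl fun i _ => sum_mul_ind' (e i) (fun _ => w i)
      · dsimp only
        split_ifs with h
        · exact hz ⟨_, rfl⟩
        · exact hx₀
      · dsimp only
        rw [← hsum]
        simp_rw [Finset.sum_smul]
        rw [Finset.sum_comm]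
        refine Finset.sum_congr rfl fun i _ => ?_
        rw [Finset.sum_eq_single (e i)]
        · have h : ∃ i', e i' = e i := ⟨i, rfl⟩
          rw [ind_true rfl, mul_one, dif_pos h, e.injective h.choose_spec]
        · intro j _ hj; rw [ind_false (Ne.symm hj)]; simp
        · simp
    · rintro _ ⟨⟨w, z⟩, ⟨hw, hz⟩, rfl⟩
      exact (convex_convexHull ℝ s).sum_mem (fun i _ => hw.1 i) hw.2
        fun i _ => subset_convexHull ℝ s (hz i (Set.mem_univ i))
  rw [himg]
  refine ((isCompact_stdSimplex ℝ (Fin d)).prod (isCompact_univ_pi fun _ => hs)).image ?_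
  fun_prop

/-! ### Compactness of the set of tradeoff vectors. -/

section Compactness

variable {K : ℕ} {𝒳 𝒴₀ : Type*} {𝒴 : Fin K → Type*}
variable [Fintype 𝒳] [Fintype 𝒴₀] [∀ k, Fintype (𝒴 k)]
variable {p₀ : 𝒳 × 𝒴₀ → ℝ} {κ : ∀ k, 𝒳 × 𝒴₀ → 𝒴 k → ℝ}

lemma continuous_ent_channelJoint {α : Type*} [Fintype α] {𝒰 : Fin K → Type*}
    [∀ k, Fintype (𝒰 k)] (P : Letter 𝒳 𝒴₀ 𝒴 → ℝ) (A : Letter 𝒳 𝒴₀ 𝒴 × (∀ k, 𝒰 k) → α) :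
    Continuous fun W : ∀ k, 𝒴 k → 𝒰 k → ℝ => ent (channelJoint P W) A := by
  simp_rw [ent_eq_sum_negMulLog, pmfOf_eq, channelJoint]
  refine continuous_finsetSum _ fun a _ => Real.continuous_negMulLog.comp ?_
  fun_prop

/-- Continuity is read off from the entropy expansion, since -x log x is continuous at 0. The
expansion needs non-negative masses, hence the restriction to channels. -/
lemma continuousOn_condMutualInfo {α β γ : Type*} [Fintype α] [Fintype β] [Fintype γ]
    {𝒰 : Fin K → Type*} [∀ k, Fintype (𝒰 k)] (hs : IsSource p₀ κ)
    (A : Letter 𝒳 𝒴₀ 𝒴 × (∀ k, 𝒰 k) → α) (B : Letter 𝒳 𝒴₀ 𝒴 × (∀ k, 𝒰 k) → β)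
    (C : Letter 𝒳 𝒴₀ 𝒴 × (∀ k, 𝒰 k) → γ) :
    ContinuousOn (fun W => condMutualInfo (channelJoint (source p₀ κ) W) A B C)
      {W : ∀ k, 𝒴 k → 𝒰 k → ℝ | IsChannel W} := by
  refine ContinuousOn.congr (f := fun W => ent (channelJoint (source p₀ κ) W)
      (fun ω => (A ω, C ω)) + ent (channelJoint (source p₀ κ) W) (fun ω => (B ω, C ω)) -
      ent (channelJoint (source p₀ κ) W) (fun ω => (A ω, B ω, C ω)) -
      ent (channelJoint (source p₀ κ) W) C) ?_
    fun W hW => condMutualInfo_eq_ent (channelJoint_nonneg hs hW) A B C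
  exact ((((continuous_ent_channelJoint _ _).add (continuous_ent_channelJoint _ _)).sub
    (continuous_ent_channelJoint _ _)).sub (continuous_ent_channelJoint _ _)).continuousOn

lemma isCompact_tradeoffSet (hs : IsSource p₀ κ) : IsCompact (tradeoffSet (source p₀ κ)) := by
  have himg : tradeoffSet (source p₀ κ) = tradeoff (source p₀ κ) ''
      {W : ∀ k, 𝒴 k → Fin (alphabetBound 𝒴) → ℝ | IsChannel W} := rfl
  rw [himg]
  have hc : IsCompact {W : ∀ k, 𝒴 k → Fin (alphabetBound 𝒴) → ℝ | IsChannel W} := by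
    have : {W : ∀ k, 𝒴 k → Fin (alphabetBound 𝒴) → ℝ | IsChannel W} =
        Set.univ.pi fun k => Set.univ.pi fun _ : 𝒴 k =>
          stdSimplex ℝ (Fin (alphabetBound 𝒴)) := by
      ext W; simp only [IsChannel, Set.mem_ofPred_eq, Set.mem_pi, Set.mem_univ, true_imp_iff]
    rw [this]
    exact isCompact_univ_pi fun k => isCompact_univ_pi fun _ => isCompact_stdSimplex _ _
  refine hc.image_of_continuousOn (continuousOn_pi.2 fun S => ?_)
  exact (continuousOn_condMutualInfo hs _ _ _).sub
    (continuousOn_finsetSum _ fun k _ => continuousOn_condMutualInfo hs _ _ _)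

end Compactness

end

end DistHT

namespace DistHT

noncomputable section

set_option linter.unusedSectionVars false

/-- Summation by parts along a chain. -/
lemma sum_range_sub_mul (b F : ℕ → ℝ) (n : ℕ) :
    ∑ i ∈ Finset.range (n + 1), (b i - b (i + 1)) * F i =
      b 0 * F 0 + ∑ i ∈ Finset.range n, b (i + 1) * (F (i + 1) - F i) - b (n + 1) * F n := by
  induction n with
  | zero => simp; ring
  | succ n ih => rw [Finset.sum_range_succ, ih, Finset.sum_range_succ]; ring

/-! ### Greedy vertices for a submodular function and the dual bound. -/

section Greedy

variable {K : ℕ}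

/-- The first `i` elements of `Fin K` in the order given by `σ`. -/
def initialSegment (σ : Equiv.Perm (Fin K)) (i : ℕ) : Finset (Fin K) :=
  Finset.univ.filter fun k => (σ.symm k : ℕ) < i

lemma initialSegment_zero (σ : Equiv.Perm (Fin K)) : initialSegment σ 0 = ∅ := by
  simp [initialSegment]

lemma initialSegment_card (σ : Equiv.Perm (Fin K)) : initialSegment σ K = Finset.univ := by
  ext k; simp [initialSegment]

lemma initialSegment_succ (σ : Equiv.Perm (Fin K)) (i : Fin K) :
    initialSegment σ (i + 1) = insert (σ i) (initialSegment σ i) := by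
  ext k
  simp only [initialSegment, Finset.mem_filter, Finset.mem_univ, true_and, Finset.mem_insert]
  rw [Nat.lt_succ_iff_lt_or_eq, or_comm, ← Fin.ext_iff, Equiv.symm_apply_eq]

lemma notMem_initialSegment (σ : Equiv.Perm (Fin K)) (i : Fin K) :
    σ i ∉ initialSegment σ i := by
  simp [initialSegment]

variable {ρ : Finset (Fin K) → ℝ}

/-- Submodularity for `G.erase k` and `g`. The hypothesis `hk` also admits `k ∉ G`, where both
increments vanish. -/
lemma diminishing_returns (hρ : ∀ A B, ρ (A ∪ B) + ρ (A ∩ B) ≤ ρ A + ρ B)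
    {g G : Finset (Fin K)} (h : g ⊆ G) (k : Fin K) (hk : k ∈ G → k ∈ g) :
    ρ G - ρ (G.erase k) ≤ ρ g - ρ (g.erase k) := by
  have h1 := hρ (G.erase k) g
  have h2 : G.erase k ∪ g = G := by
    ext l
    simp only [Finset.mem_union, Finset.mem_erase]
    constructor
    · rintro (h' | h')
      exacts [h'.2, h h']
    · intro hl
      by_cases hlk : l = k
      · subst hlk; exact Or.inr (hk hl)
      · exact Or.inl ⟨hlk, hl⟩
  have h3 : G.erase k ∩ g = g.erase k := by
    ext l
    simp only [Finset.mem_inter, Finset.mem_erase]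
    exact ⟨fun h' => ⟨h'.1.1, h'.2⟩, fun h' => ⟨⟨h'.1, h h'.2⟩, h'.2⟩⟩
  rw [h2, h3] at h1
  linarith

/-- Marginal values along the chain of initial segments, restricted to `T`. -/
def marginalValue (ρ : Finset (Fin K) → ℝ) (σ : Equiv.Perm (Fin K)) (T : Finset (Fin K))
    (i : ℕ) : ℝ := ρ (T \ initialSegment σ i) - ρ (T \ initialSegment σ (i + 1))

lemma sum_marginalValue (ρ : Finset (Fin K) → ℝ) (σ : Equiv.Perm (Fin K)) (T : Finset (Fin K)) :
    ∑ i : Fin K, marginalValue ρ σ T i = ρ T - ρ ∅ := by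
  rw [Fin.sum_univ_eq_sum_range (fun i => marginalValue ρ σ T i)]
  unfold marginalValue
  rw [Finset.sum_range_sub', initialSegment_zero, initialSegment_card,
    Finset.sdiff_eq_empty_iff_subset.2 (Finset.subset_univ _), Finset.sdiff_empty]

lemma marginalValue_mono (hρ : ∀ A B, ρ (A ∪ B) + ρ (A ∩ B) ≤ ρ A + ρ B)
    (σ : Equiv.Perm (Fin K)) (T : Finset (Fin K)) (i : Fin K) (hi : σ i ∈ T) :
    marginalValue ρ σ Finset.univ i ≤ marginalValue ρ σ T i := by
  have h := diminishing_returns hρ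
    (Finset.sdiff_subset_sdiff (Finset.subset_univ T) (subset_refl (initialSegment σ i))) (σ i)
    (fun _ => Finset.mem_sdiff.2 ⟨hi, notMem_initialSegment σ i⟩)
  simp only [marginalValue, initialSegment_succ, Finset.sdiff_insert] at h ⊢
  exact h

lemma marginalValue_eq_zero (σ : Equiv.Perm (Fin K)) (T : Finset (Fin K)) (i : Fin K)
    (hi : σ i ∉ T) : marginalValue ρ σ T i = 0 := by
  simp only [marginalValue, initialSegment_succ, Finset.sdiff_insert]
  rw [Finset.erase_eq_of_notMem (fun h => hi (Finset.mem_sdiff.1 h).1), sub_self]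

/-- Feasibility of the greedy vertex. -/
lemma sub_le_sum_marginalValue (hρ : ∀ A B, ρ (A ∪ B) + ρ (A ∩ B) ≤ ρ A + ρ B)
    (σ : Equiv.Perm (Fin K)) (T S : Finset (Fin K)) :
    ρ T - ρ (T \ S) ≤ ∑ k ∈ S, marginalValue ρ σ T (σ.symm k) := by
  have key : ∀ n : ℕ, n ≤ K → ρ T - ρ (T \ (S ∩ initialSegment σ n)) ≤
      ∑ k ∈ S ∩ initialSegment σ n, marginalValue ρ σ T (σ.symm k) := by
    intro n
    induction n with
    | zero => intro _; simp [initialSegment_zero]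
    | succ n ih =>
      intro hn
      have ih' := ih (by omega)
      have hseg := initialSegment_succ σ ⟨n, by omega⟩
      simp only at hseg
      have hnot := notMem_initialSegment σ ⟨n, by omega⟩
      simp only at hnot
      set k := σ ⟨n, by omega⟩ with hk
      rw [hseg]
      by_cases hkS : k ∈ S
      · rw [Finset.inter_insert_of_mem hkS, Finset.sum_insert (by simp [hnot]),
          Finset.sdiff_insert]
        have hmv : marginalValue ρ σ T (σ.symm k) =
            ρ (T \ initialSegment σ n) - ρ ((T \ initialSegment σ n).erase k) := by
          rw [hk, Equiv.symm_apply_apply]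
          simp only [marginalValue]
          rw [hseg, Finset.sdiff_insert]
        -- Removing only S ∩ (initial segment) leaves a larger set than removing the whole segment,
        -- so deleting `k` costs less there.
        have := diminishing_returns hρ (Finset.sdiff_subset_sdiff (subset_refl T)
          (Finset.inter_subset_right (s₁ := S) (s₂ := initialSegment σ n))) k
          (fun h => Finset.mem_sdiff.2 ⟨(Finset.mem_sdiff.1 h).1, hnot⟩)
        rw [hmv]
        linarith
      · rw [Finset.inter_insert_of_notMem hkS]
        exact ih'
  have := key K le_rfl
  rwa [initialSegment_card, Finset.inter_univ] at this

/-- The linear functional of a vector indexed by sets that is dual to the rate weights `c` and the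
exponent weight `μ`. -/
def chainFunctional (σ : Equiv.Perm (Fin K)) (b : ℕ → ℝ) (v : Finset (Fin K) → ℝ) : ℝ :=
  ∑ i ∈ Finset.range (K + 1), (b i - b (i + 1)) * v (initialSegment σ i)

/-- The weights along the chain. -/
def chainWeight (σ : Equiv.Perm (Fin K)) (c : Fin K → ℝ) (μ : ℝ) : ℕ → ℝ
  | 0 => μ
  | i + 1 => if h : i < K then min (c (σ ⟨i, h⟩)) μ else 0

/-- Abel summation; the boundary term disappears because the last weight is 0. -/
lemma chainFunctional_eq (σ : Equiv.Perm (Fin K)) (c : Fin K → ℝ) (μ : ℝ)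
    (v : Finset (Fin K) → ℝ) :
    chainFunctional σ (chainWeight σ c μ) v = μ * v ∅ + ∑ i : Fin K, min (c (σ i)) μ *
      (v (insert (σ i) (initialSegment σ i)) - v (initialSegment σ i)) := by
  rw [chainFunctional, sum_range_sub_mul (chainWeight σ c μ) (fun i => v (initialSegment σ i))]
  have h1 : chainWeight σ c μ (K + 1) = 0 := by simp [chainWeight]
  rw [h1, initialSegment_zero, zero_mul, sub_zero, ← Fin.sum_univ_eq_sum_range
    (fun i => chainWeight σ c μ (i + 1) * (v (initialSegment σ (i + 1)) - v (initialSegment σ i)))]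
  simp only [chainWeight, initialSegment_succ, Fin.is_lt, dite_true, Fin.eta]

/-- The coefficients of `chainFunctional` are multipliers for the constraints along the chain. They
are non-negative because the prices decrease and are capped at μ. -/
lemma chainWeight_antitone {σ : Equiv.Perm (Fin K)} {c : Fin K → ℝ} {μ : ℝ}
    (hc : ∀ k, 0 ≤ c k) (hμ : 0 ≤ μ) (hσ : Antitone (c ∘ σ)) (i : ℕ) :
    0 ≤ chainWeight σ c μ i - chainWeight σ c μ (i + 1) := by
  rw [sub_nonneg]
  cases i with
  | zero =>
    simp only [chainWeight]
    split_ifs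
    · exact min_le_right _ _
    · exact hμ
  | succ i =>
    simp only [chainWeight]
    split_ifs with h1 h2
    · exact min_le_min_right μ (hσ (by simp [Fin.le_def]))
    · omega
    · exact le_min (hc _) hμ
    · exact le_rfl

/-- Lower bound on the rates and upper bound on the exponent allowed by the tradeoff vector `v`. -/
lemma neg_chainFunctional_le {σ : Equiv.Perm (Fin K)} {c : Fin K → ℝ} {μ : ℝ}
    (hc : ∀ k, 0 ≤ c k) (hμ : 0 ≤ μ) (hσ : Antitone (c ∘ σ)) {R : Fin K → ℝ}
    (hR : ∀ k, 0 ≤ R k) {E : ℝ} {v : Finset (Fin K) → ℝ} (h : ∀ S, E ≤ v S + ∑ k ∈ S, R k) :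
    -chainFunctional σ (chainWeight σ c μ) v ≤ ∑ k, c k * R k - μ * E := by
  -- Weak duality: only the constraints for initial segments are combined. The multipliers add up to
  -- μ on the exponent and to min(c_k, μ) ≤ c_k on each rate.
  have h1 : 0 ≤ chainFunctional σ (chainWeight σ c μ) (fun S => v S + ∑ k ∈ S, R k - E) :=
    Finset.sum_nonneg fun i _ => mul_nonneg (chainWeight_antitone hc hμ hσ i)
      (by linarith [h (initialSegment σ i)])
  have h2 : chainFunctional σ (chainWeight σ c μ) (fun S => v S + ∑ k ∈ S, R k - E) =
      chainFunctional σ (chainWeight σ c μ) v +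
        chainFunctional σ (chainWeight σ c μ) (fun S => ∑ k ∈ S, R k) -
        chainFunctional σ (chainWeight σ c μ) (fun _ => E) := by
    simp only [chainFunctional, ← Finset.sum_add_distrib, ← Finset.sum_sub_distrib]
    exact Finset.sum_congr rfl fun i _ => by ring
  have h3 : chainFunctional σ (chainWeight σ c μ) (fun _ => E) = μ * E := by
    rw [chainFunctional_eq]; simp
  have h4 : chainFunctional σ (chainWeight σ c μ) (fun S => ∑ k ∈ S, R k) ≤ ∑ k, c k * R k := by
    rw [chainFunctional_eq]
    simp only [Finset.sum_empty, mul_zero, zero_add]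
    rw [← Equiv.sum_comp σ (fun k => c k * R k)]
    refine Finset.sum_le_sum fun i _ => ?_
    rw [Finset.sum_insert (notMem_initialSegment σ i), add_sub_cancel_right]
    exact mul_le_mul_of_nonneg_right (min_le_left _ _) (hR _)
  linarith

/-- The greedy vertex attains the bound. -/
lemma greedy_le_neg_chainFunctional (hρ : ∀ A B, ρ (A ∪ B) + ρ (A ∩ B) ≤ ρ A + ρ B)
    (hρ0 : ρ ∅ = 0) {j : Fin K → ℝ} (hj : ∀ k, 0 ≤ j k) (σ : Equiv.Perm (Fin K))
    {c : Fin K → ℝ} {μ : ℝ} (hμ : 0 ≤ μ) (T : Finset (Fin K)) (hT : ∀ k, k ∈ T ↔ c k ≤ μ) :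
    ∑ k, c k * (marginalValue ρ σ T (σ.symm k) + if k ∈ T then j k else 0) - μ * ρ T ≤
      -chainFunctional σ (chainWeight σ c μ) (fun S => ρ Sᶜ - ∑ k ∈ S, j k) := by
  rw [chainFunctional_eq]
  have h1 : ρ T = ∑ i : Fin K, marginalValue ρ σ T i := by
    rw [sum_marginalValue, hρ0, sub_zero]
  have h2 : ρ Finset.univ = ∑ i : Fin K, marginalValue ρ σ Finset.univ i := by
    rw [sum_marginalValue, hρ0, sub_zero]
  rw [h1, ← Equiv.sum_comp σ, Finset.compl_empty, Finset.sum_empty, sub_zero, h2, neg_add,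
    ← sub_eq_add_neg, Finset.mul_sum, Finset.mul_sum, ← Finset.sum_sub_distrib,
    ← Finset.sum_neg_distrib, ← Finset.sum_sub_distrib]
  refine Finset.sum_le_sum fun i _ => ?_
  have hmv : ρ (insert (σ i) (initialSegment σ i))ᶜ - ρ (initialSegment σ i)ᶜ =
      -marginalValue ρ σ Finset.univ i := by
    simp only [marginalValue, initialSegment_succ, Finset.compl_eq_univ_sdiff]; ring
  rw [Equiv.symm_apply_apply, Finset.sum_insert (notMem_initialSegment σ i)]
  rw [show ∀ a b x y : ℝ, a - (x + y) - (b - y) = (a - b) - x by intros; ring, hmv]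
  -- Encoders in T pay c ≤ μ per unit, and their marginal value inside T is at least that inside the
  -- full set. The others have zero marginal value, which leaves only μ j ≥ 0.
  by_cases hi : σ i ∈ T
  · have hle := (hT _).1 hi
    rw [if_pos hi, min_eq_left hle]
    have := mul_le_mul_of_nonneg_left (marginalValue_mono hρ σ T i hi) (sub_nonneg.2 hle)
    linarith
  · have hlt : μ ≤ c (σ i) := (not_le.1 fun h => hi ((hT _).2 h)).le
    rw [if_neg hi, min_eq_right hlt, marginalValue_eq_zero σ T i hi]
    have := mul_nonneg hμ (hj (σ i))
    linarith

end Greedy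

end

end DistHT

namespace DistHT

noncomputable section

set_option linter.unusedSectionVars false

/-! ### Silencing encoders. -/

section Erasure

variable {K : ℕ} {𝒳 𝒴₀ : Type*} {𝒴 𝒰 : Fin K → Type*}
variable [Fintype 𝒳] [Fintype 𝒴₀] [∀ k, Fintype (𝒴 k)] [∀ k, Fintype (𝒰 k)]
variable {p₀ : 𝒳 × 𝒴₀ → ℝ} {κ : ∀ k, 𝒳 × 𝒴₀ → 𝒴 k → ℝ} {W : ∀ k, 𝒴 k → 𝒰 k → ℝ}

lemma relevance_empty (hs : IsSource p₀ κ) (hW : IsChannel W) :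
    relevance (source p₀ κ) W ∅ = 0 := by
  rw [relevance_eq_sum hs hW]
  refine Finset.sum_eq_zero fun ω _ => ?_
  by_cases h0 : channelJoint (source p₀ κ) W ω = 0
  · simp [h0]
  · rw [Finset.prod_empty, one_mul, div_self, Real.log_one, mul_zero]
    exact ((factors_pos hs hW h0).2.2.2.2 ∅).ne'

/-- Making the outputs outside `T` constant. -/
lemma exists_tradeoff_erase (hs : IsSource p₀ κ) (hW : IsChannel W) (d : ∀ k, 𝒰 k)
    (T : Finset (Fin K)) :
    ∃ W' : ∀ k, 𝒴 k → 𝒰 k → ℝ, IsChannel W' ∧ ∀ S, tradeoff (source p₀ κ) W' S =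
      relevance (source p₀ κ) W (T \ S) -
        ∑ k ∈ S, if k ∈ T then excessRate (source p₀ κ) W k else 0 := by
  classical
  let e : ∀ k, 𝒰 k → 𝒰 k := fun k u => if k ∈ T then u else d k
  have he : ∀ k ∈ T, Function.Injective (e k) := fun k hk u u' h => by simpa [e, hk] using h
  have he' : ∀ k ∉ T, ∀ u u', e k u = e k u' := fun k hk u u' => by simp [e, hk]
  refine ⟨_, hW.map e, fun S => ?_⟩
  unfold tradeoff
  rw [relevance_map (source p₀ κ) W _ e (fun _ _ _ => rfl) Sᶜ (T \ S)]
  · congr 1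
    refine Finset.sum_congr rfl fun k _ => ?_
    split_ifs with hk
    · exact excessRate_map _ W _ e (fun _ _ _ => rfl) k (he k hk)
    · exact excessRate_map_const (channelJoint_nonneg hs hW) _ e (fun _ _ _ => rfl) k (he' k hk)
  · exact fun k hk => he k (Finset.mem_sdiff.1 hk).1
  · intro k hk; exact Finset.mem_compl.2 (Finset.mem_sdiff.1 hk).2
  · intro k hk hk'
    exact he' k fun h => hk' (Finset.mem_sdiff.2 ⟨h, Finset.mem_compl.1 hk⟩)

end Erasure

/-! ### Separation argument for quantization and binning. -/

section Separation

variable {K : ℕ} {𝒳 𝒴₀ : Type*} {𝒴 : Fin K → Type*}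
variable [Fintype 𝒳] [Fintype 𝒴₀] [∀ k, Fintype (𝒴 k)]
variable {p₀ : 𝒳 × 𝒴₀ → ℝ} {κ : ∀ k, 𝒳 × 𝒴₀ → 𝒴 k → ℝ}

/-- The rates and exponents supported by quantization and binning for some vector in `C`. -/
def binningSet (C : Set (Finset (Fin K) → ℝ)) : Set ((Fin K → ℝ) × ℝ) :=
  {x | ∃ v ∈ C, (∀ S, v ∅ - v S ≤ ∑ k ∈ S, x.1 k) ∧ x.2 ≤ v ∅}

lemma convex_binningSet {C : Set (Finset (Fin K) → ℝ)} (hC : Convex ℝ C) :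
    Convex ℝ (binningSet C) := by
  rintro x ⟨v, hv, hv1, hv2⟩ y ⟨w, hw, hw1, hw2⟩ a b ha hb hab
  refine ⟨a • v + b • w, hC hv hw ha hb hab, fun S => ?_, ?_⟩
  · have h1 := mul_le_mul_of_nonneg_left (hv1 S) ha
    have h2 := mul_le_mul_of_nonneg_left (hw1 S) hb
    simp only [Pi.add_apply, Pi.smul_apply, smul_eq_mul, Prod.fst_add, Prod.smul_fst,
      Finset.sum_add_distrib, ← Finset.mul_sum]
    linarith
  · have h1 := mul_le_mul_of_nonneg_left hv2 ha
    have h2 := mul_le_mul_of_nonneg_left hw2 hb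
    simp only [Pi.add_apply, Pi.smul_apply, smul_eq_mul, Prod.snd_add, Prod.smul_snd]
    linarith

/-- The set is the projection of a closed set along the compact factor C. -/
lemma isClosed_binningSet {C : Set (Finset (Fin K) → ℝ)} (hC : IsCompact C) :
    IsClosed (binningSet C) := by
  have : CompactSpace C := isCompact_iff_compactSpace.1 hC
  have himg : binningSet C = Prod.snd '' {q : C × ((Fin K → ℝ) × ℝ) |
      (∀ S, (q.1 : Finset (Fin K) → ℝ) ∅ - (q.1 : Finset (Fin K) → ℝ) S ≤ ∑ k ∈ S, q.2.1 k) ∧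
      q.2.2 ≤ (q.1 : Finset (Fin K) → ℝ) ∅} := by
    ext x
    constructor
    · rintro ⟨v, hv, h⟩; exact ⟨(⟨v, hv⟩, x), h, rfl⟩
    · rintro ⟨⟨⟨v, hv⟩, x⟩, h, rfl⟩; exact ⟨v, hv, h⟩
  rw [himg]
  have hcont : ∀ S, Continuous fun q : C × ((Fin K → ℝ) × ℝ) => (q.1 : Finset (Fin K) → ℝ) S :=
    fun S => (continuous_apply S).comp (continuous_subtype_val.comp continuous_fst)
  refine isClosedMap_snd_of_compactSpace _ (IsClosed.and ?_ ?_)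
  · simp only [Set.ofPred_forall]
    refine isClosed_iInter fun S => isClosed_le ((hcont _).sub (hcont _)) ?_
    fun_prop
  · exact isClosed_le (by fun_prop) (hcont _)

lemma dual_apply (f : StrongDual ℝ ((Fin K → ℝ) × ℝ)) (x : (Fin K → ℝ) × ℝ) :
    f x = ∑ k, f (Pi.single k 1, 0) * x.1 k + f (0, 1) * x.2 := by
  have hx : x = ∑ k, x.1 k • ((Pi.single k 1, 0) : (Fin K → ℝ) × ℝ) +
      x.2 • ((0, 1) : (Fin K → ℝ) × ℝ) := by
    refine Prod.ext ?_ ?_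
    · funext l
      simp [Prod.fst_sum, Finset.sum_apply, Pi.single_apply]
    · simp [Prod.snd_sum]
  conv_lhs => rw [hx]
  rw [map_add, map_sum, map_smul]
  simp only [map_smul, smul_eq_mul]
  congr 1
  · exact Finset.sum_congr rfl fun k _ => mul_comm _ _
  · exact mul_comm _ _

/-- Every rate-exponent tuple that satisfies the tradeoff inequalities is supported by quantization
and binning. -/
lemma mem_binningSet_of_tradeoff (hs : IsSource p₀ κ) {R : Fin K → ℝ} (hR : ∀ k, 0 ≤ R k) {E : ℝ}
    {v : Finset (Fin K) → ℝ} (hv : v ∈ convexHull ℝ (tradeoffSet (source p₀ κ)))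
    (h : ∀ S, E ≤ v S + ∑ k ∈ S, R k) :
    (R, E) ∈ binningSet (convexHull ℝ (tradeoffSet (source p₀ κ))) := by
  classical
  set C := convexHull ℝ (tradeoffSet (source p₀ κ)) with hCdef
  have hC := isCompact_convexHull_of_finiteDimensional (isCompact_tradeoffSet hs)
  by_contra hnot
  obtain ⟨f, s, hfs, hsf⟩ := geometric_hahn_banach_point_closed
    (convex_binningSet (convex_convexHull ℝ (tradeoffSet (source p₀ κ))))
    (isClosed_binningSet hC) hnot
  set c : Fin K → ℝ := fun k => f (Pi.single k 1, 0) with hcdef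
  set μ : ℝ := -f (0, 1) with hμdef
  have hf : ∀ x, f x = ∑ k, c k * x.1 k - μ * x.2 := by
    intro x; rw [dual_apply f x, hμdef]; ring
  -- a point of the binning set, and its recession directions
  obtain ⟨x₀, hx₀⟩ : ∃ x₀, x₀ ∈ binningSet C := by
    -- Each single rate already exceeds every binning requirement; for empty S both sides are zero.
    refine ⟨(fun _ => ∑ S, |v ∅ - v S|, v ∅), v, hv, fun S => ?_, le_rfl⟩
    rcases S.eq_empty_or_nonempty with rfl | ⟨k, hk⟩
    · simp
    · calc v ∅ - v S ≤ |v ∅ - v S| := le_abs_self _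
        _ ≤ ∑ S, |v ∅ - v S| := Finset.single_le_sum (f := fun S => |v ∅ - v S|)
          (fun _ _ => abs_nonneg _) (Finset.mem_univ S)
        _ ≤ ∑ k ∈ S, ∑ S, |v ∅ - v S| := Finset.single_le_sum
          (f := fun _ => ∑ S, |v ∅ - v S|)
          (fun _ _ => Finset.sum_nonneg fun _ _ => abs_nonneg _) hk
  have hup : ∀ x ∈ binningSet C, ∀ y : (Fin K → ℝ) × ℝ, (∀ k, x.1 k ≤ y.1 k) → y.2 ≤ x.2 →
      y ∈ binningSet C := by
    rintro x ⟨w, hw, h1, h2⟩ y hy1 hy2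
    exact ⟨w, hw, fun S => (h1 S).trans (Finset.sum_le_sum fun k _ => hy1 k), hy2.trans h2⟩
  have hdir : ∀ y : (Fin K → ℝ) × ℝ, (∀ k, 0 ≤ y.1 k) → y.2 ≤ 0 → 0 ≤ f y := by
    intro y hy1 hy2
    by_contra hneg
    push Not at hneg
    -- With this length f(x₀ + r y) = s, while f is strictly above s on the binning set.
    set r : ℝ := (f x₀ - s) / (-f y) with hr
    have hpos : 0 ≤ r := div_nonneg (sub_nonneg.2 (hsf x₀ hx₀).le) (by linarith)
    have hmem : x₀ + r • y ∈ binningSet C := by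
      refine hup x₀ hx₀ _ (fun k => ?_) ?_
      · simp only [Prod.fst_add, Prod.smul_fst, Pi.add_apply, Pi.smul_apply, smul_eq_mul]
        linarith [mul_nonneg hpos (hy1 k)]
      · simp only [Prod.snd_add, Prod.smul_snd, smul_eq_mul]
        linarith [mul_nonpos_of_nonneg_of_nonpos hpos hy2]
    have := hsf _ hmem
    rw [map_add, map_smul, smul_eq_mul, hr] at this
    have h0 : f y ≠ 0 := hneg.ne
    have : (f x₀ - s) / (-f y) * f y = -(f x₀ - s) := by field_simp
    linarith
  have hc : ∀ k, 0 ≤ c k := fun k => hdir _ (fun l => by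
    by_cases hl : l = k
    · subst hl; simp
    · simp [hl]) le_rfl
  have hμ : 0 ≤ μ := by
    have := hdir (0, -1) (fun _ => le_rfl) (by simp)
    rw [hf] at this
    simpa using this
  obtain ⟨σ, hσ⟩ : ∃ σ : Equiv.Perm (Fin K), Antitone (c ∘ σ) := by
    refine ⟨Tuple.sort (fun k => -c k), fun i j hij => ?_⟩
    have := Tuple.monotone_sort (fun k => -c k) hij
    simpa using this
  -- every vector of the hull has functional at least `s`
  have hlin : ∀ w ∈ C, s ≤ -chainFunctional σ (chainWeight σ c μ) w := by
    have hconv : Convex ℝ {w : Finset (Fin K) → ℝ |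
        s ≤ -chainFunctional σ (chainWeight σ c μ) w} := by
      intro w hw w' hw' a b ha hb hab
      have e1 : chainFunctional σ (chainWeight σ c μ) (a • w + b • w') =
          a * chainFunctional σ (chainWeight σ c μ) w +
            b * chainFunctional σ (chainWeight σ c μ) w' := by
        simp only [chainFunctional, Finset.mul_sum, ← Finset.sum_add_distrib, Pi.add_apply,
          Pi.smul_apply, smul_eq_mul]
        exact Finset.sum_congr rfl fun i _ => by ring
      simp only [Set.mem_ofPred_eq] at hw hw' ⊢
      rw [e1]
      have h1 := mul_le_mul_of_nonneg_left hw ha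
      have h2 := mul_le_mul_of_nonneg_left hw' hb
      have h3 : a * s + b * s = s := by rw [← add_mul, hab, one_mul]
      linarith
    refine convexHull_min ?_ hconv
    rintro _ ⟨W, hW, rfl⟩
    set ρ := relevance (source p₀ κ) W with hρdef
    set j := excessRate (source p₀ κ) W with hjdef
    have hρ : ∀ A B, ρ (A ∪ B) + ρ (A ∩ B) ≤ ρ A + ρ B := relevance_submodular hs hW
    -- An encoder whose rate price exceeds the value μ of the exponent is silenced. The others get
    -- their greedy marginal value plus their excess rate.
    set T := Finset.univ.filter fun k => c k ≤ μ with hT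
    have hmem : ((fun k => marginalValue ρ σ T (σ.symm k) + if k ∈ T then j k else 0, ρ T) :
        (Fin K → ℝ) × ℝ) ∈ binningSet C := by
      obtain ⟨W', hW', htr⟩ := exists_tradeoff_erase hs hW
        (fun _ => ⟨0, Nat.succ_pos _⟩) T
      refine ⟨_, subset_convexHull ℝ _ ⟨W', hW', rfl⟩, fun S => ?_, ?_⟩
      · rw [htr, htr, Finset.sdiff_empty, Finset.sum_empty, sub_zero, Finset.sum_add_distrib]
        have := sub_le_sum_marginalValue hρ σ T S
        linarith
      · rw [htr, Finset.sdiff_empty, Finset.sum_empty, sub_zero]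
    have h1 := hsf _ hmem
    rw [hf] at h1
    have h2 := greedy_le_neg_chainFunctional hρ (relevance_empty hs hW)
      (fun k => excessRate_nonneg hs hW k) σ (c := c) hμ T (by simp [hT])
    exact (h1.le.trans h2)
  have h1 := neg_chainFunctional_le hc hμ hσ hR h
  have h2 := hlin v hv
  rw [hf] at hfs
  simp only at hfs
  linarith

end Separation

/-! ### Time sharing and the equality of the two single-letter regions. -/

section Regions

variable {K : ℕ} {𝒳 𝒴₀ : Type*} {𝒴 : Fin K → Type*}
variable [Fintype 𝒳] [Fintype 𝒴₀] [∀ k, Fintype (𝒴 k)]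
variable {p₀ : 𝒳 × 𝒴₀ → ℝ} {κ : ∀ k, 𝒳 × 𝒴₀ → 𝒴 k → ℝ}

lemma Auxiliary.mixture_mem (hs : IsSource p₀ κ) (a : Auxiliary 𝒴) :
    (fun S => ∑ q, a.pQ q * tradeoff (source p₀ κ) (a.channel q) S) ∈
      convexHull ℝ (tradeoffSet (source p₀ κ)) := by
  have := (convex_convexHull ℝ (tradeoffSet (source p₀ κ))).sum_mem (t := Finset.univ)
    (fun q _ => a.pQ_mem.1 q) a.pQ_mem.2
    (fun q _ => subset_convexHull ℝ _ (tradeoff_mem_tradeoffSet hs (a.isChannel q)))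
  convert this using 1
  funext S
  simp

lemma exists_auxiliary_of_mem_convexHull {P : Letter 𝒳 𝒴₀ 𝒴 → ℝ} {v : Finset (Fin K) → ℝ}
    (hv : v ∈ convexHull ℝ (tradeoffSet P)) :
    ∃ a : Auxiliary 𝒴, ∀ S, v S = ∑ q, a.pQ q * tradeoff P (a.channel q) S := by
  obtain ⟨ι, hι, w, z, hw, hw1, hz, rfl⟩ := mem_convexHull_iff_exists_fintype.1 hv
  choose W hW hWz using hz
  let e := Fintype.equivFin ι
  refine ⟨⟨fun _ => alphabetBound 𝒴, Fintype.card ι, fun q => w (e.symm q),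
    fun k y q u => W (e.symm q) k y u, ⟨fun q => hw _, ?_⟩, fun k y q => hW _ k y⟩, fun S => ?_⟩
  · rw [e.symm.sum_comp]; exact hw1
  · rw [Finset.sum_apply, ← e.symm.sum_comp]
    refine Finset.sum_congr rfl fun q _ => ?_
    simp only [Pi.smul_apply, smul_eq_mul, ← hWz]
    rfl

/-- The laws of Q correspond to convex combinations of tradeoff vectors, so the region is described
by the hull alone. -/
lemma mem_singleLetterRegion_iff (hs : IsSource p₀ κ) {R : Fin K → ℝ} {E : ℝ} :
    (R, E) ∈ singleLetterRegion (source p₀ κ) ↔ (∀ k, 0 ≤ R k) ∧ 0 ≤ E ∧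
      ∃ v ∈ convexHull ℝ (tradeoffSet (source p₀ κ)), ∀ S, E ≤ v S + ∑ k ∈ S, R k := by
  refine and_congr Iff.rfl (and_congr Iff.rfl ⟨?_, ?_⟩)
  · rintro ⟨a, ha⟩
    exact ⟨_, a.mixture_mem hs, fun S => (ha S).trans_eq (a.tradeoff_eq _ R S)⟩
  · rintro ⟨v, hv, h⟩
    obtain ⟨a, ha⟩ := exists_auxiliary_of_mem_convexHull hv
    refine ⟨a, fun S => ((h S).trans_eq ?_).trans_eq (a.tradeoff_eq _ R S).symm⟩
    rw [ha S]

lemma Auxiliary.joint_nonneg (hs : IsSource p₀ κ) (a : Auxiliary 𝒴) (w : a.Space 𝒳 𝒴₀) :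
    0 ≤ a.joint (source p₀ κ) w :=
  mul_nonneg (mul_nonneg (a.pQ_mem.1 _) (mul_nonneg (hs.base_mem.1 _)
    (Finset.prod_nonneg fun k _ => (hs.kernel_mem k _).1 _)))
    (Finset.prod_nonneg fun k _ => (a.pU_mem k _ _).1 _)

lemma Auxiliary.mass_joint_mixture {α : Type*} (a : Auxiliary 𝒴) (P : Letter 𝒳 𝒴₀ 𝒴 → ℝ)
    (D : Letter 𝒳 𝒴₀ 𝒴 × (∀ k, Fin (a.cardU k)) → α) (w : a.Space 𝒳 𝒴₀) :
    mass (a.joint P) (fun w => (D (w.1, w.2.1), w.2.2)) w =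
      a.pQ w.2.2 * mass (channelJoint P (a.channel w.2.2)) D (w.1, w.2.1) :=
  pmfOf_mixture (a.pmfOf_joint P) D _ _

lemma Auxiliary.mass_joint {α : Type*} (a : Auxiliary 𝒴) (P : Letter 𝒳 𝒴₀ 𝒴 → ℝ)
    (D : Letter 𝒳 𝒴₀ 𝒴 × (∀ k, Fin (a.cardU k)) → α) (w : a.Space 𝒳 𝒴₀) :
    mass (a.joint P) (fun w => D (w.1, w.2.1)) w =
      ∑ q, a.pQ q * mass (channelJoint P (a.channel q)) D (w.1, w.2.1) := by
  unfold mass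
  rw [pmfOf_fst_eq_sum (a.joint P) (fun w => D (w.1, w.2.1)) (fun w => w.2.2)]
  exact Finset.sum_congr rfl fun q _ => pmfOf_mixture (a.pmfOf_joint P) D _ q

/-- `Q` is independent of `(X, Y₀)`. -/
lemma Auxiliary.ent_timeSharing (hs : IsSource p₀ κ) (a : Auxiliary 𝒴) :
    ent (a.joint (source p₀ κ)) (fun w => (a.rvX w, a.rvY₀ w, a.rvQ w)) +
        ent (a.joint (source p₀ κ)) a.rvY₀ =
      ent (a.joint (source p₀ κ)) (fun w => (a.rvX w, a.rvY₀ w)) +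
        ent (a.joint (source p₀ κ)) (fun w => (a.rvY₀ w, a.rvQ w)) := by
  refine ent_add_eq_of_mass (a.joint_nonneg hs) fun w _ => ?_
  have h1 : mass (a.joint (source p₀ κ)) (fun w => (a.rvX w, a.rvY₀ w, a.rvQ w)) w =
      a.pQ w.2.2 * p₀ (w.1.1, w.1.2.1) := by
    have e := a.mass_joint_mixture (source p₀ κ) (fun v => (v.1.1, v.1.2.1)) w
    rw [mass_pair hs (a.isChannel _)] at e
    rw [← e]
    refine mass_congr fun w' _ => ?_
    simp only [Prod.mk.injEq, Auxiliary.rvX, Auxiliary.rvY₀, Auxiliary.rvQ]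
    tauto
  have h2 : mass (a.joint (source p₀ κ)) (fun w => (a.rvX w, a.rvY₀ w)) w =
      p₀ (w.1.1, w.1.2.1) := by
    have e := a.mass_joint (source p₀ κ) (fun v => (v.1.1, v.1.2.1)) w
    simp_rw [fun q => mass_pair hs (a.isChannel q)] at e
    rw [← Finset.sum_mul, a.pQ_mem.2, one_mul] at e
    exact e
  have hside : ∀ q, mass (channelJoint (source p₀ κ) (a.channel q)) (fun v => v.1.2.1)
      (w.1, w.2.1) = ∑ x, p₀ (x, w.1.2.1) := by
    intro q
    rw [mass_side hs (a.isChannel q)]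
    simp [outputMarginal]
  have h3 : mass (a.joint (source p₀ κ)) (fun w => (a.rvY₀ w, a.rvQ w)) w =
      a.pQ w.2.2 * ∑ x, p₀ (x, w.1.2.1) := by
    have e := a.mass_joint_mixture (source p₀ κ) (fun v => v.1.2.1) w
    rw [hside] at e
    exact e
  have h4 : mass (a.joint (source p₀ κ)) a.rvY₀ w = ∑ x, p₀ (x, w.1.2.1) := by
    have e := a.mass_joint (source p₀ κ) (fun v => v.1.2.1) w
    simp_rw [hside] at e
    rw [← Finset.sum_mul, a.pQ_mem.2, one_mul] at e
    exact e
  rw [h1, h2, h3, h4]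
  ring

/-- I(U;X|Y₀) ≤ I(U,Q;X|Y₀) = I(U;X|Y₀,Q), the last step because Q is independent of (X,Y₀). -/
lemma Auxiliary.relevance_le (hs : IsSource p₀ κ) (a : Auxiliary 𝒴) :
    condMutualInfo (a.joint (source p₀ κ)) (a.rvUs Finset.univ) a.rvX a.rvY₀ ≤
      condMutualInfo (a.joint (source p₀ κ)) (a.rvUs Finset.univ) a.rvX
        (fun w => (a.rvY₀ w, a.rvQ w)) := by
  have hp := a.joint_nonneg hs
  rw [condMutualInfo_eq_ent hp, condMutualInfo_eq_ent hp]
  have h1 := a.ent_timeSharing hs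
  have h2 := ent_submodular hp a.rvQ a.rvX (fun w => (a.rvUs Finset.univ w, a.rvY₀ w))
  have e1 : ent (a.joint (source p₀ κ)) (fun w => (a.rvQ w, a.rvX w, a.rvUs Finset.univ w,
      a.rvY₀ w)) = ent (a.joint (source p₀ κ)) (fun w => (a.rvUs Finset.univ w, a.rvX w,
      a.rvY₀ w, a.rvQ w)) :=
    ent_congr fun w w' _ _ => by simp only [Prod.mk.injEq]; tauto
  have e2 : ent (a.joint (source p₀ κ)) (fun w => (a.rvQ w, a.rvUs Finset.univ w, a.rvY₀ w)) =
      ent (a.joint (source p₀ κ)) (fun w => (a.rvUs Finset.univ w, a.rvY₀ w, a.rvQ w)) :=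
    ent_congr fun w w' _ _ => by simp only [Prod.mk.injEq]; tauto
  have e3 : ent (a.joint (source p₀ κ)) (fun w => (a.rvX w, a.rvUs Finset.univ w, a.rvY₀ w)) =
      ent (a.joint (source p₀ κ)) (fun w => (a.rvUs Finset.univ w, a.rvX w, a.rvY₀ w)) :=
    ent_congr fun w w' _ _ => by simp only [Prod.mk.injEq]; tauto
  rw [e1, e2, e3] at h2
  linarith

/-- If U reveals Q, nothing is lost in I(U;X|Y₀) ≤ I(U,Q;X|Y₀). -/
lemma Auxiliary.relevance_eq_of_determines (hs : IsSource p₀ κ) (a : Auxiliary 𝒴)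
    (hdet : ∀ w w' : a.Space 𝒳 𝒴₀, a.joint (source p₀ κ) w ≠ 0 → a.joint (source p₀ κ) w' ≠ 0 →
      a.rvUs Finset.univ w' = a.rvUs Finset.univ w → a.rvQ w' = a.rvQ w) :
    condMutualInfo (a.joint (source p₀ κ)) (a.rvUs Finset.univ) a.rvX a.rvY₀ =
      condMutualInfo (a.joint (source p₀ κ)) (a.rvUs Finset.univ) a.rvX
        (fun w => (a.rvY₀ w, a.rvQ w)) := by
  have hp := a.joint_nonneg hs
  rw [condMutualInfo_eq_ent hp, condMutualInfo_eq_ent hp]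
  have h1 := a.ent_timeSharing hs
  have e1 : ent (a.joint (source p₀ κ)) (fun w => (a.rvUs Finset.univ w, a.rvX w, a.rvY₀ w)) =
      ent (a.joint (source p₀ κ)) (fun w => (a.rvUs Finset.univ w, a.rvX w, a.rvY₀ w,
        a.rvQ w)) :=
    ent_congr fun w w' hw hw' => by
      have := hdet w w' hw hw'
      simp only [Prod.mk.injEq]; tauto
  have e2 : ent (a.joint (source p₀ κ)) (fun w => (a.rvUs Finset.univ w, a.rvY₀ w)) =
      ent (a.joint (source p₀ κ)) (fun w => (a.rvUs Finset.univ w, a.rvY₀ w, a.rvQ w)) :=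
    ent_congr fun w w' hw hw' => by
      have := hdet w w' hw hw'
      simp only [Prod.mk.injEq]; tauto
  rw [e1, e2]
  linarith

/-- The auxiliary in which every `U_k` also reveals `Q`. -/
def Auxiliary.revealing (a : Auxiliary 𝒴) : Auxiliary 𝒴 where
  cardU k := a.cardU k * a.cardQ
  cardQ := a.cardQ
  pQ := a.pQ
  pU k y q u := a.pU k y q (finProdFinEquiv.symm u).1 * ind ((finProdFinEquiv.symm u).2 = q)
  pQ_mem := a.pQ_mem
  pU_mem k y q := by
    refine ⟨fun u => mul_nonneg ((a.pU_mem k y q).1 _) (ind_nonneg _), ?_⟩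
    rw [← finProdFinEquiv.sum_comp, Fintype.sum_prod_type, ← (a.pU_mem k y q).2]
    refine Finset.sum_congr rfl fun u _ => ?_
    simp only [Equiv.symm_apply_apply]
    rw [sum_mul_ind q (fun _ => a.pU k y q u)]

/-- For fixed q the added label is constant, so the enlarged channel is the old one embedded by u ↦
(u, q). -/
lemma Auxiliary.tradeoff_revealing (a : Auxiliary 𝒴) (P : Letter 𝒳 𝒴₀ 𝒴 → ℝ) (q : Fin a.cardQ) :
    tradeoff P (a.revealing.channel q) = tradeoff P (a.channel q) := by
  have := tradeoff_comp_injective P (a.revealing.channel q)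
    (fun k (u : Fin (a.cardU k)) => (finProdFinEquiv (u, q) : Fin (a.cardU k * a.cardQ)))
    (fun k u u' h => (Prod.mk.inj (finProdFinEquiv.injective h)).1) (fun k y u' hu => ?_)
  · rw [← this]
    congr 1
    funext k y u
    simp only [Auxiliary.channel, Auxiliary.revealing, Equiv.symm_apply_apply]
    rw [ind_true trivial, mul_one]
  · simp only [Auxiliary.channel, Auxiliary.revealing]
    rw [ind_false, mul_zero]
    intro h
    apply hu
    have h' : ((finProdFinEquiv.symm u').1, q) = finProdFinEquiv.symm u' := Prod.ext rfl h.symm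
    exact ⟨(finProdFinEquiv.symm u').1,
      (congrArg finProdFinEquiv h').trans (Equiv.apply_symm_apply _ _)⟩

lemma Auxiliary.mixture_revealing (a : Auxiliary 𝒴) (P : Letter 𝒳 𝒴₀ 𝒴 → ℝ)
    (S : Finset (Fin K)) :
    ∑ q, a.revealing.pQ q * tradeoff P (a.revealing.channel q) S =
      ∑ q, a.pQ q * tradeoff P (a.channel q) S :=
  Finset.sum_congr rfl fun q _ => congrArg (a.pQ q * ·) (congrFun (a.tradeoff_revealing P q) S)

lemma binningRate_mixture (hs : IsSource p₀ κ) (a : Auxiliary 𝒴) (S : Finset (Fin K)) :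
    ∑ q, a.pQ q * binningRate (source p₀ κ) (a.channel q) S =
      ∑ q, a.pQ q * tradeoff (source p₀ κ) (a.channel q) ∅ -
        ∑ q, a.pQ q * tradeoff (source p₀ κ) (a.channel q) S := by
  rw [← Finset.sum_sub_distrib]
  refine Finset.sum_congr rfl fun q _ => ?_
  rw [binningRate_eq_sub hs (a.isChannel q)]; ring

lemma tradeoff_empty_eq {𝒰 : Fin K → Type*} [∀ k, Fintype (𝒰 k)] (P : Letter 𝒳 𝒴₀ 𝒴 → ℝ)
    (W : ∀ k, 𝒴 k → 𝒰 k → ℝ) : tradeoff P W ∅ = relevance P W Finset.univ := by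
  rw [tradeoff, Finset.sum_empty, sub_zero, Finset.compl_empty]

/-- From left to right the auxiliary variables are replaced: the separation argument supplies
another point of the hull, and its realization is then made to reveal Q. From right to left they
stay the same, and the two kinds of constraints are added. -/
lemma singleLetterRegion_eq_quantizeBinTestRegion (hs : IsSource p₀ κ) :
    singleLetterRegion (source p₀ κ) = quantizeBinTestRegion (source p₀ κ) := by
  apply Set.Subset.antisymm
  · rintro ⟨R, E⟩ h
    obtain ⟨hR, hE, v, hv, hvS⟩ := (mem_singleLetterRegion_iff hs).1 h
    obtain ⟨v', hv', hb, he⟩ := mem_binningSet_of_tradeoff hs hR hv hvS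
    obtain ⟨a, ha⟩ := exists_auxiliary_of_mem_convexHull hv'
    refine ⟨hR, hE, a.revealing, fun S => ?_, ?_⟩
    · rw [ge_iff_le, Auxiliary.binningRate_eq, binningRate_mixture hs]
      rw [a.mixture_revealing, a.mixture_revealing]
      have := hb S
      rw [ha, ha] at this
      exact this
    · have hdet : ∀ w w' : a.revealing.Space 𝒳 𝒴₀, a.revealing.joint (source p₀ κ) w ≠ 0 →
          a.revealing.joint (source p₀ κ) w' ≠ 0 → 0 < K →
          a.revealing.rvUs Finset.univ w' = a.revealing.rvUs Finset.univ w →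
          a.revealing.rvQ w' = a.revealing.rvQ w := by
        intro w w' hw hw' hK huu
        have key : ∀ w : a.revealing.Space 𝒳 𝒴₀, a.revealing.joint (source p₀ κ) w ≠ 0 →
            (finProdFinEquiv.symm (w.2.1 ⟨0, hK⟩)).2 = w.2.2 := by
          intro w hw
          by_contra hne
          apply hw
          rw [Auxiliary.joint, Finset.prod_eq_zero (Finset.mem_univ ⟨0, hK⟩), mul_zero]
          simp only [Auxiliary.revealing]
          rw [ind_false hne, mul_zero]
        have h1 := congrFun huu ⟨⟨0, hK⟩, Finset.mem_univ _⟩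
        simp only [Auxiliary.rvUs, Auxiliary.rvU] at h1
        simp only [Auxiliary.rvQ]
        rw [← key w hw, ← key w' hw', h1]
      have hrel : ∑ q, a.pQ q * tradeoff (source p₀ κ) (a.channel q) ∅ =
          condMutualInfo (a.revealing.joint (source p₀ κ)) (a.revealing.rvUs Finset.univ)
            a.revealing.rvX (fun w => (a.revealing.rvY₀ w, a.revealing.rvQ w)) := by
        rw [a.revealing.relevance_eq]
        refine Finset.sum_congr rfl fun q _ => ?_
        rw [← a.tradeoff_revealing, tradeoff_empty_eq]
        rfl
      refine (he.trans_eq ((ha ∅).trans hrel)).trans_eq ?_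
      -- Without encoders no output can reveal Q, but then both mutual informations are zero.
      rcases Nat.eq_zero_or_pos K with hK | hK
      · subst hK
        have hp := a.revealing.joint_nonneg hs
        rw [condMutualInfo_eq_ent hp, condMutualInfo_eq_ent hp]
        have hU : ∀ w w' : a.revealing.Space 𝒳 𝒴₀,
            a.revealing.rvUs Finset.univ w = a.revealing.rvUs Finset.univ w' := by
          intro w w'; funext ⟨k, _⟩; exact k.elim0
        have e1 := ent_congr (p := a.revealing.joint (source p₀ κ))
          (A := fun w => (a.revealing.rvUs Finset.univ w, a.revealing.rvY₀ w, a.revealing.rvQ w))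
          (B := fun w => (a.revealing.rvY₀ w, a.revealing.rvQ w))
          (fun w w' _ _ => by simp [hU w' w])
        have e2 := ent_congr (p := a.revealing.joint (source p₀ κ))
          (A := fun w => (a.revealing.rvUs Finset.univ w, a.revealing.rvX w,
            a.revealing.rvY₀ w, a.revealing.rvQ w))
          (B := fun w => (a.revealing.rvX w, a.revealing.rvY₀ w, a.revealing.rvQ w))
          (fun w w' _ _ => by simp [hU w' w])
        have e3 := ent_congr (p := a.revealing.joint (source p₀ κ))
          (A := fun w => (a.revealing.rvUs Finset.univ w, a.revealing.rvY₀ w))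
          (B := a.revealing.rvY₀) (fun w w' _ _ => by simp [hU w' w])
        have e4 := ent_congr (p := a.revealing.joint (source p₀ κ))
          (A := fun w => (a.revealing.rvUs Finset.univ w, a.revealing.rvX w,
            a.revealing.rvY₀ w))
          (B := fun w => (a.revealing.rvX w, a.revealing.rvY₀ w))
          (fun w w' _ _ => by simp [hU w' w])
        rw [e1, e2, e3, e4]
        ring
      · exact (a.revealing.relevance_eq_of_determines hs fun w w' hw hw' =>
          hdet w w' hw hw' hK).symm
  · rintro ⟨R, E⟩ ⟨hR, hE, a, hb, he⟩
    refine (mem_singleLetterRegion_iff hs).2 ⟨hR, hE, _, a.mixture_mem hs, fun S => ?_⟩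
    have h1 := hb S
    rw [ge_iff_le, a.binningRate_eq, binningRate_mixture hs] at h1
    have h2 := he.trans (a.relevance_le hs)
    rw [a.relevance_eq] at h2
    simp_rw [← tradeoff_empty_eq] at h2
    simp only at h1 h2 ⊢
    linarith

end Regions

end

end DistHT

namespace DistHT

noncomputable section

set_option linter.unusedSectionVars false

/-! ### Channels acting on a pair of independent sources. -/

section Tensorization

variable {K : ℕ} {𝒳 𝒴₀ 𝒳' 𝒴₀' : Type*} {𝒴 𝒴' 𝒰 : Fin K → Type*}
variable [Fintype 𝒳] [Fintype 𝒴₀] [∀ k, Fintype (𝒴 k)] [∀ k, Fintype (𝒰 k)]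
variable [Fintype 𝒳'] [Fintype 𝒴₀'] [∀ k, Fintype (𝒴' k)]

/-- The marginal of `((X, X'), (Y₀, Y₀'))` for two independent sources. -/
def tensorBase (p₀ : 𝒳 × 𝒴₀ → ℝ) (p₀' : 𝒳' × 𝒴₀' → ℝ) : (𝒳 × 𝒳') × (𝒴₀ × 𝒴₀') → ℝ :=
  fun z => p₀ (z.1.1, z.2.1) * p₀' (z.1.2, z.2.2)

/-- The observation kernels of two independent sources. -/
def tensorKernel (κ : ∀ k, 𝒳 × 𝒴₀ → 𝒴 k → ℝ) (κ' : ∀ k, 𝒳' × 𝒴₀' → 𝒴' k → ℝ) (k : Fin K)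
    (z : (𝒳 × 𝒳') × (𝒴₀ × 𝒴₀')) (y : 𝒴 k × 𝒴' k) : ℝ :=
  κ k (z.1.1, z.2.1) y.1 * κ' k (z.1.2, z.2.2) y.2

lemma sum_tensorBase (p₀ : 𝒳 × 𝒴₀ → ℝ) (p₀' : 𝒳' × 𝒴₀' → ℝ) (y₀ : 𝒴₀) (y₀' : 𝒴₀') :
    ∑ x, tensorBase p₀ p₀' (x, (y₀, y₀')) = (∑ x, p₀ (x, y₀)) * ∑ x', p₀' (x', y₀') := by
  rw [Fintype.sum_prod_type, Finset.sum_mul_sum]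
  rfl

lemma mul_mem_stdSimplex {α β : Type*} [Fintype α] [Fintype β] {f : α → ℝ} {g : β → ℝ}
    (hf : f ∈ stdSimplex ℝ α) (hg : g ∈ stdSimplex ℝ β) :
    (fun ab : α × β => f ab.1 * g ab.2) ∈ stdSimplex ℝ (α × β) := by
  refine ⟨fun ab => mul_nonneg (hf.1 _) (hg.1 _), ?_⟩
  rw [Fintype.sum_prod_type, ← Finset.sum_mul_sum, hf.2, hg.2, mul_one]

variable {p₀ : 𝒳 × 𝒴₀ → ℝ} {κ : ∀ k, 𝒳 × 𝒴₀ → 𝒴 k → ℝ}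
variable {p₀' : 𝒳' × 𝒴₀' → ℝ} {κ' : ∀ k, 𝒳' × 𝒴₀' → 𝒴' k → ℝ}
variable {W : ∀ k, 𝒴 k × 𝒴' k → 𝒰 k → ℝ}

lemma IsSource.tensor (hs : IsSource p₀ κ) (hs' : IsSource p₀' κ') :
    IsSource (tensorBase p₀ p₀') (tensorKernel κ κ') where
  base_mem := by
    refine ⟨fun z => mul_nonneg (hs.base_mem.1 _) (hs'.base_mem.1 _), ?_⟩
    rw [Fintype.sum_prod_type, Finset.sum_comm, Fintype.sum_prod_type]
    simp_rw [sum_tensorBase]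
    rw [← Finset.sum_mul_sum, Finset.sum_comm, ← Fintype.sum_prod_type', hs.base_mem.2, one_mul,
      Finset.sum_comm, ← Fintype.sum_prod_type', hs'.base_mem.2]
  kernel_mem k z := mul_mem_stdSimplex (hs.kernel_mem k _) (hs'.kernel_mem k _)

/-- The channel seen by the first source when the pair `(X', Y₀')` of the second is given. -/
def firstChannel (κ' : ∀ k, 𝒳' × 𝒴₀' → 𝒴' k → ℝ) (W : ∀ k, 𝒴 k × 𝒴' k → 𝒰 k → ℝ)
    (z' : 𝒳' × 𝒴₀') (k : Fin K) (y : 𝒴 k) (u : 𝒰 k) : ℝ := ∑ y', κ' k z' y' * W k (y, y') u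

/-- The channel seen by the second source when the pair `(X, Y₀)` of the first is given and the
output also reveals the first observation. -/
def secondChannel (κ : ∀ k, 𝒳 × 𝒴₀ → 𝒴 k → ℝ) (W : ∀ k, 𝒴 k × 𝒴' k → 𝒰 k → ℝ)
    (z : 𝒳 × 𝒴₀) (k : Fin K) (y' : 𝒴' k) (u : 𝒰 k × 𝒴 k) : ℝ := κ k z u.2 * W k (u.2, y') u.1

lemma isChannel_firstChannel (hs' : IsSource p₀' κ') (hW : IsChannel W) (z' : 𝒳' × 𝒴₀') :
    IsChannel (firstChannel κ' W z') := by
  intro k y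
  refine ⟨fun u => Finset.sum_nonneg fun y' _ =>
    mul_nonneg ((hs'.kernel_mem k z').1 _) ((hW k _).1 u), ?_⟩
  simp only [firstChannel]
  rw [Finset.sum_comm]
  simp_rw [← Finset.mul_sum, (hW k _).2, mul_one, (hs'.kernel_mem k z').2]

lemma isChannel_secondChannel (hs : IsSource p₀ κ) (hW : IsChannel W) (z : 𝒳 × 𝒴₀) :
    IsChannel (secondChannel κ W z) := by
  intro k y'
  refine ⟨fun u => mul_nonneg ((hs.kernel_mem k z).1 _) ((hW k _).1 _), ?_⟩
  simp only [secondChannel]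
  rw [Fintype.sum_prod_type, Finset.sum_comm]
  simp_rw [← Finset.mul_sum, (hW k _).2, mul_one, (hs.kernel_mem k z).2]

/-- Here (X',Y₀') acts as a time-sharing variable for the first source: it is independent of that
source, and given its value the observations Y'_k are independent local randomness of the encoders.
-/
lemma pmfOf_tensor_first (ω : Letter 𝒳 𝒴₀ 𝒴 × (∀ k, 𝒰 k)) (z' : 𝒳' × 𝒴₀') :
    pmfOf (channelJoint (source (tensorBase p₀ p₀') (tensorKernel κ κ')) W)
      (fun w => ((((w.1.1.1, w.1.2.1.1, fun k => (w.1.2.2 k).1), w.2) :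
        Letter 𝒳 𝒴₀ 𝒴 × (∀ k, 𝒰 k)), (w.1.1.2, w.1.2.1.2))) (ω, z') =
      p₀' z' * channelJoint (source p₀ κ) (firstChannel κ' W z') ω := by
  have h := sum_channelJoint_mul (tensorBase p₀ p₀') (tensorKernel κ κ') W
    (fun z => ind (z = ((ω.1.1, z'.1), (ω.1.2.1, z'.2))))
    (fun k y u => ind (y.1 = ω.1.2.2 k ∧ u = ω.2 k))
  rw [pmfOf_eq]
  refine Eq.trans (Finset.sum_congr rfl fun w _ => ?_) (h.trans ?_)
  · rw [← ind_forall, ← ind_and]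
    congr 1
    apply ind_congr
    obtain ⟨⟨x, y₀, y⟩, u⟩ := ω
    obtain ⟨x', y₀'⟩ := z'
    simp only [Prod.ext_iff, funext_iff, forall_and]
    tauto
  · simp_rw [mul_right_comm _ (ind (_ = (((ω.1.1, z'.1), (ω.1.2.1, z'.2)) :
      (𝒳 × 𝒳') × (𝒴₀ × 𝒴₀'))))]
    rw [sum_mul_ind]
    have hloc : ∀ k, ∑ y, ∑ u, tensorKernel κ κ' k ((ω.1.1, z'.1), (ω.1.2.1, z'.2)) y *
        W k y u * ind (y.1 = ω.1.2.2 k ∧ u = ω.2 k) =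
        κ k (ω.1.1, ω.1.2.1) (ω.1.2.2 k) * firstChannel κ' W z' k (ω.1.2.2 k) (ω.2 k) := by
      intro k
      simp_rw [ind_and, ← mul_assoc, sum_mul_ind, Fintype.sum_prod_type]
      rw [Finset.sum_comm]
      simp_rw [sum_mul_ind, firstChannel, Finset.mul_sum, tensorKernel]
      exact Finset.sum_congr rfl fun y' _ => by ring
    simp_rw [hloc, Finset.prod_mul_distrib, channelJoint, source, tensorBase]
    ring

/-- The roles are exchanged, with the pair (U_k, Y_k) as output; adjoining Y_k is what makes the
chain rule for the excess rates exact. -/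
lemma pmfOf_tensor_second (ω : Letter 𝒳' 𝒴₀' 𝒴' × (∀ k, 𝒰 k × 𝒴 k)) (z : 𝒳 × 𝒴₀) :
    pmfOf (channelJoint (source (tensorBase p₀ p₀') (tensorKernel κ κ')) W)
      (fun w => ((((w.1.1.2, w.1.2.1.2, fun k => (w.1.2.2 k).2), fun k => (w.2 k, (w.1.2.2 k).1)) :
        Letter 𝒳' 𝒴₀' 𝒴' × (∀ k, 𝒰 k × 𝒴 k)), (w.1.1.1, w.1.2.1.1))) (ω, z) =
      p₀ z * channelJoint (source p₀' κ') (secondChannel κ W z) ω := by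
  have h := sum_channelJoint_mul (tensorBase p₀ p₀') (tensorKernel κ κ') W
    (fun z'' => ind (z'' = ((z.1, ω.1.1), (z.2, ω.1.2.1))))
    (fun k y u => ind (y = ((ω.2 k).2, ω.1.2.2 k) ∧ u = (ω.2 k).1))
  rw [pmfOf_eq]
  refine Eq.trans (Finset.sum_congr rfl fun w _ => ?_) (h.trans ?_)
  · rw [← ind_forall, ← ind_and]
    congr 1
    apply ind_congr
    obtain ⟨⟨x, y₀, y⟩, u⟩ := ω
    obtain ⟨x', y₀'⟩ := z
    simp only [Prod.ext_iff, funext_iff, forall_and]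
    tauto
  · simp_rw [mul_right_comm _ (ind (_ = (((z.1, ω.1.1), (z.2, ω.1.2.1)) :
      (𝒳 × 𝒳') × (𝒴₀ × 𝒴₀'))))]
    rw [sum_mul_ind]
    have hloc : ∀ k, ∑ y, ∑ u, tensorKernel κ κ' k ((z.1, ω.1.1), (z.2, ω.1.2.1)) y *
        W k y u * ind (y = ((ω.2 k).2, ω.1.2.2 k) ∧ u = (ω.2 k).1) =
        κ' k (ω.1.1, ω.1.2.1) (ω.1.2.2 k) * secondChannel κ W z k (ω.1.2.2 k) (ω.2 k) := by
      intro k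
      simp_rw [ind_and, ← mul_assoc, sum_mul_ind]
      simp only [tensorKernel, secondChannel]
      ring
    simp_rw [hloc, Finset.prod_mul_distrib, channelJoint, source, tensorBase]
    ring

end Tensorization

end

end DistHT

namespace DistHT

noncomputable section

set_option linter.unusedSectionVars false

/-! ### Single-letterization: the tensor inequality. -/

section TensorInequality

variable {K : ℕ} {𝒳 𝒴₀ 𝒳' 𝒴₀' : Type*} {𝒴 𝒴' 𝒰 : Fin K → Type*}
variable [Fintype 𝒳] [Fintype 𝒴₀] [∀ k, Fintype (𝒴 k)] [∀ k, Fintype (𝒰 k)]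
variable [Fintype 𝒳'] [Fintype 𝒴₀'] [∀ k, Fintype (𝒴' k)]
variable {p₀ : 𝒳 × 𝒴₀ → ℝ} {κ : ∀ k, 𝒳 × 𝒴₀ → 𝒴 k → ℝ}
variable {p₀' : 𝒳' × 𝒴₀' → ℝ} {κ' : ∀ k, 𝒳' × 𝒴₀' → 𝒴' k → ℝ}
variable {W : ∀ k, 𝒴 k × 𝒴' k → 𝒰 k → ℝ}

/-- Write Z = (X,Y₀) and Z' = (X',Y₀'). The chain rule gives I(Y,Y';U|Z,Z') = I(Y;U|Z,Z') +
I(Y';U|Y,Z,Z'), and the last term equals I(Y';U,Y|Z,Z') since Y and Y' are independent given (Z,Z').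
-/
lemma excessRate_tensor (hs : IsSource p₀ κ) (hs' : IsSource p₀' κ') (hW : IsChannel W)
    (k : Fin K) :
    excessRate (source (tensorBase p₀ p₀') (tensorKernel κ κ')) W k =
      ∑ z', p₀' z' * excessRate (source p₀ κ) (firstChannel κ' W z') k +
      ∑ z, p₀ z * excessRate (source p₀' κ') (secondChannel κ W z) k := by
  have hp := channelJoint_nonneg (hs.tensor hs') hW
  unfold excessRate
  rw [← condMutualInfo_mixture _ _ _ p₀' (fun z' => channelJoint (source p₀ κ)
      (firstChannel κ' W z')) pmfOf_tensor_first (fun w => w.1.2.2 k) (fun w => w.2 k)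
      (fun w => (w.1.1, w.1.2.1)),
    ← condMutualInfo_mixture _ _ _ p₀ (fun z => channelJoint (source p₀' κ')
      (secondChannel κ W z)) pmfOf_tensor_second (fun w => w.1.2.2 k) (fun w => w.2 k)
      (fun w => (w.1.1, w.1.2.1))]
  simp_rw [condMutualInfo_eq_ent hp]
  set p := channelJoint (source (tensorBase p₀ p₀') (tensorKernel κ κ')) W with hpdef
  -- Conditional independence of the two observations of encoder k given (Z,Z').
  have hind : ent p (fun w => (w.1.2.2 k, w.1.1, w.1.2.1)) + ent p (fun w => (w.1.1, w.1.2.1)) =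
      ent p (fun w => ((w.1.2.2 k).1, (w.1.1.1, w.1.2.1.1), (w.1.1.2, w.1.2.1.2))) +
      ent p (fun w => ((w.1.2.2 k).2, (w.1.1.2, w.1.2.1.2), (w.1.1.1, w.1.2.1.1))) := by
    refine ent_add_eq_of_mass hp fun w _ => ?_
    rw [hpdef, mass_obs_pair (hs.tensor hs') hW, mass_pair (hs.tensor hs') hW, ← hpdef]
    have h1 : mass p (fun w => ((w.1.2.2 k).1, (w.1.1.1, w.1.2.1.1), (w.1.1.2, w.1.2.1.2))) w =
        p₀' (w.1.1.2, w.1.2.1.2) * (p₀ (w.1.1.1, w.1.2.1.1) *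
          κ k (w.1.1.1, w.1.2.1.1) (w.1.2.2 k).1) := by
      rw [← mass_obs_pair hs (isChannel_firstChannel hs' hW (w.1.1.2, w.1.2.1.2))
        ((w.1.1.1, w.1.2.1.1, fun k => (w.1.2.2 k).1), w.2) k]
      exact pmfOf_mixture_pair pmfOf_tensor_first (fun w => w.1.2.2 k)
        (fun w => (w.1.1, w.1.2.1)) _ _ _
    have h2 : mass p (fun w => ((w.1.2.2 k).2, (w.1.1.2, w.1.2.1.2), (w.1.1.1, w.1.2.1.1))) w =
        p₀ (w.1.1.1, w.1.2.1.1) * (p₀' (w.1.1.2, w.1.2.1.2) *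
          κ' k (w.1.1.2, w.1.2.1.2) (w.1.2.2 k).2) := by
      rw [← mass_obs_pair hs' (isChannel_secondChannel hs hW (w.1.1.1, w.1.2.1.1))
        ((w.1.1.2, w.1.2.1.2, fun k => (w.1.2.2 k).2), fun k => (w.2 k, (w.1.2.2 k).1)) k]
      exact pmfOf_mixture_pair pmfOf_tensor_second (fun w => w.1.2.2 k)
        (fun w => (w.1.1, w.1.2.1)) _ _ _
    rw [h1, h2]
    simp only [tensorBase, tensorKernel]
    ring
  have e1 : ent p (fun w => (w.2 k, (w.1.1.1, w.1.2.1.1), (w.1.1.2, w.1.2.1.2))) =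
      ent p (fun w => (w.2 k, w.1.1, w.1.2.1)) :=
    ent_congr fun w w' _ _ => by simp only [Prod.ext_iff]; tauto
  have e2 : ent p (fun w => ((w.1.2.2 k).1, w.2 k, (w.1.1.1, w.1.2.1.1), (w.1.1.2, w.1.2.1.2))) =
      ent p (fun w => ((w.2 k, (w.1.2.2 k).1), (w.1.1.2, w.1.2.1.2), (w.1.1.1, w.1.2.1.1))) :=
    ent_congr fun w w' _ _ => by simp only [Prod.ext_iff]; tauto
  have e3 : ent p (fun w => ((w.1.2.2 k).2, (w.2 k, (w.1.2.2 k).1), (w.1.1.2, w.1.2.1.2),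
      (w.1.1.1, w.1.2.1.1))) = ent p (fun w => (w.1.2.2 k, w.2 k, w.1.1, w.1.2.1)) :=
    ent_congr fun w w' _ _ => by simp only [Prod.ext_iff]; tauto
  have e4 : ent p (fun w => ((w.1.1.1, w.1.2.1.1), (w.1.1.2, w.1.2.1.2))) =
      ent p (fun w => (w.1.1, w.1.2.1)) :=
    ent_congr fun w w' _ _ => by simp only [Prod.ext_iff]; tauto
  have e5 : ent p (fun w => ((w.1.1.2, w.1.2.1.2), (w.1.1.1, w.1.2.1.1))) =
      ent p (fun w => (w.1.1, w.1.2.1)) :=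
    ent_congr fun w w' _ _ => by simp only [Prod.ext_iff]; tauto
  rw [e1, e2, e3, e4, e5]
  linarith

/-- The chain rule gives I(U_T;X,X'|Y₀,Y₀') = I(U_T;X|X',Y₀,Y₀') + I(U_T;X'|Y₀,Y₀'). The last term
is at most I(U_T,Y_T,X;X'|Y₀,Y₀'), which equals I(U_T,Y_T;X'|X,Y₀,Y₀') by independence of the
sources. -/
lemma relevance_tensor_le (hs : IsSource p₀ κ) (hs' : IsSource p₀' κ') (hW : IsChannel W)
    (T : Finset (Fin K)) :
    relevance (source (tensorBase p₀ p₀') (tensorKernel κ κ')) W T ≤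
      ∑ z', p₀' z' * relevance (source p₀ κ) (firstChannel κ' W z') T +
      ∑ z, p₀ z * relevance (source p₀' κ') (secondChannel κ W z) T := by
  have hp := channelJoint_nonneg (hs.tensor hs') hW
  unfold relevance
  rw [← condMutualInfo_mixture _ _ _ p₀' (fun z' => channelJoint (source p₀ κ)
      (firstChannel κ' W z')) pmfOf_tensor_first (fun w (k : T) => w.2 k) (fun w => w.1.1)
      (fun w => w.1.2.1),
    ← condMutualInfo_mixture _ _ _ p₀ (fun z => channelJoint (source p₀' κ')
      (secondChannel κ W z)) pmfOf_tensor_second (fun w (k : T) => w.2 k) (fun w => w.1.1)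
      (fun w => w.1.2.1)]
  simp_rw [condMutualInfo_eq_ent hp]
  set p := channelJoint (source (tensorBase p₀ p₀') (tensorKernel κ κ')) W with hpdef
  have hind : ent p (fun w => (w.1.2.1.1, (w.1.1.2, w.1.2.1.2))) +
      ent p (fun w => (w.1.2.1.2, (w.1.1.1, w.1.2.1.1))) =
      ent p (fun w => (w.1.1, w.1.2.1)) + ent p (fun w => w.1.2.1) := by
    refine ent_add_eq_of_mass hp fun w _ => ?_
    rw [hpdef, mass_pair (hs.tensor hs') hW, mass_side (hs.tensor hs') hW, ← hpdef]
    have h1 : mass p (fun w => (w.1.2.1.1, (w.1.1.2, w.1.2.1.2))) w =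
        p₀' (w.1.1.2, w.1.2.1.2) * ∑ x, p₀ (x, w.1.2.1.1) := by
      have := mass_side hs (isChannel_firstChannel hs' hW (w.1.1.2, w.1.2.1.2))
        ((w.1.1.1, w.1.2.1.1, fun k => (w.1.2.2 k).1), w.2)
      simp only [outputMarginal, Finset.prod_empty, mul_one] at this
      rw [← this]
      exact pmfOf_mixture pmfOf_tensor_first (fun w => w.1.2.1) _ _
    have h2 : mass p (fun w => (w.1.2.1.2, (w.1.1.1, w.1.2.1.1))) w =
        p₀ (w.1.1.1, w.1.2.1.1) * ∑ x, p₀' (x, w.1.2.1.2) := by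
      have := mass_side hs' (isChannel_secondChannel hs hW (w.1.1.1, w.1.2.1.1))
        ((w.1.1.2, w.1.2.1.2, fun k => (w.1.2.2 k).2), fun k => (w.2 k, (w.1.2.2 k).1))
      simp only [outputMarginal, Finset.prod_empty, mul_one] at this
      rw [← this]
      exact pmfOf_mixture pmfOf_tensor_second (fun w => w.1.2.1) _ _
    rw [h1, h2]
    simp only [outputMarginal, Finset.prod_empty, mul_one]
    rw [show w.1.2.1 = (w.1.2.1.1, w.1.2.1.2) from rfl, sum_tensorBase]
    simp only [tensorBase]
    ring
  -- The only inequality of the argument: Y_T and X are adjoined to what is known about X'.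
  have hsub := ent_submodular hp (fun w => w.1.1.2)
    (fun w => (fun k : T => (w.1.2.2 k).1, w.1.1.1)) (fun w => (fun k : T => w.2 k, w.1.2.1))
  have e1 : ent p (fun w => (w.1.1.2, fun k : T => w.2 k, w.1.2.1)) =
      ent p (fun w => (fun k : T => w.2 k, w.1.2.1.1, (w.1.1.2, w.1.2.1.2))) :=
    ent_congr fun w w' _ _ => by simp only [Prod.ext_iff]; tauto
  have e2 : ent p (fun w => (w.1.1.2, (fun k : T => (w.1.2.2 k).1, w.1.1.1),
      fun k : T => w.2 k, w.1.2.1)) =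
      ent p (fun w => (fun k : T => (w.2 k, (w.1.2.2 k).1), w.1.1.2, w.1.2.1.2,
        (w.1.1.1, w.1.2.1.1))) :=
    ent_congr fun w w' _ _ => by simp only [Prod.ext_iff, funext_iff, forall_and]; tauto
  have e3 : ent p (fun w => ((fun k : T => (w.1.2.2 k).1, w.1.1.1),
      fun k : T => w.2 k, w.1.2.1)) =
      ent p (fun w => (fun k : T => (w.2 k, (w.1.2.2 k).1), w.1.2.1.2,
        (w.1.1.1, w.1.2.1.1))) :=
    ent_congr fun w w' _ _ => by simp only [Prod.ext_iff, funext_iff, forall_and]; tauto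
  have e4 : ent p (fun w => (fun k : T => w.2 k, w.1.1.1, w.1.2.1.1, (w.1.1.2, w.1.2.1.2))) =
      ent p (fun w => (fun k : T => w.2 k, w.1.1, w.1.2.1)) :=
    ent_congr fun w w' _ _ => by simp only [Prod.ext_iff]; tauto
  have e5 : ent p (fun w => (w.1.1.1, w.1.2.1.1, (w.1.1.2, w.1.2.1.2))) =
      ent p (fun w => (w.1.1, w.1.2.1)) :=
    ent_congr fun w w' _ _ => by simp only [Prod.ext_iff]; tauto
  have e6 : ent p (fun w => (w.1.1.2, w.1.2.1.2, (w.1.1.1, w.1.2.1.1))) =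
      ent p (fun w => (w.1.1, w.1.2.1)) :=
    ent_congr fun w w' _ _ => by simp only [Prod.ext_iff]; tauto
  rw [e1, e2, e3] at hsub
  rw [e4, e5, e6]
  linarith

/-- Single-letterization of a channel acting on two independent sources. -/
lemma tradeoff_tensor_le (hs : IsSource p₀ κ) (hs' : IsSource p₀' κ') (hW : IsChannel W)
    (S : Finset (Fin K)) :
    tradeoff (source (tensorBase p₀ p₀') (tensorKernel κ κ')) W S ≤
      ∑ z', p₀' z' * tradeoff (source p₀ κ) (firstChannel κ' W z') S +
      ∑ z, p₀ z * tradeoff (source p₀' κ') (secondChannel κ W z) S := by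
  have h := relevance_tensor_le hs hs' hW Sᶜ
  simp only [tradeoff, mul_sub, Finset.sum_sub_distrib, excessRate_tensor hs hs' hW,
    Finset.sum_add_distrib, Finset.mul_sum]
  rw [Finset.sum_comm (s := S), Finset.sum_comm (s := S)]
  linarith

end TensorInequality

/-! ### Blocks of a memoryless source. -/

section Block

variable {K : ℕ} {𝒳 𝒴₀ : Type*} {𝒴 : Fin K → Type*}

/-- The marginal of `(Xⁿ, Y₀ⁿ)` for a memoryless source. -/
def blockBase (p₀ : 𝒳 × 𝒴₀ → ℝ) (n : ℕ) (z : (Fin n → 𝒳) × (Fin n → 𝒴₀)) : ℝ :=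
  ∏ i, p₀ (z.1 i, z.2 i)

/-- The observation kernels of a memoryless source. -/
def blockKernel (κ : ∀ k, 𝒳 × 𝒴₀ → 𝒴 k → ℝ) (n : ℕ) (k : Fin K)
    (z : (Fin n → 𝒳) × (Fin n → 𝒴₀)) (y : Fin n → 𝒴 k) : ℝ :=
  ∏ i, κ k (z.1 i, z.2 i) (y i)

variable [Fintype 𝒳] [Fintype 𝒴₀] [∀ k, Fintype (𝒴 k)]
variable {p₀ : 𝒳 × 𝒴₀ → ℝ} {κ : ∀ k, 𝒳 × 𝒴₀ → 𝒴 k → ℝ}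

lemma prod_mem_stdSimplex {α : Type*} [Fintype α] {n : ℕ} {f : Fin n → α → ℝ}
    (hf : ∀ i, f i ∈ stdSimplex ℝ α) :
    (fun a : Fin n → α => ∏ i, f i (a i)) ∈ stdSimplex ℝ (Fin n → α) := by
  refine ⟨fun a => Finset.prod_nonneg fun i _ => (hf i).1 _, ?_⟩
  rw [sum_pi_prod (fun i a => f i a)]
  exact Finset.prod_eq_one fun i _ => (hf i).2

lemma sum_pi_pair {α β : Type*} [Fintype α] [Fintype β] {n : ℕ} (f : Fin n → α → β → ℝ) :
    ∑ z : (Fin n → α) × (Fin n → β), ∏ i, f i (z.1 i) (z.2 i) = ∏ i, ∑ a, ∑ b, f i a b := by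
  rw [Fintype.sum_prod_type]
  exact sum_pi_pi_prod f

lemma IsSource.block (hs : IsSource p₀ κ) (n : ℕ) :
    IsSource (blockBase p₀ n) (blockKernel κ n) where
  base_mem := by
    refine ⟨fun z => Finset.prod_nonneg fun i _ => hs.base_mem.1 _, ?_⟩
    refine (sum_pi_pair (fun _ x y₀ => p₀ (x, y₀))).trans (Finset.prod_eq_one fun i _ => ?_)
    rw [← Fintype.sum_prod_type', hs.base_mem.2]
  kernel_mem k z := prod_mem_stdSimplex fun i => hs.kernel_mem k (z.1 i, z.2 i)

lemma tradeoffSet_nonempty (P : Letter 𝒳 𝒴₀ 𝒴 → ℝ) : (tradeoffSet P).Nonempty := by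
  refine ⟨_, fun _ _ u => ind (u = ⟨0, Nat.succ_pos _⟩), fun k y => ⟨fun u => ind_nonneg _, ?_⟩,
    rfl⟩
  simpa using sum_mul_ind (⟨0, Nat.succ_pos _⟩ : Fin (alphabetBound 𝒴)) (fun _ => (1 : ℝ))

lemma source_block_cons (n : ℕ) (x : 𝒳 × (Fin n → 𝒳)) (y₀ : 𝒴₀ × (Fin n → 𝒴₀))
    (y : ∀ k, 𝒴 k × (Fin n → 𝒴 k)) :
    source (blockBase p₀ (n + 1)) (blockKernel κ (n + 1)) (Fin.consEquiv (fun _ => 𝒳) x,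
      Fin.consEquiv (fun _ => 𝒴₀) y₀, fun k => Fin.consEquiv (fun _ => 𝒴 k) (y k)) =
    source (tensorBase p₀ (blockBase p₀ n)) (tensorKernel κ (blockKernel κ n)) (x, y₀, y) := by
  simp [source, blockBase, blockKernel, tensorBase, tensorKernel, Fin.prod_univ_succ]

/-- Single-letterization of channels acting on blocks. -/
lemma exists_le_of_mem_tradeoffSet_block (hs : IsSource p₀ κ) (n : ℕ) :
    ∀ w ∈ tradeoffSet (source (blockBase p₀ n) (blockKernel κ n)),
      ∃ v ∈ convexHull ℝ (tradeoffSet (source p₀ κ)), ∀ S, w S ≤ n * v S := by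
  induction n with
  | zero =>
    rintro _ ⟨W, hW, rfl⟩
    obtain ⟨v, hv⟩ := tradeoffSet_nonempty (source p₀ κ)
    refine ⟨v, subset_convexHull ℝ _ hv, fun S => ?_⟩
    -- Sequences of length 0 form a one-point alphabet.
    have h1 : relevance (source (blockBase p₀ 0) (blockKernel κ 0)) W Sᶜ = 0 :=
      condMutualInfo_const_right (channelJoint_nonneg (hs.block 0) hW) _ _ _
        fun _ _ => Subsingleton.elim _ _
    have h2 : 0 ≤ ∑ k ∈ S, excessRate (source (blockBase p₀ 0) (blockKernel κ 0)) W k :=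
      Finset.sum_nonneg fun k _ => excessRate_nonneg (hs.block 0) hW k
    rw [tradeoff, h1]
    simpa using h2
  | succ n ih =>
    rintro _ ⟨W, hW, rfl⟩
    have hsn := hs.block n
    set W' : ∀ k, 𝒴 k × (Fin n → 𝒴 k) → Fin (alphabetBound fun k => Fin (n + 1) → 𝒴 k) → ℝ :=
      fun k y u => W k (Fin.consEquiv (fun _ => 𝒴 k) y) u with hW'def
    have hW' : IsChannel W' := fun k y => hW k _
    have hre : tradeoff (source (blockBase p₀ (n + 1)) (blockKernel κ (n + 1))) W =
        tradeoff (source (tensorBase p₀ (blockBase p₀ n)) (tensorKernel κ (blockKernel κ n))) W' :=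
      tradeoff_reindex _ _ _ _ (Fin.consEquiv fun _ => 𝒳) (Fin.consEquiv fun _ => 𝒴₀)
        (fun k => Fin.consEquiv fun _ => 𝒴 k) (source_block_cons n) fun _ _ _ => rfl
    have hconv := convex_convexHull ℝ (tradeoffSet (source p₀ κ))
    -- The second channel has a larger output alphabet, since it reveals a letter of Y_k. The
    -- cardinality bound brings it back into the scope of the induction hypothesis.
    choose v hv hle using fun z => ih _ (tradeoff_mem_tradeoffSet hsn
      (isChannel_secondChannel hs hW' z))
    have h1 := hconv.sum_mem (t := Finset.univ) (fun z _ => hsn.base_mem.1 z) hsn.base_mem.2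
      (fun z _ => subset_convexHull ℝ _ (tradeoff_mem_tradeoffSet hs
        (isChannel_firstChannel hsn hW' z)))
    have h2 := hconv.sum_mem (t := Finset.univ) (fun z _ => hs.base_mem.1 z) hs.base_mem.2
      (fun z _ => hv z)
    have hn : (0 : ℝ) < (n : ℝ) + 1 := by positivity
    -- The weights are those of a uniform time index on n + 1 letters: one letter against the
    -- remaining n.
    refine ⟨_, hconv h1 h2 (a := 1 / ((n : ℝ) + 1)) (b := n / ((n : ℝ) + 1)) (by positivity)
      (by positivity) (by field_simp; ring), fun S => ?_⟩
    rw [hre]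
    refine (tradeoff_tensor_le hs hsn hW' S).trans ?_
    have h3 : ∑ z, p₀ z * tradeoff (source (blockBase p₀ n) (blockKernel κ n))
        (secondChannel κ W' z) S ≤ n * ∑ z, p₀ z * v z S := by
      rw [Finset.mul_sum]
      refine Finset.sum_le_sum fun z _ => ?_
      have := mul_le_mul_of_nonneg_left (hle z S) (hs.base_mem.1 z)
      linarith
    simp only [Pi.add_apply, Pi.smul_apply, Finset.sum_apply, smul_eq_mul]
    push_cast
    have h4 : ∀ a b : ℝ, ((n : ℝ) + 1) * (1 / ((n : ℝ) + 1) * a + n / ((n : ℝ) + 1) * b) =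
        a + n * b := by intro a b; field_simp
    rw [h4]
    linarith

end Block

end

end DistHT

namespace DistHT

noncomputable section

set_option linter.unusedSectionVars false

/-! ### The alternate hypothesis and block probabilities. -/

section Hypotheses

variable {K : ℕ} {𝒳 𝒴₀ : Type*} {𝒴 𝒰 : Fin K → Type*}
variable [Fintype 𝒳] [Fintype 𝒴₀] [∀ k, Fintype (𝒴 k)] [∀ k, Fintype (𝒰 k)]

/-- The alternate hypothesis for a source given by its kernels. -/
def altSource (p₀ : 𝒳 × 𝒴₀ → ℝ) (κ : ∀ k, 𝒳 × 𝒴₀ → 𝒴 k → ℝ) : Letter 𝒳 𝒴₀ 𝒴 → ℝ := fun w =>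
  p₀ (w.1, w.2.1) * (∑ x, p₀ (x, w.2.1) * ∏ k, κ k (x, w.2.1) (w.2.2 k)) / ∑ x, p₀ (x, w.2.1)

variable {p₀ : 𝒳 × 𝒴₀ → ℝ} {κ : ∀ k, 𝒳 × 𝒴₀ → 𝒴 k → ℝ} {W : ∀ k, 𝒴 k → 𝒰 k → ℝ}

lemma sum_prod_kernel (hs : IsSource p₀ κ) (z : 𝒳 × 𝒴₀) :
    ∑ y : ∀ k, 𝒴 k, ∏ k, κ k z (y k) = 1 := by
  rw [sum_pi_prod]
  exact Finset.prod_eq_one fun k _ => (hs.kernel_mem k z).2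

lemma pmfOf_source_side (hs : IsSource p₀ κ) (y₀ : 𝒴₀) :
    pmfOf (source p₀ κ) (fun w => w.2.1) y₀ = ∑ x, p₀ (x, y₀) := by
  rw [pmfOf_eq, Fintype.sum_prod_type]
  refine Finset.sum_congr rfl fun x _ => ?_
  rw [Fintype.sum_prod_type]
  simp only [source, ← Finset.mul_sum, ← Finset.sum_mul, sum_prod_kernel hs, mul_one]
  exact sum_mul_ind y₀ (fun y₀ => p₀ (x, y₀))

lemma pmfOf_source_pair (hs : IsSource p₀ κ) (x : 𝒳) (y₀ : 𝒴₀) :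
    pmfOf (source p₀ κ) (fun w => (w.1, w.2.1)) (x, y₀) = p₀ (x, y₀) := by
  rw [pmfOf_eq, Fintype.sum_prod_type, ← sum_mul_ind x (fun x => p₀ (x, y₀))]
  refine Finset.sum_congr rfl fun x' _ => ?_
  rw [Fintype.sum_prod_type]
  simp only [source, ← Finset.mul_sum, ← Finset.sum_mul, sum_prod_kernel hs, mul_one]
  simp_rw [Prod.mk.injEq, ind_and, mul_comm (ind (x' = x)), ← mul_assoc, ← Finset.sum_mul]
  rw [sum_mul_ind y₀ (fun y₀ => p₀ (x', y₀))]

lemma pmfOf_source_obs_side (y : ∀ k, 𝒴 k) (y₀ : 𝒴₀) :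
    pmfOf (source p₀ κ) (fun w => (w.2.2, w.2.1)) (y, y₀) =
      ∑ x, p₀ (x, y₀) * ∏ k, κ k (x, y₀) (y k) := by
  rw [pmfOf_eq, Fintype.sum_prod_type]
  refine Finset.sum_congr rfl fun x _ => ?_
  rw [Fintype.sum_prod_type]
  simp_rw [Prod.mk.injEq, ind_and, ← mul_assoc, ← Finset.sum_mul]
  rw [sum_mul_ind y₀ (fun y₀' => ∑ y', source p₀ κ (x, y₀', y') * ind (y' = y)),
    sum_mul_ind y (fun y' => source p₀ κ (x, y₀, y'))]
  rfl

/-- One factor P(y₀) cancels; where P(y₀) = 0 both sides are zero by the convention for division. -/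
lemma altPmf_source (hs : IsSource p₀ κ) : altPmf (source p₀ κ) = altSource p₀ κ := by
  funext ⟨x, y₀, y⟩
  simp only [altPmf, condPmf, altSource, pmfOf_source_side hs, pmfOf_source_obs_side]
  rw [show pmfOf (source p₀ κ) (fun ω => (ω.1, ω.2.1)) (x, y₀) = p₀ (x, y₀) from
    pmfOf_source_pair hs x y₀]
  by_cases h : ∑ x, p₀ (x, y₀) = 0
  · simp [h]
  · field_simp

lemma sum_channelJoint_output (F : (∀ k, 𝒰 k) → 𝒳 × 𝒴₀ → ℝ) :
    ∑ ω, channelJoint (source p₀ κ) W ω * F ω.2 (ω.1.1, ω.1.2.1) =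
      ∑ z, ∑ u, p₀ z * (∏ k, outputKernel κ W k z (u k)) * F u z := by
  rw [Fintype.sum_prod_type, Fintype.sum_prod_type, Fintype.sum_prod_type]
  refine Finset.sum_congr rfl fun x _ => ?_
  rw [Fintype.sum_prod_type]
  refine Finset.sum_congr rfl fun y₀ _ => ?_
  rw [Finset.sum_comm]
  refine Finset.sum_congr rfl fun u _ => ?_
  simp only [channelJoint, source, outputKernel]
  rw [← sum_pi_prod, Finset.mul_sum, Finset.sum_mul]
  refine Finset.sum_congr rfl fun y _ => ?_
  rw [Finset.prod_mul_distrib]; ring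

/-- Under the alternative U_T depends on (X,Y₀) through Y₀ only: the joint law is P(x,y₀) P(u_T|y₀).
-/
lemma sum_altSource_channel (T : Finset (Fin K)) (hs : IsSource p₀ κ) (z : 𝒳 × 𝒴₀)
    (u : ∀ k, 𝒰 k) :
    ∑ y, altSource p₀ κ (z.1, z.2, y) * ∏ k ∈ T, W k (y k) (u k) =
      p₀ z * outputMarginal p₀ κ W T u z.2 / outputMarginal p₀ κ W ∅ u z.2 := by
  classical
  simp only [altSource, outputMarginal, Finset.prod_empty, mul_one]
  simp_rw [div_mul_eq_mul_div, ← Finset.sum_div]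
  congr 1
  simp_rw [mul_assoc, ← Finset.mul_sum]
  congr 1
  simp_rw [Finset.sum_mul]
  rw [Finset.sum_comm]
  refine Finset.sum_congr rfl fun x _ => ?_
  simp_rw [mul_assoc, ← Finset.mul_sum]
  congr 1
  have h1 : ∀ y : ∀ k, 𝒴 k, (∏ k, κ k (x, z.2) (y k)) * ∏ k ∈ T, W k (y k) (u k) =
      ∏ k, (κ k (x, z.2) (y k) * if k ∈ T then W k (y k) (u k) else 1) := by
    intro y
    rw [Finset.prod_mul_distrib]
    simp [Finset.prod_ite_mem]
  simp_rw [h1]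
  rw [sum_pi_prod (fun k y => κ k (x, z.2) y * if k ∈ T then W k y (u k) else 1)]
  rw [← Finset.prod_subset (Finset.subset_univ T)]
  · exact Finset.prod_congr rfl fun k hk => by simp [hk, outputKernel]
  · intro k _ hk; simp [hk, (hs.kernel_mem k _).2]

lemma altSource_nonneg (hs : IsSource p₀ κ) (w : Letter 𝒳 𝒴₀ 𝒴) : 0 ≤ altSource p₀ κ w :=
  div_nonneg (mul_nonneg (hs.base_mem.1 _) (Finset.sum_nonneg fun _ _ =>
    mul_nonneg (hs.base_mem.1 _) (Finset.prod_nonneg fun k _ => (hs.kernel_mem k _).1 _)))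
    (Finset.sum_nonneg fun _ _ => hs.base_mem.1 _)

end Hypotheses

section Blocks

variable {K : ℕ} {𝒳 𝒴₀ : Type*} {𝒴 : Fin K → Type*}

/-- A sequence of letters as a letter of sequences. -/
def blockEquiv (𝒳 𝒴₀ : Type*) (𝒴 : Fin K → Type*) (n : ℕ) :
    (Fin n → Letter 𝒳 𝒴₀ 𝒴) ≃ Letter (Fin n → 𝒳) (Fin n → 𝒴₀) (fun k => Fin n → 𝒴 k) where
  toFun w := (fun i => (w i).1, fun i => (w i).2.1, fun k i => (w i).2.2 k)
  invFun b := fun i => (b.1 i, b.2.1 i, fun k => b.2.2 k i)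
  left_inv _ := rfl
  right_inv _ := rfl

variable [Fintype 𝒳] [Fintype 𝒴₀] [∀ k, Fintype (𝒴 k)]
variable {p₀ : 𝒳 × 𝒴₀ → ℝ} {κ : ∀ k, 𝒳 × 𝒴₀ → 𝒴 k → ℝ}

lemma iidPmf_source (n : ℕ) (w : Fin n → Letter 𝒳 𝒴₀ 𝒴) :
    iidPmf (source p₀ κ) n w =
      source (blockBase p₀ n) (blockKernel κ n) (blockEquiv 𝒳 𝒴₀ 𝒴 n w) := by
  simp only [iidPmf, source, blockBase, blockKernel, blockEquiv, Equiv.coe_fn_mk,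
    Finset.prod_mul_distrib]
  rw [Finset.prod_comm]

lemma iidPmf_altSource (n : ℕ) (w : Fin n → Letter 𝒳 𝒴₀ 𝒴) :
    iidPmf (altSource p₀ κ) n w =
      altSource (blockBase p₀ n) (blockKernel κ n) (blockEquiv 𝒳 𝒴₀ 𝒴 n w) := by
  simp only [iidPmf, altSource, blockBase, blockKernel, blockEquiv, Equiv.coe_fn_mk,
    Finset.prod_mul_distrib, Finset.prod_div_distrib]
  congr 1
  · congr 1
    rw [← sum_pi_prod (fun i x => p₀ (x, (w i).2.1) * ∏ k, κ k (x, (w i).2.1) ((w i).2.2 k))]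
    refine Finset.sum_congr rfl fun x _ => ?_
    rw [Finset.prod_mul_distrib]
    congr 1
    rw [Finset.prod_comm]
  · rw [← sum_pi_prod (fun i x => p₀ (x, (w i).2.1))]

/-- Error probabilities in terms of the block source. -/
lemma prob_iidPmf_eq {n : ℕ} {M : Fin K → ℕ} (p : Letter 𝒳 𝒴₀ 𝒴 → ℝ)
    (q : Letter (Fin n → 𝒳) (Fin n → 𝒴₀) (fun k => Fin n → 𝒴 k) → ℝ)
    (h : ∀ w, iidPmf p n w = q (blockEquiv 𝒳 𝒴₀ 𝒴 n w)) (φ : ∀ k, (Fin n → 𝒴 k) → Fin (M k))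
    (A : Set ((∀ k, Fin (M k)) × (Fin n → 𝒳) × (Fin n → 𝒴₀))) :
    prob (iidPmf p n) {w | detectorInput φ w ∈ A} =
      ∑ b, q b * ind ((fun k => φ k (b.2.2 k), b.1, b.2.1) ∈ A) := by
  rw [prob_eq, ← (blockEquiv 𝒳 𝒴₀ 𝒴 n).sum_comp]
  refine Finset.sum_congr rfl fun w _ => ?_
  rw [h w]
  rfl

end Blocks

/-! ### Data processing for a code. -/

section DataProcessing

variable {K : ℕ} {𝒳 𝒴₀ : Type*} {𝒴 : Fin K → Type*}
variable [Fintype 𝒳] [Fintype 𝒴₀] [∀ k, Fintype (𝒴 k)]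
variable {p₀ : 𝒳 × 𝒴₀ → ℝ} {κ : ∀ k, 𝒳 × 𝒴₀ → 𝒴 k → ℝ}

/-- The deterministic channel of an encoder. -/
def encoderChannel {M : Fin K → ℕ} (φ : ∀ k, 𝒴 k → Fin (M k)) (k : Fin K) (y : 𝒴 k)
    (m : Fin (M k)) : ℝ := ind (φ k y = m)

lemma isChannel_encoderChannel {M : Fin K → ℕ} (φ : ∀ k, 𝒴 k → Fin (M k)) :
    IsChannel (encoderChannel φ) := fun k y =>
  ⟨fun m => ind_nonneg _, by simpa [encoderChannel] using sum_mul_ind' (φ k y) (fun _ => (1 : ℝ))⟩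

lemma sum_encoderChannel {M : Fin K → ℕ} (φ : ∀ k, 𝒴 k → Fin (M k)) (y : ∀ k, 𝒴 k)
    (F : (∀ k, Fin (M k)) → ℝ) :
    ∑ u, (∏ k, encoderChannel φ k (y k) (u k)) * F u = F fun k => φ k (y k) := by
  simp only [encoderChannel, ← ind_forall]
  rw [← sum_mul_ind' (fun k => φ k (y k)) F]
  refine Finset.sum_congr rfl fun u _ => ?_
  rw [mul_comm, funext_iff]

lemma sum_altSource_encoder (hs : IsSource p₀ κ) {M : Fin K → ℕ} (φ : ∀ k, 𝒴 k → Fin (M k))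
    (F : (∀ k, Fin (M k)) → 𝒳 × 𝒴₀ → ℝ) :
    ∑ w, altSource p₀ κ w * F (fun k => φ k (w.2.2 k)) (w.1, w.2.1) =
      ∑ z, ∑ u, p₀ z * outputMarginal p₀ κ (encoderChannel φ) Finset.univ u z.2 /
        outputMarginal p₀ κ (encoderChannel φ) ∅ u z.2 * F u z := by
  rw [Fintype.sum_prod_type, Fintype.sum_prod_type]
  refine Finset.sum_congr rfl fun x _ => ?_
  rw [Fintype.sum_prod_type]
  refine Finset.sum_congr rfl fun y₀ _ => ?_
  simp_rw [← sum_altSource_channel Finset.univ hs (x, y₀), Finset.sum_mul]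
  rw [Finset.sum_comm]
  refine Finset.sum_congr rfl fun y _ => ?_
  simp_rw [mul_assoc, ← Finset.mul_sum]
  rw [sum_encoderChannel φ y (fun u => F u (x, y₀))]

/-- Data processing for the divergence between the two hypotheses. -/
lemma le_relevance_encoderChannel (hs : IsSource p₀ κ) {M : Fin K → ℕ}
    (φ : ∀ k, 𝒴 k → Fin (M k)) (A : Set ((∀ k, Fin (M k)) × 𝒳 × 𝒴₀)) {β : ℝ} (hβ : 0 < β)
    (hA : ∑ w, altSource p₀ κ w * ind ((fun k => φ k (w.2.2 k), w.1, w.2.1) ∈ A) ≤ β) :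
    (∑ w, source p₀ κ w * ind ((fun k => φ k (w.2.2 k), w.1, w.2.1) ∈ A)) * (-Real.log β) - 1 ≤
      relevance (source p₀ κ) (encoderChannel φ) Finset.univ := by
  have hW := isChannel_encoderChannel φ
  set W := encoderChannel φ with hWdef
  -- the likelihood ratio is compared with `g`
  set g : (∀ k, Fin (M k)) → 𝒳 × 𝒴₀ → ℝ := fun u z =>
    1 + (β⁻¹ - 1) * ind ((u, z.1, z.2) ∈ A) with hg
  have hgval : ∀ u z, g u z = if (ind ((u, z.1, z.2) ∈ A)) = 1 then β⁻¹ else 1 := by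
    intro u z
    by_cases h : (u, z.1, z.2) ∈ A
    · simp [hg, ind_true h]
    · simp [hg, ind_false h]
  have hgpos : ∀ u z, 0 < g u z := by
    intro u z; rw [hgval]; split_ifs <;> positivity
  have hglog : ∀ u z, Real.log (g u z) = ind ((u, z.1, z.2) ∈ A) * (-Real.log β) := by
    intro u z
    by_cases h : (u, z.1, z.2) ∈ A
    · simp [hg, ind_true h]
    · simp [hg, ind_false h]
  rw [relevance_eq_sum hs hW]
  set t : (∀ k, Fin (M k)) → 𝒳 × 𝒴₀ → ℝ := fun u z => outputMarginal p₀ κ W Finset.univ u z.2 /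
    ((∏ k, outputKernel κ W k z (u k)) * outputMarginal p₀ κ W ∅ u z.2) with ht
  -- The variational bound log(1/t) ≥ log g + 1 - g t, with `t` the likelihood ratio of alternative
  -- to null. It comes from log x ≤ x - 1 at x = g t.
  have hpt : ∀ ω, channelJoint (source p₀ κ) W ω * (Real.log (g ω.2 (ω.1.1, ω.1.2.1)) + 1 -
      g ω.2 (ω.1.1, ω.1.2.1) * t ω.2 (ω.1.1, ω.1.2.1)) ≤ channelJoint (source p₀ κ) W ω *
      Real.log ((∏ k, outputKernel κ W k (ω.1.1, ω.1.2.1) (ω.2 k)) *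
      outputMarginal p₀ κ W ∅ ω.2 ω.1.2.1 / outputMarginal p₀ κ W Finset.univ ω.2 ω.1.2.1) := by
    intro ω
    by_cases h0 : channelJoint (source p₀ κ) W ω = 0
    · simp [h0]
    obtain ⟨-, -, -, hV, hG⟩ := factors_pos hs hW h0
    refine mul_le_mul_of_nonneg_left ?_ (channelJoint_nonneg hs hW ω)
    have hVp : 0 < ∏ k, outputKernel κ W k (ω.1.1, ω.1.2.1) (ω.2 k) :=
      Finset.prod_pos fun k _ => hV k
    have htinv : (∏ k, outputKernel κ W k (ω.1.1, ω.1.2.1) (ω.2 k)) *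
      outputMarginal p₀ κ W ∅ ω.2 ω.1.2.1 / outputMarginal p₀ κ W Finset.univ ω.2 ω.1.2.1 =
        (t ω.2 (ω.1.1, ω.1.2.1))⁻¹ := by simp only [ht]; rw [inv_div]
    have htpos : 0 < t ω.2 (ω.1.1, ω.1.2.1) := div_pos (hG _) (mul_pos hVp (hG _))
    rw [htinv]
    have hgp := hgpos ω.2 (ω.1.1, ω.1.2.1)
    have := Real.log_le_sub_one_of_pos (mul_pos hgp htpos)
    rw [Real.log_mul hgp.ne' htpos.ne'] at this
    rw [Real.log_inv]
    linarith
  refine le_trans ?_ (Finset.sum_le_sum fun ω _ => hpt ω)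
  have hsplit : ∀ ω, channelJoint (source p₀ κ) W ω * (Real.log (g ω.2 (ω.1.1, ω.1.2.1)) + 1 -
      g ω.2 (ω.1.1, ω.1.2.1) * t ω.2 (ω.1.1, ω.1.2.1)) =
      channelJoint (source p₀ κ) W ω * ind ((ω.2, ω.1.1, ω.1.2.1) ∈ A) * (-Real.log β) +
      channelJoint (source p₀ κ) W ω - channelJoint (source p₀ κ) W ω *
        (g ω.2 (ω.1.1, ω.1.2.1) * t ω.2 (ω.1.1, ω.1.2.1)) := by
    intro ω; rw [hglog]; ring
  rw [Finset.sum_congr rfl fun ω _ => hsplit ω, Finset.sum_sub_distrib, Finset.sum_add_distrib,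
    sum_channelJoint hs hW, ← Finset.sum_mul]
  have h1 : ∑ ω, channelJoint (source p₀ κ) W ω * ind ((ω.2, ω.1.1, ω.1.2.1) ∈ A) =
      ∑ w, source p₀ κ w * ind ((fun k => φ k (w.2.2 k), w.1, w.2.1) ∈ A) := by
    rw [Fintype.sum_prod_type]
    refine Finset.sum_congr rfl fun w _ => ?_
    simp only [channelJoint, mul_assoc, ← Finset.mul_sum]
    rw [hWdef, sum_encoderChannel φ w.2.2 (fun u => ind ((u, w.1, w.2.1) ∈ A))]
  -- The expectation of g under the alternative is at most 1 off A plus β⁻¹ β on A. Against the +1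
  -- of the variational bound this leaves the loss of 1.
  have h2 : ∑ ω, channelJoint (source p₀ κ) W ω *
      (g ω.2 (ω.1.1, ω.1.2.1) * t ω.2 (ω.1.1, ω.1.2.1)) ≤ 2 := by
    rw [sum_channelJoint_output (fun u z => g u z * t u z)]
    -- Only an inequality, because the alternative may charge outputs that have null probability
    -- zero.
    have hle : ∑ z, ∑ u, p₀ z * (∏ k, outputKernel κ W k z (u k)) * (g u z * t u z) ≤
        ∑ z, ∑ u, p₀ z * outputMarginal p₀ κ W Finset.univ u z.2 /
          outputMarginal p₀ κ W ∅ u z.2 * g u z := by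
      refine Finset.sum_le_sum fun z _ => Finset.sum_le_sum fun u _ => ?_
      have hVn : ∀ z k, 0 ≤ outputKernel κ W k z (u k) := fun z k =>
        Finset.sum_nonneg fun y _ => mul_nonneg ((hs.kernel_mem k z).1 _) ((hW k y).1 _)
      have hGn : ∀ T, 0 ≤ outputMarginal p₀ κ W T u z.2 := fun T =>
        Finset.sum_nonneg fun x _ => mul_nonneg (hs.base_mem.1 _)
          (Finset.prod_nonneg fun k _ => hVn _ k)
      by_cases hV0 : ∏ k, outputKernel κ W k z (u k) = 0
      · rw [hV0]
        simp only [mul_zero, zero_mul]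
        exact mul_nonneg (div_nonneg (mul_nonneg (hs.base_mem.1 _) (hGn _)) (hGn _))
          (hgpos u z).le
      · apply le_of_eq
        simp only [ht]
        by_cases hG0 : outputMarginal p₀ κ W ∅ u z.2 = 0
        · simp [hG0]
        · field_simp
    refine hle.trans ?_
    rw [hWdef, ← sum_altSource_encoder hs φ g]
    have h3 : ∑ w, altSource p₀ κ w * g (fun k => φ k (w.2.2 k)) (w.1, w.2.1) =
        ∑ w, altSource p₀ κ w * (1 - ind ((fun k => φ k (w.2.2 k), w.1, w.2.1) ∈ A)) +
        β⁻¹ * ∑ w, altSource p₀ κ w * ind ((fun k => φ k (w.2.2 k), w.1, w.2.1) ∈ A) := by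
      rw [Finset.mul_sum, ← Finset.sum_add_distrib]
      exact Finset.sum_congr rfl fun w _ => by simp only [hg]; ring
    have h4 : ∑ w, altSource p₀ κ w * (1 - ind ((fun k => φ k (w.2.2 k), w.1, w.2.1) ∈ A)) ≤ 1 := by
      calc _ ≤ ∑ w, altSource p₀ κ w * 1 := Finset.sum_le_sum fun w _ =>
            mul_le_mul_of_nonneg_left (by linarith [ind_nonneg ((fun k => φ k (w.2.2 k), w.1, w.2.1)
              ∈ A)]) (altSource_nonneg hs w)
        _ = ∑ z, p₀ z * (∑ x, p₀ (x, z.2)) / (∑ x, p₀ (x, z.2)) := by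
          simp only [mul_one]
          rw [Fintype.sum_prod_type, Fintype.sum_prod_type]
          refine Finset.sum_congr rfl fun x _ => ?_
          rw [Fintype.sum_prod_type]
          refine Finset.sum_congr rfl fun y₀ _ => ?_
          have := sum_altSource_channel (W := W) ∅ hs (x, y₀) (fun k => φ k (Classical.choice ?_))
          · simpa [outputMarginal] using this
          · by_contra hne
            rw [not_nonempty_iff] at hne
            have := (hs.kernel_mem k (x, y₀)).2
            simp at this
        _ ≤ ∑ z, p₀ z := by
          refine Finset.sum_le_sum fun z _ => ?_
          by_cases h0 : ∑ x, p₀ (x, z.2) = 0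
          · simp [h0, hs.base_mem.1 z]
          · rw [mul_div_assoc, div_self h0, mul_one]
        _ = 1 := hs.base_mem.2
    have h5 : β⁻¹ * ∑ w, altSource p₀ κ w *
        ind ((fun k => φ k (w.2.2 k), w.1, w.2.1) ∈ A) ≤ 1 := by
      calc _ ≤ β⁻¹ * β := mul_le_mul_of_nonneg_left hA (by positivity)
        _ = 1 := inv_mul_cancel₀ hβ.ne'
    rw [h3]
    linarith
  rw [h1]
  linarith

/-- The loss from binning is at most the total rate. -/
lemma tradeoff_empty_sub_le (hs : IsSource p₀ κ) {M : Fin K → ℕ} {W : ∀ k, 𝒴 k → Fin (M k) → ℝ}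
    (hW : IsChannel W) (S : Finset (Fin K)) :
    tradeoff (source p₀ κ) W ∅ - tradeoff (source p₀ κ) W S ≤ ∑ k ∈ S, Real.log (M k) := by
  classical
  have hp := channelJoint_nonneg hs hW
  have h1 := sum_channelJoint hs hW
  rw [← binningRate_eq_sub hs hW, binningRate, condMutualInfo_eq_ent hp]
  set p := channelJoint (source p₀ κ) W
  -- The chain is I(U_S;Y_S|U_{Sᶜ},Y₀) ≤ H(U_S|U_{Sᶜ},Y₀) ≤ H(U_S) ≤ ∑_{k∈S} log M_k.
  have e1 : ent p (fun ω => (fun k : S => ω.1.2.2 k, fun k : (Sᶜ : Finset (Fin K)) => ω.2 k,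
      ω.1.2.1)) ≤ ent p (fun ω => (fun k : S => ω.2 k, fun k : S => ω.1.2.2 k,
      fun k : (Sᶜ : Finset (Fin K)) => ω.2 k, ω.1.2.1)) :=
    ent_le_of_kernel hp fun ω ω' h => (Prod.mk.inj h).2
  have e2 := ent_submodular hp (fun ω (k : S) => ω.2 k)
    (fun ω => (fun k : (Sᶜ : Finset (Fin K)) => ω.2 k, ω.1.2.1)) (fun _ => ())
  have e3 : ent p (fun ω => (fun k : S => ω.2 k, (fun k : (Sᶜ : Finset (Fin K)) => ω.2 k,
      ω.1.2.1), ())) = ent p (fun ω => (fun k : S => ω.2 k,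
      fun k : (Sᶜ : Finset (Fin K)) => ω.2 k, ω.1.2.1)) :=
    ent_congr fun ω ω' _ _ => by simp
  have e4 : ent p (fun ω => ((fun k : (Sᶜ : Finset (Fin K)) => ω.2 k, ω.1.2.1), ())) =
      ent p (fun ω => (fun k : (Sᶜ : Finset (Fin K)) => ω.2 k, ω.1.2.1)) :=
    ent_congr fun ω ω' _ _ => by simp
  have e5 : ent p (fun ω => (fun k : S => ω.2 k, ())) = ent p (fun ω (k : S) => ω.2 k) :=
    ent_congr fun ω ω' _ _ => by simp
  have e6 : ent p (fun _ => ()) = 0 := ent_const_eq_zero h1 fun _ _ => rfl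
  have e7 := ent_le_log_card hp h1 (fun ω (k : S) => ω.2 k)
  have hM : ∀ k, M k ≠ 0 := by
    intro k hk
    have hne : Nonempty (Letter 𝒳 𝒴₀ 𝒴 × (∀ k, Fin (M k))) := by
      by_contra hne
      rw [not_nonempty_iff] at hne
      simp at h1
    obtain ⟨⟨-, u⟩⟩ := hne
    have := (u k).isLt
    omega
  have e8 : Real.log (Fintype.card (∀ k : S, Fin (M k))) = ∑ k ∈ S, Real.log (M k) := by
    rw [Fintype.card_pi]
    push_cast
    rw [Real.log_prod (fun k _ => by simpa using hM k)]
    simp only [Fintype.card_fin]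
    exact Finset.sum_coe_sort S (fun k => Real.log (M k))
  rw [e3, e4, e5, e6] at e2
  rw [e8] at e7
  linarith

end DataProcessing

end

end DistHT

namespace DistHT

noncomputable section

set_option linter.unusedSectionVars false

/-! ### The converse. -/

section Converse

variable {K : ℕ} {𝒳 𝒴₀ : Type*} {𝒴 : Fin K → Type*}
variable [Fintype 𝒳] [Fintype 𝒴₀] [∀ k, Fintype (𝒴 k)]
variable {p₀ : 𝒳 × 𝒴₀ → ℝ} {κ : ∀ k, 𝒳 × 𝒴₀ → 𝒴 k → ℝ}

lemma sum_source (hs : IsSource p₀ κ) : ∑ w, source p₀ κ w = 1 := by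
  have := sum_pmfOf (source p₀ κ) (fun w => (w.1, w.2.1))
  rw [← this, ← hs.base_mem.2]
  exact Finset.sum_congr rfl fun z _ => pmfOf_source_pair hs z.1 z.2

lemma source_nonneg (hs : IsSource p₀ κ) (w : Letter 𝒳 𝒴₀ 𝒴) : 0 ≤ source p₀ κ w :=
  mul_nonneg (hs.base_mem.1 _) (Finset.prod_nonneg fun k _ => (hs.kernel_mem k _).1 _)

/-- A code of block length `n` yields a point of the single-letter region up to vanishing terms. -/
lemma exists_tradeoff_of_code (hs : IsSource p₀ κ) {n : ℕ} (hn : 0 < n) {R : Fin K → ℝ}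
    {E ε δ β : ℝ} (hE : 0 ≤ E) (hδ : 0 ≤ δ) {M : Fin K → ℕ}
    (φ : ∀ k, (Fin n → 𝒴 k) → Fin (M k))
    (A : Set ((∀ k, Fin (M k)) × (Fin n → 𝒳) × (Fin n → 𝒴₀))) (hβ : 0 < β)
    (h0 : prob (iidPmf (source p₀ κ) n) {w | detectorInput φ w ∉ A} ≤ ε)
    (h1 : prob (iidPmf (altPmf (source p₀ κ)) n) {w | detectorInput φ w ∈ A} ≤ β)
    (hM : ∀ k, 1 / (n : ℝ) * Real.log (M k) ≤ R k + δ)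
    (hβE : -(1 / (n : ℝ)) * Real.log β ≥ E - δ) :
    ∃ v ∈ convexHull ℝ (tradeoffSet (source p₀ κ)), ∀ S,
      E - (ε * E + (K + 1) * δ + 1 / n) ≤ v S + ∑ k ∈ S, R k := by
  have hn' : (0 : ℝ) < n := by exact_mod_cast hn
  have hb := hs.block n
  have hW := isChannel_encoderChannel φ
  obtain ⟨v, hv, hvS⟩ := exists_le_of_mem_tradeoffSet_block hs n _ (tradeoff_mem_tradeoffSet hb hW)
  refine ⟨v, hv, fun S => ?_⟩
  have e0 := prob_iidPmf_eq _ _ (iidPmf_source (p₀ := p₀) (κ := κ) n) φ Aᶜ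
  rw [altPmf_source hs, prob_iidPmf_eq _ _ (iidPmf_altSource (p₀ := p₀) (κ := κ) n) φ A] at h1
  have e1 := le_relevance_encoderChannel hb φ A hβ h1
  rw [← tradeoff_empty_eq] at e1
  have e2 := tradeoff_empty_sub_le hb hW S
  have e3 := hvS S
  set p := ∑ w, source (blockBase p₀ n) (blockKernel κ n) w *
    ind ((fun k => φ k (w.2.2 k), w.1, w.2.1) ∈ A) with hp
  have hp1 : 1 - ε ≤ p := by
    have : prob (iidPmf (source p₀ κ) n) {w | detectorInput φ w ∉ A} = 1 - p := by
      refine e0.trans ?_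
      rw [hp, ← sum_source hb, ← Finset.sum_sub_distrib]
      refine Finset.sum_congr rfl fun w _ => ?_
      rw [Set.mem_compl_iff, ind_not]
      ring
    linarith
  have hp2 : p ≤ 1 := by
    rw [← sum_source hb]
    exact Finset.sum_le_sum fun w _ => mul_le_of_le_one_right (source_nonneg hb w) (ind_le_one _)
  have hp0 : 0 ≤ p := Finset.sum_nonneg fun w _ => mul_nonneg (source_nonneg hb w) (ind_nonneg _)
  have e4 : n * (E - δ) ≤ -Real.log β := by
    have := mul_le_mul_of_nonneg_left hβE hn'.le
    rwa [show (n : ℝ) * (-(1 / (n : ℝ)) * Real.log β) = -Real.log β by field_simp] at this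
  have e5 : ∑ k ∈ S, Real.log (M k) ≤ n * (∑ k ∈ S, R k + K * δ) := by
    calc ∑ k ∈ S, Real.log (M k) ≤ ∑ k ∈ S, n * (R k + δ) := Finset.sum_le_sum fun k _ => by
          have := mul_le_mul_of_nonneg_left (hM k) hn'.le
          rwa [← mul_assoc, mul_one_div_cancel hn'.ne', one_mul] at this
      _ = n * (∑ k ∈ S, R k + S.card * δ) := by
          rw [← Finset.mul_sum, Finset.sum_add_distrib, Finset.sum_const, nsmul_eq_mul]
      _ ≤ _ := by
          have : (S.card : ℝ) ≤ K := by
            exact_mod_cast (Finset.card_le_univ S).trans_eq (Fintype.card_fin K)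
          gcongr
  -- The two bounds on p are used separately: p ≥ 1 - ε against E ≥ 0, and p ≤ 1 against δ ≥ 0.
  have e6 : n * ((1 - ε) * E - δ) ≤ p * (-Real.log β) := by
    calc n * ((1 - ε) * E - δ) ≤ n * (p * E - p * δ) := by
          apply mul_le_mul_of_nonneg_left _ hn'.le
          have := mul_le_mul_of_nonneg_right hp1 hE
          have := mul_le_mul_of_nonneg_right hp2 hδ
          linarith
      _ = p * (n * (E - δ)) := by ring
      _ ≤ _ := mul_le_mul_of_nonneg_left e4 hp0
  have e7 : n * (E - (ε * E + (K + 1) * δ + 1 / n)) ≤ n * (v S + ∑ k ∈ S, R k) := by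
    have : n * (E - (ε * E + (K + 1) * δ + 1 / n)) =
        n * ((1 - ε) * E - δ) - n * (K * δ) - 1 := by field_simp; ring
    rw [this]
    linarith
  exact le_of_mul_le_mul_left e7 hn'

/-- A maximizer over C of the continuous function min_i (v_i + r_i) works for all η simultaneously.
-/
lemma exists_of_forall_sub_le {ι : Type*} [Fintype ι] [Nonempty ι] {C : Set (ι → ℝ)}
    (hC : IsCompact C) {E : ℝ} {r : ι → ℝ}
    (h : ∀ η : ℝ, 0 < η → ∃ v ∈ C, ∀ i, E - η ≤ v i + r i) :
    ∃ v ∈ C, ∀ i, E ≤ v i + r i := by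
  have hne : C.Nonempty := by
    obtain ⟨v, hv, -⟩ := h 1 one_pos
    exact ⟨v, hv⟩
  have hcont : Continuous fun v : ι → ℝ =>
      Finset.univ.inf' Finset.univ_nonempty fun i => v i + r i :=
    Continuous.finset_inf'_apply _ fun i _ => (continuous_apply i).add continuous_const
  obtain ⟨v, hv, hmax⟩ := hC.exists_isMaxOn hne hcont.continuousOn
  refine ⟨v, hv, fun i => le_of_forall_pos_le_add fun η hη => ?_⟩
  obtain ⟨v', hv', h'⟩ := h η hη
  have h1 : E - η ≤ Finset.univ.inf' Finset.univ_nonempty fun i => v' i + r i :=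
    Finset.le_inf' _ _ fun i _ => h' i
  have h2 := hmax hv'
  have h3 := Finset.inf'_le (fun i => v i + r i) (Finset.mem_univ i)
  simp only [Set.mem_ofPred_eq] at h2
  linarith

/-- The converse part. -/
lemma rateExponentRegion_subset (hs : IsSource p₀ κ) :
    rateExponentRegion (source p₀ κ) ⊆ singleLetterRegion (source p₀ κ) := by
  rintro ⟨R, E⟩ ⟨hR, hE, h⟩
  refine (mem_singleLetterRegion_iff hs).2 ⟨hR, hE, ?_⟩
  refine exists_of_forall_sub_le
    (isCompact_convexHull_of_finiteDimensional (isCompact_tradeoffSet hs)) fun η hη => ?_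
  simp only at hE h
  -- The error terms ε E, (K + 1) δ and 1/n are each made at most η/3; E + 1 avoids division by
  -- zero.
  set ε := min 1 (η / (3 * (E + 1))) with hε
  set δ := η / (3 * (K + 1)) with hδ
  have hδ0 : 0 < δ := by positivity
  have hε0 : 0 < ε := lt_min one_pos (by positivity)
  obtain ⟨N, hN⟩ := Filter.eventually_atTop.1 (h ε ⟨hε0, min_le_left _ _⟩ δ hδ0)
  obtain ⟨n₀, hn₀⟩ := exists_nat_gt (3 / η)
  set n := max N n₀
  have hnn : 3 / η < (n : ℝ) := hn₀.trans_le (by exact_mod_cast le_max_right N n₀)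
  have hn' : (0 : ℝ) < n := lt_trans (by positivity) hnn
  have hn : 0 < n := by exact_mod_cast hn'
  obtain ⟨M, φ, A, β, hβ, h0, h1, hM, hβE⟩ := hN n (le_max_left _ _)
  obtain ⟨v, hv, hvS⟩ := exists_tradeoff_of_code hs hn hE hδ0.le φ A hβ h0 h1 hM hβE
  refine ⟨v, hv, fun S => le_trans ?_ (hvS S)⟩
  have a1 : ε * E ≤ η / 3 := by
    calc ε * E ≤ η / (3 * (E + 1)) * (E + 1) := by
          apply mul_le_mul (min_le_right _ _) (by linarith) hE (by positivity)
      _ = η / 3 := by field_simp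
  have a2 : (K + 1) * δ = η / 3 := by rw [hδ]; field_simp
  have a3 : 1 / (n : ℝ) ≤ η / 3 := by
    rw [div_lt_iff₀ hη] at hnn
    rw [div_le_iff₀ hn']
    linarith
  linarith

end Converse

/-! ### Kernels of the null hypothesis. -/

section Existence

variable {K : ℕ} {𝒳 𝒴₀ : Type*} {𝒴 : Fin K → Type*}
variable [Fintype 𝒳] [Fintype 𝒴₀] [∀ k, Fintype (𝒴 k)]

/-- Under the null hypothesis the pmf is a source with conditionally independent observations. -/
lemma exists_source {P : Letter 𝒳 𝒴₀ 𝒴 → ℝ} (hP : P ∈ stdSimplex ℝ (Letter 𝒳 𝒴₀ 𝒴))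
    (hnull : CondIndepObservations P) : ∃ p₀ κ, IsSource p₀ κ ∧ P = source p₀ κ := by
  classical
  set p₀ : 𝒳 × 𝒴₀ → ℝ := pmfOf P (fun w => (w.1, w.2.1)) with hp₀
  -- Where P(x,y₀) = 0 the conditional pmf is identically zero by convention, hence not stochastic.
  -- The marginal of Y_k stands in, and its choice does not affect P.
  refine ⟨p₀, fun k z y => if p₀ z = 0 then pmfOf P (fun w => w.2.2 k) y else
    condPmf P (fun w => w.2.2 k) (fun w => (w.1, w.2.1)) y z, ⟨?_, fun k z => ?_⟩, ?_⟩
  · exact ⟨fun z => pmfOf_nonneg hP.1 _ _, by rw [hp₀, sum_pmfOf, hP.2]⟩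
  · by_cases h : p₀ z = 0
    · simp only [h, if_true]
      exact ⟨fun y => pmfOf_nonneg hP.1 _ _, by rw [sum_pmfOf, hP.2]⟩
    · simp only [h, if_false]
      refine ⟨fun y => div_nonneg (pmfOf_nonneg hP.1 _ _) (pmfOf_nonneg hP.1 _ _), ?_⟩
      simp only [condPmf]
      rw [← Finset.sum_div, sum_pmfOf_fst]
      exact div_self h
  · funext ⟨x, y₀, y⟩
    rw [hnull x y₀ y, source]
    by_cases h : p₀ (x, y₀) = 0
    · simp only [← hp₀, h, zero_mul]
    · simp only [h, if_false, ← hp₀]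

end Existence

end

end DistHT

namespace DistHT

noncomputable section

set_option linter.unusedSectionVars false

/-! ### Rejection sampling from a random codebook. -/

section Codebook

variable {U ι : Type*} [Fintype U] {L : ℕ}

lemma sum_iidPmf_mul_prod (p : U → ℝ) (n : ℕ) (f : Fin n → U → ℝ) :
    ∑ w, iidPmf p n w * ∏ i, f i (w i) = ∏ i, ∑ v, p v * f i v := by
  rw [← sum_pi_prod (fun i v => p v * f i v)]
  exact Finset.sum_congr rfl fun w _ => by rw [iidPmf, Finset.prod_mul_distrib]

lemma iidPmf_mem {p : U → ℝ} (hp : p ∈ stdSimplex ℝ U) (n : ℕ) :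
    iidPmf p n ∈ stdSimplex ℝ (Fin n → U) := by
  refine ⟨fun w => Finset.prod_nonneg fun i _ => hp.1 _, ?_⟩
  have := sum_iidPmf_mul_prod p n (fun _ _ => 1)
  simpa [hp.2] using this

/-- The probability that `j` is the first index accepted when the codeword `v` is accepted with
probability `a v`. -/
def firstHit (a : U → ℝ) (C : Fin L → U) (j : Fin L) : ℝ :=
  a (C j) * ∏ i with i < j, (1 - a (C i))

/-- The law of the first accepted index, `none` if there is no such index. -/
def selection (a : U → ℝ) (C : Fin L → U) : Option (Fin L) → ℝ
  | none => ∏ i, (1 - a (C i))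
  | some j => firstHit a C j

lemma firstHit_nonneg {a : U → ℝ} (ha : ∀ v, a v ∈ Set.Icc 0 1) (C : Fin L → U) (j : Fin L) :
    0 ≤ firstHit a C j :=
  mul_nonneg (ha _).1 (Finset.prod_nonneg fun i _ => by linarith [(ha (C i)).2])

lemma firstHit_le {a : U → ℝ} (ha : ∀ v, a v ∈ Set.Icc 0 1) (C : Fin L → U) (j : Fin L) :
    firstHit a C j ≤ a (C j) :=
  mul_le_of_le_one_right (ha _).1 (Finset.prod_le_one (fun i _ => by linarith [(ha (C i)).2])
    fun i _ => by linarith [(ha (C i)).1])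

lemma selection_mem {a : U → ℝ} (ha : ∀ v, a v ∈ Set.Icc 0 1) (C : Fin L → U) :
    selection a C ∈ stdSimplex ℝ (Option (Fin L)) := by
  refine ⟨fun i => ?_, ?_⟩
  · cases i with
    | none => exact Finset.prod_nonneg fun i _ => by linarith [(ha (C i)).2]
    | some j => exact firstHit_nonneg ha C j
  · rw [Fintype.sum_option]
    simp only [selection, firstHit]
    rw [Finset.prod_one_sub_ordered]
    ring

lemma prod_ite_lt_ite_eq (j : Fin L) (f g : Fin L → ℝ) :
    ∏ i, (if i < j then f i else if i = j then g i else 1) = g j * ∏ i with i < j, f i := by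
  rw [Finset.prod_ite, Finset.prod_ite_eq', mul_comm]
  simp

/-- The codewords are independent: the j earlier ones are all rejected and the one with index j
equals u and is accepted. -/
lemma sum_firstHit_mul_ind {r : U → ℝ} (hr : r ∈ stdSimplex ℝ U) (a : U → ℝ) (j : Fin L)
    (u : U) : ∑ C, iidPmf r L C * (firstHit a C j * ind (C j = u)) =
      r u * a u * (1 - ∑ v, r v * a v) ^ (j : ℕ) := by
  have h := sum_iidPmf_mul_prod r L fun i v =>
    if i < j then 1 - a v else if i = j then a v * ind (v = u) else 1
  have h1 : ∀ C : Fin L → U, firstHit a C j * ind (C j = u) =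
      ∏ i, if i < j then 1 - a (C i) else if i = j then a (C i) * ind (C i = u) else 1 := by
    intro C
    rw [prod_ite_lt_ite_eq j (fun i => 1 - a (C i)) (fun i => a (C i) * ind (C i = u)), firstHit]
    ring
  simp_rw [h1, h]
  have h2 : ∀ i : Fin L, ∑ v, r v * (if i < j then 1 - a v else
      if i = j then a v * ind (v = u) else 1) =
      if i < j then 1 - ∑ v, r v * a v else if i = j then r u * a u else 1 := by
    intro i
    split_ifs
    · simp_rw [mul_sub, mul_one, Finset.sum_sub_distrib, hr.2]
    · simp_rw [← mul_assoc]
      rw [sum_mul_ind u (fun v => r v * a v)]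
    · simp [hr.2]
  simp_rw [h2]
  rw [prod_ite_lt_ite_eq j (fun _ => 1 - ∑ v, r v * a v) (fun _ => r u * a u), Finset.prod_const,
    show Finset.univ.filter (· < j) = Finset.Iio j by ext; simp, Fin.card_Iio]

lemma sum_accept_mul_ind {r : U → ℝ} (hr : r ∈ stdSimplex ℝ U) (a : U → ℝ) {j j' : Fin L}
    (hj : j' ≠ j) (u : U) : ∑ C, iidPmf r L C * (a (C j) * ind (C j' = u)) =
      (∑ v, r v * a v) * r u := by
  have h := sum_iidPmf_mul_prod r L fun i v =>
    (if i = j then a v else 1) * (if i = j' then ind (v = u) else 1)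
  have h1 : ∀ C : Fin L → U, a (C j) * ind (C j' = u) =
      ∏ i, (if i = j then a (C i) else 1) * (if i = j' then ind (C i = u) else 1) := by
    intro C
    rw [Finset.prod_mul_distrib, Finset.prod_ite_eq', Finset.prod_ite_eq']
    simp
  simp_rw [h1, h]
  have h2 : ∀ i : Fin L, ∑ v, r v * ((if i = j then a v else 1) *
      (if i = j' then ind (v = u) else 1)) =
      (if i = j then ∑ v, r v * a v else 1) * (if i = j' then r u else 1) := by
    intro i
    by_cases h : i = j
    · have : i ≠ j' := fun h' => hj (h'.symm.trans h)
      simp [h, hj.symm]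
    · by_cases h' : i = j'
      · subst h'
        simp [hj, sum_mul_ind u r]
      · simp [h, h', hr.2]
  simp_rw [h2]
  rw [Finset.prod_mul_distrib, Finset.prod_ite_eq', Finset.prod_ite_eq']
  simp

/-- The probability with which the codeword `u` is accepted, for the target law `W`, the codebook
law `r` and the threshold `c`. -/
def acceptProb (c : ℝ) (r W : U → ℝ) (u : U) : ℝ := min 1 (W u / (c * r u))

variable {c : ℝ} {r W : U → ℝ}

lemma acceptProb_mem (hc : 0 ≤ c) (hr : ∀ u, 0 ≤ r u) (hW : ∀ u, 0 ≤ W u) (u : U) :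
    acceptProb c r W u ∈ Set.Icc 0 1 :=
  ⟨le_min zero_le_one (div_nonneg (hW u) (mul_nonneg hc (hr u))), min_le_left _ _⟩

lemma mul_acceptProb_le (hc : 0 < c) (hr : ∀ u, 0 < r u) (u : U) :
    r u * acceptProb c r W u ≤ W u / c := by
  have := hr u
  calc r u * acceptProb c r W u ≤ r u * (W u / (c * r u)) :=
        mul_le_mul_of_nonneg_left (min_le_right _ _) this.le
    _ = W u / c := by field_simp

lemma sum_mul_acceptProb_le (hc : 0 < c) (hr : ∀ u, 0 < r u) (hW : W ∈ stdSimplex ℝ U) :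
    ∑ u, r u * acceptProb c r W u ≤ 1 / c := by
  calc _ ≤ ∑ u, W u / c := Finset.sum_le_sum fun u _ => mul_acceptProb_le hc hr u
    _ = 1 / c := by rw [← Finset.sum_div, hW.2]

/-- The selected codeword has approximately the target law. -/
lemma le_sum_firstHit (hc : 1 ≤ c) (hr : r ∈ stdSimplex ℝ U) (hr0 : ∀ u, 0 < r u)
    (hW : W ∈ stdSimplex ℝ U) (L : ℕ) (u : U) :
    (1 - (1 - 1 / c) ^ L) * (W u * ind (W u ≤ c * r u)) ≤
      ∑ C : Fin L → U, iidPmf r L C *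
        ∑ j, firstHit (acceptProb c r W) C j * ind (C j = u) := by
  have hc0 : 0 < c := by linarith
  have hac := acceptProb_mem hc0.le (fun u => (hr0 u).le) hW.1
  simp_rw [Finset.mul_sum]
  rw [Finset.sum_comm]
  simp_rw [sum_firstHit_mul_ind hr]
  rw [← Finset.mul_sum]
  have hc1 : 0 ≤ 1 - 1 / c := by
    rw [sub_nonneg, div_le_one hc0]; exact hc
  -- A codeword is accepted with average probability at most 1/c, so the geometric series of
  -- rejections dominates the one with ratio 1 - 1/c.
  have hg : (1 - (1 - 1 / c) ^ L) * c ≤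
      ∑ j : Fin L, (1 - ∑ v, r v * acceptProb c r W v) ^ (j : ℕ) := by
    calc (1 - (1 - 1 / c) ^ L) * c = ∑ j : Fin L, (1 - 1 / c) ^ (j : ℕ) := by
          rw [Fin.sum_univ_eq_sum_range (fun j => (1 - 1 / c) ^ j) L]
          have := mul_neg_geom_sum (1 - 1 / c) L
          rw [sub_sub_cancel] at this
          rw [← this]
          field_simp
      _ ≤ _ := Finset.sum_le_sum fun j _ => pow_le_pow_left₀ hc1
          (by linarith [sum_mul_acceptProb_le hc0 hr0 hW]) _
  refine le_trans ?_ (mul_le_mul_of_nonneg_left hg (mul_nonneg (hr0 u).le (hac u).1))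
  have hθ : 0 ≤ 1 - (1 - 1 / c) ^ L := by
    have : (1 - 1 / c) ^ L ≤ 1 := pow_le_one₀ hc1 (by
      have : 0 ≤ 1 / c := by positivity
      linarith)
    linarith
  -- Under the threshold nothing is clipped and r u · a u = W u / c exactly; above it the claimed
  -- bound is zero.
  by_cases h : W u ≤ c * r u
  · have h1 : acceptProb c r W u = W u / (c * r u) :=
      min_eq_right ((div_le_one (mul_pos hc0 (hr0 u))).2 h)
    have := (hr0 u).ne'
    rw [ind_true h, h1, mul_one]
    apply le_of_eq
    field_simp
  · rw [ind_false h, mul_zero, mul_zero]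
    exact mul_nonneg (mul_nonneg (hr0 u).le (hac u).1) (mul_nonneg hθ hc0.le)

/-- The codewords in the bin of the selected codeword. -/
lemma sum_firstHit_bin_le (hc : 0 < c) (hr : r ∈ stdSimplex ℝ U) (hr0 : ∀ u, 0 < r u)
    (hW : W ∈ stdSimplex ℝ U) {L : ℕ} (bin : Fin L → ι) {B : ℝ}
    (hB : ∀ j, ∑ j', ind (j' ≠ j ∧ bin j' = bin j) ≤ B) (u : U) :
    ∑ C : Fin L → U, iidPmf r L C * ∑ j, ∑ j', firstHit (acceptProb c r W) C j *
        (ind (bin j' = bin j) * ind (C j' = u)) ≤ L / c * (W u + B * r u) := by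
  have hac := acceptProb_mem hc.le (fun u => (hr0 u).le) hW.1
  set a := acceptProb c r W
  have hρ := sum_mul_acceptProb_le hc hr0 hW
  have hρ0 : 0 ≤ ∑ v, r v * a v := Finset.sum_nonneg fun v _ => mul_nonneg (hr0 v).le (hac v).1
  have hρ1 : ∑ v, r v * a v ≤ 1 := by
    rw [← hr.2]
    exact Finset.sum_le_sum fun v _ => mul_le_of_le_one_right (hr0 v).le (hac v).2
  -- For j' = j the selected codeword itself is u. For j' ≠ j the rejections are ignored, and
  -- acceptance of the codeword j is independent of the value of the codeword j'.
  have hterm : ∀ j j', ∑ C : Fin L → U, iidPmf r L C * (firstHit a C j * ind (C j' = u)) ≤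
      ind (j' = j) * (W u / c) + ind (j' ≠ j) * (1 / c * r u) := by
    intro j j'
    by_cases h : j' = j
    · subst h
      rw [sum_firstHit_mul_ind hr, ind_true rfl, ind_false (by simp), one_mul, zero_mul, add_zero]
      refine le_trans (mul_le_of_le_one_right (mul_nonneg (hr0 u).le (hac u).1) ?_)
        (mul_acceptProb_le hc hr0 u)
      exact pow_le_one₀ (by linarith) (by linarith)
    · rw [ind_false h, ind_true h, zero_mul, one_mul, zero_add]
      calc _ ≤ ∑ C : Fin L → U, iidPmf r L C * (a (C j) * ind (C j' = u)) :=
            Finset.sum_le_sum fun C _ => mul_le_mul_of_nonneg_left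
              (mul_le_mul_of_nonneg_right (firstHit_le hac C j) (ind_nonneg _))
              ((iidPmf_mem hr L).1 C)
        _ = (∑ v, r v * a v) * r u := sum_accept_mul_ind hr a h u
        _ ≤ _ := mul_le_mul_of_nonneg_right hρ (hr0 u).le
  calc _ = ∑ j, ∑ j', ind (bin j' = bin j) *
        ∑ C : Fin L → U, iidPmf r L C * (firstHit a C j * ind (C j' = u)) := by
        simp_rw [Finset.mul_sum]
        rw [Finset.sum_comm]
        refine Finset.sum_congr rfl fun j _ => ?_
        rw [Finset.sum_comm]
        exact Finset.sum_congr rfl fun j' _ => Finset.sum_congr rfl fun C _ => by ring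
    _ ≤ ∑ j, ∑ j', ind (bin j' = bin j) *
        (ind (j' = j) * (W u / c) + ind (j' ≠ j) * (1 / c * r u)) :=
        Finset.sum_le_sum fun j _ => Finset.sum_le_sum fun j' _ =>
          mul_le_mul_of_nonneg_left (hterm j j') (ind_nonneg _)
    _ = ∑ j : Fin L, (W u / c + (∑ j', ind (j' ≠ j ∧ bin j' = bin j)) * (1 / c * r u)) := by
        refine Finset.sum_congr rfl fun j _ => ?_
        simp_rw [mul_add, Finset.sum_add_distrib, Finset.sum_mul, ind_and]
        congr 1
        · have := sum_mul_ind j (fun j' => ind (bin j' = bin j) * (W u / c))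
          rw [ind_true rfl, one_mul] at this
          refine Eq.trans (Finset.sum_congr rfl fun j' _ => ?_) this
          ring
        · exact Finset.sum_congr rfl fun j' _ => by ring
    _ ≤ ∑ _j : Fin L, (W u / c + B * (1 / c * r u)) := Finset.sum_le_sum fun j _ => by
        have := mul_le_mul_of_nonneg_right (hB j)
          (mul_nonneg (one_div_nonneg.2 hc.le) (hr0 u).le)
        linarith
    _ = L / c * (W u + B * r u) := by
        rw [Finset.sum_const, nsmul_eq_mul]
        simp only [Finset.card_univ, Fintype.card_fin]
        field_simp

end Codebook

end

end DistHT

namespace DistHT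

noncomputable section

set_option linter.unusedSectionVars false

/-! ### Deterministic encoders. -/

section Derandomization

variable {K : ℕ} {𝒴 I : Fin K → Type*} [∀ k, Fintype (𝒴 k)] [∀ k, Fintype (I k)]

lemma exists_le_of_le_sum_mul {α : Type*} [Fintype α] {p : α → ℝ} (hp : p ∈ stdSimplex ℝ α)
    {f : α → ℝ} {v : ℝ} (h : v ≤ ∑ a, p a * f a) : ∃ a, v ≤ f a := by
  have hne : Nonempty α := by
    by_contra hne
    rw [not_nonempty_iff] at hne
    have := hp.2
    simp at this
  obtain ⟨a, ha⟩ := Finite.exists_max f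
  refine ⟨a, h.trans ?_⟩
  calc ∑ b, p b * f b ≤ ∑ b, p b * f a :=
        Finset.sum_le_sum fun b _ => mul_le_mul_of_nonneg_left (ha b) (hp.1 b)
    _ = f a := by rw [← Finset.sum_mul, hp.2, one_mul]

lemma sum_fun_prod {α β : Type*} [Fintype α] [Fintype β] [DecidableEq α] (f : α → β → ℝ) :
    ∑ φ : α → β, ∏ a, f a (φ a) = ∏ a, ∑ b, f a b := by
  rw [Finset.prod_univ_sum, Fintype.piFinset_univ]

/-- A random function with independent values has the prescribed law at each point. -/
lemma sum_fun_prod_mul_ind {α β : Type*} [Fintype α] [Fintype β] [DecidableEq α] {e : α → β → ℝ}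
    (he : ∀ a, e a ∈ stdSimplex ℝ β) (a : α) (b : β) :
    ∑ φ : α → β, (∏ a', e a' (φ a')) * ind (φ a = b) = e a b := by
  have h1 : ∀ φ : α → β, (∏ a', e a' (φ a')) * ind (φ a = b) =
      ∏ a', e a' (φ a') * (if a' = a then ind (φ a' = b) else 1) := by
    intro φ
    rw [Finset.prod_mul_distrib, Finset.prod_ite_eq']
    simp
  simp_rw [h1]
  rw [sum_fun_prod (fun a' b' => e a' b' * (if a' = a then ind (b' = b) else 1))]
  rw [Finset.prod_eq_single a]
  · simp [sum_mul_ind b (e a)]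
  · intro a' _ h
    simp [h, (he a').2]
  · simp

/-- Stochastic encoders can be replaced by deterministic ones. -/
lemma exists_deterministic {e : ∀ k, 𝒴 k → I k → ℝ} (he : IsChannel e)
    {c : (∀ k, 𝒴 k) → (∀ k, I k) → ℝ} {v : ℝ}
    (h : v ≤ ∑ y, ∑ i, (∏ k, e k (y k) (i k)) * c y i) :
    ∃ φ : ∀ k, 𝒴 k → I k, v ≤ ∑ y, c y fun k => φ k (y k) := by
  classical
  -- All values of all encoders are drawn independently in advance. For one observation vector this
  -- reproduces the stochastic encoders, so some draw is as good as the average.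
  set p : (∀ k, 𝒴 k → I k) → ℝ := fun φ => ∏ k, ∏ y, e k y (φ k y) with hp
  have hpmem : p ∈ stdSimplex ℝ (∀ k, 𝒴 k → I k) := by
    refine ⟨fun φ => Finset.prod_nonneg fun k _ => Finset.prod_nonneg fun y _ => (he k y).1 _, ?_⟩
    rw [hp, sum_pi_prod (fun k (f : 𝒴 k → I k) => ∏ y, e k y (f y))]
    refine Finset.prod_eq_one fun k _ => ?_
    rw [sum_fun_prod (e k)]
    exact Finset.prod_eq_one fun y _ => (he k y).2
  refine exists_le_of_le_sum_mul hpmem (h.trans_eq ?_)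
  simp_rw [Finset.mul_sum]
  rw [Finset.sum_comm (s := (Finset.univ : Finset (∀ k, 𝒴 k → I k)))]
  refine Finset.sum_congr rfl fun y _ => ?_
  have h1 : ∀ φ : ∀ k, 𝒴 k → I k, p φ * c y (fun k => φ k (y k)) =
      ∑ i, (∏ k, (∏ y', e k y' (φ k y')) * ind (φ k (y k) = i k)) * c y i := by
    intro φ
    rw [← sum_mul_ind' (fun k => φ k (y k)) (c y), Finset.mul_sum]
    refine Finset.sum_congr rfl fun i _ => ?_
    rw [Finset.prod_mul_distrib, ← ind_forall, funext_iff]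
    ring
  simp_rw [h1]
  rw [Finset.sum_comm]
  refine Finset.sum_congr rfl fun i _ => ?_
  rw [← Finset.sum_mul, sum_pi_prod (fun k (f : 𝒴 k → I k) =>
    (∏ y', e k y' (f y')) * ind (f (y k) = i k))]
  congr 1
  exact Finset.prod_congr rfl fun k _ => (sum_fun_prod_mul_ind (he k) (y k) (i k)).symm

end Derandomization

/-! ### The detector with bins. -/

section Acceptance

variable {K : ℕ} {𝒵 : Type*} {𝒰 : Fin K → Type*} [∀ k, Fintype (𝒰 k)] {L M : Fin K → ℕ}

/-- The message sent for the selected index: its bin, or an error message. -/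
def binMessage {L M : ℕ} (bin : Fin L → Fin M) : Option (Fin L) → Fin (M + 1)
  | none => Fin.last M
  | some j => (bin j).castSucc

/-- The detector accepts if some tuple of codewords in the given bins passes the test `T`. -/
def acceptRegion (bin : ∀ k, Fin (L k) → Fin (M k)) (C : ∀ k, Fin (L k) → 𝒰 k)
    (T : (∀ k, 𝒰 k) → 𝒵 → Prop) : Set ((∀ k, Fin (M k + 1)) × 𝒵) :=
  {d | ∃ j : ∀ k, Fin (L k), (∀ k, d.1 k = (bin k (j k)).castSucc) ∧ T (fun k => C k (j k)) d.2}

/-- The probability of acceptance for given laws of the selected indices. -/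
def acceptance (bin : ∀ k, Fin (L k) → Fin (M k)) (C : ∀ k, Fin (L k) → 𝒰 k)
    (T : (∀ k, 𝒰 k) → 𝒵 → Prop) (s : ∀ k, Option (Fin (L k)) → ℝ) (z : 𝒵) : ℝ :=
  ∑ i : ∀ k, Option (Fin (L k)), (∏ k, s k (i k)) *
    ind ((fun k => binMessage (bin k) (i k), z) ∈ acceptRegion bin C T)

variable (bin : ∀ k, Fin (L k) → Fin (M k)) (C : ∀ k, Fin (L k) → 𝒰 k)
  (T : (∀ k, 𝒰 k) → 𝒵 → Prop) {s : ∀ k, Option (Fin (L k)) → ℝ}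

/-- The error message is not the label of any bin, so an encoder that selects nothing causes
rejection. -/
lemma acceptance_eq (z : 𝒵) : acceptance bin C T s z =
    ∑ j : ∀ k, Fin (L k), (∏ k, s k (some (j k))) *
      ind ((fun k => (bin k (j k)).castSucc, z) ∈ acceptRegion bin C T) := by
  classical
  set g : (∀ k, Fin (L k)) ↪ (∀ k, Option (Fin (L k))) :=
    ⟨fun j k => some (j k), fun j j' h => funext fun k => Option.some_injective _ (congrFun h k)⟩
  have := Finset.sum_map Finset.univ g fun i : ∀ k, Option (Fin (L k)) =>
    (∏ k, s k (i k)) *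
    ind ((fun k => binMessage (bin k) (i k), z) ∈ acceptRegion bin C T)
  refine Eq.trans ?_ this
  refine (Finset.sum_subset (Finset.subset_univ _) fun i _ hi => ?_).symm
  rw [ind_false, mul_zero]
  rintro ⟨j, hj, -⟩
  apply hi
  have : ∀ k, ∃ j', i k = some j' := by
    intro k
    cases hik : i k with
    | none =>
      have h := hj k
      simp only [hik, binMessage] at h
      exact absurd h.symm (Fin.castSucc_lt_last _).ne
    | some j' => exact ⟨j', rfl⟩
  choose j' hj' using this
  rw [Finset.mem_map]
  exact ⟨j', Finset.mem_univ _, funext fun k => (hj' k).symm⟩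

lemma ind_test_eq (j : ∀ k, Fin (L k)) (z : 𝒵) : ind (T (fun k => C k (j k)) z) =
    ∑ u, ind (T u z) * ∏ k, ind (C k (j k) = u k) := by
  rw [← sum_mul_ind' (fun k => C k (j k)) (fun u => ind (T u z))]
  exact Finset.sum_congr rfl fun u _ => by rw [← ind_forall, funext_iff]

/-- The tuple of selected codewords is itself a candidate for the detector. -/
lemma le_acceptance (hs : ∀ k i, 0 ≤ s k i) (z : 𝒵) :
    ∑ u, ind (T u z) * ∏ k, ∑ j, s k (some j) * ind (C k j = u k) ≤
      acceptance bin C T s z := by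
  rw [acceptance_eq]
  calc _ = ∑ j : ∀ k, Fin (L k), (∏ k, s k (some (j k))) * ind (T (fun k => C k (j k)) z) := by
        simp_rw [ind_test_eq, ← sum_pi_prod (fun k (j : Fin (L k)) => s k (some j) *
          ind (C k j = _)), Finset.mul_sum, Finset.prod_mul_distrib]
        rw [Finset.sum_comm]
        exact Finset.sum_congr rfl fun j _ => Finset.sum_congr rfl fun u _ => by ring
    _ ≤ _ := Finset.sum_le_sum fun j _ => mul_le_mul_of_nonneg_left
        (ind_mono fun h => ⟨j, fun _ => rfl, h⟩) (Finset.prod_nonneg fun k _ => hs k _)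

/-- Union bound over all tuples of codewords sharing the bins of the selected ones. -/
lemma acceptance_le (hs : ∀ k i, 0 ≤ s k i) (z : 𝒵) : acceptance bin C T s z ≤
    ∑ u, ind (T u z) * ∏ k, ∑ j, ∑ j', s k (some j) *
      (ind (bin k j' = bin k j) * ind (C k j' = u k)) := by
  rw [acceptance_eq]
  calc _ ≤ ∑ j : ∀ k, Fin (L k), (∏ k, s k (some (j k))) * ∑ j' : ∀ k, Fin (L k),
        (∏ k, ind (bin k (j' k) = bin k (j k))) * ind (T (fun k => C k (j' k)) z) := by
        refine Finset.sum_le_sum fun j _ => mul_le_mul_of_nonneg_left ?_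
          (Finset.prod_nonneg fun k _ => hs k _)
        simp_rw [← ind_forall, ← ind_and]
        by_cases h : (fun k => (bin k (j k)).castSucc, z) ∈ acceptRegion bin C T
        · obtain ⟨j', hj', hT⟩ := h
          refine (ind_le_one _).trans ?_
          have h1 : (∀ k, bin k (j' k) = bin k (j k)) ∧ T (fun k => C k (j' k)) z :=
            ⟨fun k => (Fin.castSucc_injective _ (hj' k)).symm, hT⟩
          rw [← ind_true h1]
          exact Finset.single_le_sum (f := fun j' : ∀ k, Fin (L k) =>
            ind ((∀ k, bin k (j' k) = bin k (j k)) ∧ T (fun k => C k (j' k)) z))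
            (fun _ _ => ind_nonneg _) (Finset.mem_univ j')
        · rw [ind_false h]
          exact Finset.sum_nonneg fun _ _ => ind_nonneg _
    _ = _ := by
        simp_rw [ind_test_eq, ← sum_pi_pi_prod (fun k (j j' : Fin (L k)) => s k (some j) *
          (ind (bin k j' = bin k j) * ind (C k j' = _))), Finset.mul_sum, Finset.prod_mul_distrib]
        symm
        rw [Finset.sum_comm]
        refine Finset.sum_congr rfl fun j _ => ?_
        rw [Finset.sum_comm]
        exact Finset.sum_congr rfl fun j' _ => Finset.sum_congr rfl fun u _ => by ring

end Acceptance

/-! ### One-shot random coding with binning. -/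

section OneShot

variable {K : ℕ} {𝒳 𝒴₀ : Type*} {𝒴 𝒰 : Fin K → Type*}
variable [Fintype 𝒳] [Fintype 𝒴₀] [∀ k, Fintype (𝒴 k)] [∀ k, Fintype (𝒰 k)]
variable {p₀ : 𝒳 × 𝒴₀ → ℝ} {κ : ∀ k, 𝒳 × 𝒴₀ → 𝒴 k → ℝ} {W : ∀ k, 𝒴 k → 𝒰 k → ℝ}
variable {r : ∀ k, 𝒰 k → ℝ} {c : Fin K → ℝ} {L M : Fin K → ℕ}

lemma sum_letter (f : Letter 𝒳 𝒴₀ 𝒴 → ℝ) : ∑ w, f w = ∑ y, ∑ z : 𝒳 × 𝒴₀, f (z.1, z.2, y) := by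
  rw [Finset.sum_comm, Fintype.sum_prod_type, Fintype.sum_prod_type]
  exact Finset.sum_congr rfl fun x _ => Fintype.sum_prod_type _

/-- The encoding kernels for a given codebook. -/
def codeChannel (c : Fin K → ℝ) (r : ∀ k, 𝒰 k → ℝ) (W : ∀ k, 𝒴 k → 𝒰 k → ℝ)
    (C : ∀ k, Fin (L k) → 𝒰 k) (k : Fin K) (y : 𝒴 k) : Option (Fin (L k)) → ℝ :=
  selection (acceptProb (c k) (r k) (W k y)) (C k)

lemma isChannel_codeChannel (hc : ∀ k, 0 ≤ c k) (hr : ∀ k u, 0 ≤ r k u) (hW : IsChannel W)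
    (C : ∀ k, Fin (L k) → 𝒰 k) : IsChannel (codeChannel c r W C) := fun k y =>
  selection_mem (acceptProb_mem (hc k) (hr k) (hW k y).1) (C k)

/-- The law of the random codebooks. -/
def codebooksPmf (r : ∀ k, 𝒰 k → ℝ) (L : Fin K → ℕ) (C : ∀ k, Fin (L k) → 𝒰 k) : ℝ :=
  ∏ k, iidPmf (r k) (L k) (C k)

lemma codebooksPmf_mem (hr : ∀ k, r k ∈ stdSimplex ℝ (𝒰 k)) (L : Fin K → ℕ) :
    codebooksPmf r L ∈ stdSimplex ℝ (∀ k, Fin (L k) → 𝒰 k) := by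
  refine ⟨fun C => Finset.prod_nonneg fun k _ => (iidPmf_mem (hr k) (L k)).1 _, ?_⟩
  unfold codebooksPmf
  rw [sum_pi_prod (fun k C => iidPmf (r k) (L k) C)]
  exact Finset.prod_eq_one fun k _ => (iidPmf_mem (hr k) (L k)).2

lemma sum_codebooksPmf_mul {𝒵 : Type*} (T : (∀ k, 𝒰 k) → 𝒵 → Prop) (z : 𝒵)
    (g : ∀ k, (Fin (L k) → 𝒰 k) → 𝒰 k → ℝ) :
    ∑ C, codebooksPmf r L C * ∑ u, ind (T u z) * ∏ k, g k (C k) (u k) =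
      ∑ u, ind (T u z) * ∏ k, ∑ C, iidPmf (r k) (L k) C * g k C (u k) := by
  simp_rw [Finset.mul_sum]
  rw [Finset.sum_comm]
  refine Finset.sum_congr rfl fun u _ => ?_
  rw [← sum_pi_prod (fun k C => iidPmf (r k) (L k) C * g k C (u k)), Finset.mul_sum]
  refine Finset.sum_congr rfl fun C _ => ?_
  rw [Finset.prod_mul_distrib, codebooksPmf]
  ring

lemma le_sum_acceptance (hc : ∀ k, 1 ≤ c k) (hr : ∀ k, r k ∈ stdSimplex ℝ (𝒰 k))
    (hr0 : ∀ k u, 0 < r k u) (hW : IsChannel W) (bin : ∀ k, Fin (L k) → Fin (M k))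
    (T : (∀ k, 𝒰 k) → 𝒳 × 𝒴₀ → Prop) (y : ∀ k, 𝒴 k) (z : 𝒳 × 𝒴₀) :
    (∏ k, (1 - (1 - 1 / c k) ^ L k)) * ∑ u, ind (T u z) *
        ∏ k, (W k (y k) (u k) * ind (W k (y k) (u k) ≤ c k * r k (u k))) ≤
      ∑ C, codebooksPmf r L C *
        acceptance bin C T (fun k => codeChannel c r W C k (y k)) z := by
  have hc0 : ∀ k, 0 < c k := fun k => zero_lt_one.trans_le (hc k)
  have hch := fun C => isChannel_codeChannel (L := L) (fun k => (hc0 k).le)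
    (fun k u => (hr0 k u).le) hW C
  refine le_trans ?_ (Finset.sum_le_sum fun C _ => mul_le_mul_of_nonneg_left
    (le_acceptance bin C T (fun k i => (hch C k (y k)).1 i) z) ((codebooksPmf_mem hr L).1 C))
  have := sum_codebooksPmf_mul (r := r) T z (fun k C u => ∑ j : Fin (L k),
    firstHit (acceptProb (c k) (r k) (W k (y k))) C j * ind (C j = u))
  refine le_trans ?_ this.ge
  rw [Finset.mul_sum]
  refine Finset.sum_le_sum fun u _ => ?_
  rw [mul_left_comm, ← Finset.prod_mul_distrib]
  refine mul_le_mul_of_nonneg_left (Finset.prod_le_prod (fun k _ => ?_) fun k _ =>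
    le_sum_firstHit (hc k) (hr k) (hr0 k) (hW k (y k)) (L k) (u k)) (ind_nonneg _)
  have h1 : 0 ≤ 1 - 1 / c k := by rw [sub_nonneg, div_le_one (hc0 k)]; exact hc k
  have h2 : (1 - 1 / c k) ^ L k ≤ 1 := pow_le_one₀ h1 (by
    have : 0 ≤ 1 / c k := by have := hc0 k; positivity
    linarith)
  exact mul_nonneg (by linarith) (mul_nonneg ((hW k (y k)).1 _) (ind_nonneg _))

lemma sum_acceptance_le (hc : ∀ k, 0 < c k) (hr : ∀ k, r k ∈ stdSimplex ℝ (𝒰 k))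
    (hr0 : ∀ k u, 0 < r k u) (hW : IsChannel W) (bin : ∀ k, Fin (L k) → Fin (M k))
    {B : Fin K → ℝ} (hB : ∀ k j, ∑ j', ind (j' ≠ j ∧ bin k j' = bin k j) ≤ B k)
    (T : (∀ k, 𝒰 k) → 𝒳 × 𝒴₀ → Prop) (y : ∀ k, 𝒴 k) (z : 𝒳 × 𝒴₀) :
    ∑ C, codebooksPmf r L C * acceptance bin C T (fun k => codeChannel c r W C k (y k)) z ≤
      ∑ u, ind (T u z) * ∏ k, (L k / c k * (W k (y k) (u k) + B k * r k (u k))) := by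
  have hch := fun C => isChannel_codeChannel (L := L) (fun k => (hc k).le)
    (fun k u => (hr0 k u).le) hW C
  refine (Finset.sum_le_sum fun C _ => mul_le_mul_of_nonneg_left
    (acceptance_le bin C T (fun k i => (hch C k (y k)).1 i) z)
    ((codebooksPmf_mem hr L).1 C)).trans ?_
  have := sum_codebooksPmf_mul (r := r) T z (fun k C u => ∑ j : Fin (L k), ∑ j',
    firstHit (acceptProb (c k) (r k) (W k (y k))) C j *
      (ind (bin k j' = bin k j) * ind (C j' = u)))
  refine this.le.trans (Finset.sum_le_sum fun u _ => mul_le_mul_of_nonneg_left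
    (Finset.prod_le_prod (fun k _ => ?_) fun k _ =>
      sum_firstHit_bin_le (hc k) (hr k) (hr0 k) (hW k (y k)) (bin k) (hB k) (u k)) (ind_nonneg _))
  exact Finset.sum_nonneg fun C _ => mul_nonneg ((iidPmf_mem (hr k) (L k)).1 C)
    (Finset.sum_nonneg fun j _ => Finset.sum_nonneg fun j' _ =>
      mul_nonneg (firstHit_nonneg (acceptProb_mem (hc k).le (fun u => (hr0 k u).le)
        (hW k (y k)).1) C j) (mul_nonneg (ind_nonneg _) (ind_nonneg _)))

/-- The alternate hypothesis puts small mass on the test. -/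
lemma sum_altSource_test_le (hs : IsSource p₀ κ) (hW : IsChannel W) {B : Fin K → ℝ}
    {a : Fin K → ℝ} {T : (∀ k, 𝒰 k) → 𝒳 × 𝒴₀ → Prop} {τ : ℝ}
    (hτ : 0 ≤ τ) (hT : ∀ u z, T u z → ∀ S : Finset (Fin K),
      (∏ k, a k) * (∏ k ∈ S, B k * r k (u k)) *
        (outputMarginal p₀ κ W Sᶜ u z.2 / outputMarginal p₀ κ W ∅ u z.2) ≤
      τ * ∏ k, outputKernel κ W k z (u k)) :
    ∑ y, ∑ z : 𝒳 × 𝒴₀, altSource p₀ κ (z.1, z.2, y) *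
      ∑ u, ind (T u z) * ∏ k, (a k * (W k (y k) (u k) + B k * r k (u k))) ≤ 2 ^ K * τ := by
  classical
  calc _ = ∑ z : 𝒳 × 𝒴₀, ∑ u, ind (T u z) * (∏ k, a k) *
        ∑ S : Finset (Fin K), (∏ k ∈ S, B k * r k (u k)) * ∑ y, altSource p₀ κ (z.1, z.2, y) *
          ∏ k ∈ Sᶜ, W k (y k) (u k) := by
        rw [Finset.sum_comm]
        refine Finset.sum_congr rfl fun z _ => ?_
        simp_rw [Finset.mul_sum]
        rw [Finset.sum_comm]
        refine Finset.sum_congr rfl fun u _ => ?_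
        rw [Finset.sum_comm]
        refine Finset.sum_congr rfl fun y _ => ?_
        -- Expanding the product over encoders gives a sum over S, the set of encoders contributing
        -- a bin-mate instead of their selected codeword.
        simp_rw [add_comm (W _ _ _)]
        rw [Finset.prod_mul_distrib, Fintype.prod_add, Finset.mul_sum, Finset.mul_sum,
          Finset.mul_sum]
        exact Finset.sum_congr rfl fun S _ => by ring
    _ ≤ ∑ z : 𝒳 × 𝒴₀, ∑ u : ∀ k, 𝒰 k, ∑ _S : Finset (Fin K),
        τ * (p₀ z * ∏ k, outputKernel κ W k z (u k)) := by
        refine Finset.sum_le_sum fun z _ => Finset.sum_le_sum fun u _ => ?_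
        rw [Finset.mul_sum]
        refine Finset.sum_le_sum fun S _ => ?_
        rw [sum_altSource_channel Sᶜ hs z u]
        by_cases h : T u z
        · rw [ind_true h, one_mul]
          have := mul_le_mul_of_nonneg_left (hT u z h S) (hs.base_mem.1 z)
          calc _ = p₀ z * ((∏ k, a k) * (∏ k ∈ S, B k * r k (u k)) *
            (outputMarginal p₀ κ W Sᶜ u z.2 / outputMarginal p₀ κ W ∅ u z.2)) := by ring
            _ ≤ _ := this
            _ = _ := by ring
        · rw [ind_false h, zero_mul, zero_mul]
          exact mul_nonneg hτ (mul_nonneg (hs.base_mem.1 z) (Finset.prod_nonneg fun k _ =>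
            Finset.sum_nonneg fun y _ => mul_nonneg ((hs.kernel_mem k z).1 y) ((hW k y).1 _)))
    _ = 2 ^ K * τ := by
        have h := sum_channelJoint_output (p₀ := p₀) (κ := κ) (W := W) (fun _ _ => 1)
        simp only [mul_one, sum_channelJoint hs hW] at h
        simp only [Finset.sum_const, nsmul_eq_mul, Finset.card_univ, Fintype.card_finset,
          Fintype.card_fin]
        simp_rw [mul_left_comm _ τ, ← Finset.mul_sum] at h ⊢
        rw [← h]
        push_cast
        ring

/-- Random coding with binning. -/
lemma exists_code (hs : IsSource p₀ κ) (hc : ∀ k, 1 ≤ c k)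
    (hr : ∀ k, r k ∈ stdSimplex ℝ (𝒰 k)) (hr0 : ∀ k u, 0 < r k u) (hW : IsChannel W)
    (bin : ∀ k, Fin (L k) → Fin (M k)) {B : Fin K → ℝ}
    (hB : ∀ k j, ∑ j', ind (j' ≠ j ∧ bin k j' = bin k j) ≤ B k)
    {T : (∀ k, 𝒰 k) → 𝒳 × 𝒴₀ → Prop} {τ t : ℝ} (hτ : 0 ≤ τ) (ht : 0 ≤ t)
    (hT : ∀ u z, T u z → ∀ S : Finset (Fin K),
      (∏ k, (L k / c k : ℝ)) * (∏ k ∈ S, B k * r k (u k)) *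
        (outputMarginal p₀ κ W Sᶜ u z.2 / outputMarginal p₀ κ W ∅ u z.2) ≤
      τ * ∏ k, outputKernel κ W k z (u k)) :
    ∃ (φ : ∀ k, 𝒴 k → Fin (M k + 1)) (A : Set ((∀ k, Fin (M k + 1)) × 𝒳 × 𝒴₀)),
      (∏ k, (1 - (1 - 1 / c k) ^ L k)) * (∑ ω, channelJoint (source p₀ κ) W ω *
        ind (T ω.2 (ω.1.1, ω.1.2.1) ∧
          ∀ k, W k (ω.1.2.2 k) (ω.2 k) ≤ c k * r k (ω.2 k))) - t * (2 ^ K * τ) ≤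
      (∑ w, source p₀ κ w * ind ((fun k => φ k (w.2.2 k), w.1, w.2.1) ∈ A)) -
        t * ∑ w, altSource p₀ κ w * ind ((fun k => φ k (w.2.2 k), w.1, w.2.1) ∈ A) := by
  have hc0 : ∀ k, 0 < c k := fun k => zero_lt_one.trans_le (hc k)
  set p := codebooksPmf r L
  set acc : (∀ k, Fin (L k) → 𝒰 k) → (∀ k, 𝒴 k) → 𝒳 × 𝒴₀ → ℝ := fun C y z =>
    acceptance bin C T (fun k => codeChannel c r W C k (y k)) z with hacc
  set θ := ∏ k, (1 - (1 - 1 / c k) ^ L k)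
  -- the expectation over the codebooks
  have h1 : θ * (∑ ω, channelJoint (source p₀ κ) W ω * ind (T ω.2 (ω.1.1, ω.1.2.1) ∧
      ∀ k, W k (ω.1.2.2 k) (ω.2 k) ≤ c k * r k (ω.2 k))) ≤
      ∑ y, ∑ z : 𝒳 × 𝒴₀, source p₀ κ (z.1, z.2, y) * ∑ C, p C * acc C y z := by
    rw [Fintype.sum_prod_type, sum_letter, Finset.mul_sum]
    refine Finset.sum_le_sum fun y _ => ?_
    rw [Finset.mul_sum]
    refine Finset.sum_le_sum fun z _ => ?_
    refine le_trans (le_of_eq ?_) (mul_le_mul_of_nonneg_left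
      (le_sum_acceptance hc hr hr0 hW bin T y z) (source_nonneg hs (z.1, z.2, y)))
    rw [mul_left_comm, Finset.mul_sum (a := source p₀ κ _)]
    congr 1
    refine Finset.sum_congr rfl fun u _ => ?_
    simp only [channelJoint]
    rw [ind_and, ind_forall, Finset.prod_mul_distrib]
    ring
  have h2 : ∑ y, ∑ z : 𝒳 × 𝒴₀, altSource p₀ κ (z.1, z.2, y) * ∑ C, p C * acc C y z ≤
      2 ^ K * τ := by
    refine le_trans ?_ (sum_altSource_test_le hs hW hτ hT)
    exact Finset.sum_le_sum fun y _ => Finset.sum_le_sum fun z _ =>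
      mul_le_mul_of_nonneg_left (sum_acceptance_le hc0 hr hr0 hW bin hB T y z)
        (altSource_nonneg hs _)
  -- Both error probabilities are merged into one linear payoff with multiplier `t`, so a single
  -- codebook, and later a single choice of encoders, handles both.
  have h3 : ∑ C, p C * (∑ y, ∑ z : 𝒳 × 𝒴₀, (source p₀ κ (z.1, z.2, y) -
      t * altSource p₀ κ (z.1, z.2, y)) * acc C y z) =
      (∑ y, ∑ z : 𝒳 × 𝒴₀, source p₀ κ (z.1, z.2, y) * ∑ C, p C * acc C y z) -
      t * ∑ y, ∑ z : 𝒳 × 𝒴₀, altSource p₀ κ (z.1, z.2, y) * ∑ C, p C * acc C y z := by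
    rw [Finset.mul_sum, ← Finset.sum_sub_distrib]
    simp_rw [Finset.mul_sum]
    rw [Finset.sum_comm]
    refine Finset.sum_congr rfl fun y _ => ?_
    rw [Finset.sum_comm, ← Finset.sum_sub_distrib]
    refine Finset.sum_congr rfl fun z _ => ?_
    rw [← Finset.sum_sub_distrib]
    exact Finset.sum_congr rfl fun C _ => by ring
  obtain ⟨C, hC⟩ := exists_le_of_le_sum_mul (codebooksPmf_mem hr L) (h3.ge.trans'
    (sub_le_sub h1 (mul_le_mul_of_nonneg_left h2 ht)))
  -- the deterministic encoders
  have h4 : ∑ y, ∑ z : 𝒳 × 𝒴₀, (source p₀ κ (z.1, z.2, y) -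
      t * altSource p₀ κ (z.1, z.2, y)) * acc C y z =
      ∑ y, ∑ i : ∀ k, Option (Fin (L k)), (∏ k, codeChannel c r W C k (y k) (i k)) * ∑ z : 𝒳 × 𝒴₀,
        (source p₀ κ (z.1, z.2, y) - t * altSource p₀ κ (z.1, z.2, y)) *
          ind ((fun k => binMessage (bin k) (i k), z) ∈ acceptRegion bin C T) := by
    refine Finset.sum_congr rfl fun y _ => ?_
    simp_rw [hacc, acceptance, Finset.mul_sum]
    rw [Finset.sum_comm]
    exact Finset.sum_congr rfl fun i _ => Finset.sum_congr rfl fun z _ => by ring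
  obtain ⟨φ, hφ⟩ := exists_deterministic (isChannel_codeChannel (fun k => (hc0 k).le)
    (fun k u => (hr0 k u).le) hW C) (hC.trans_eq h4)
  refine ⟨fun k y => binMessage (bin k) (φ k y), acceptRegion bin C T, hφ.trans_eq ?_⟩
  rw [Finset.mul_sum, ← Finset.sum_sub_distrib, sum_letter]
  exact Finset.sum_congr rfl fun y _ => Finset.sum_congr rfl fun z _ => by
    rw [sub_mul, mul_assoc]

end OneShot

end

end DistHT

namespace DistHT

noncomputable section

set_option linter.unusedSectionVars false

/-! ### The law of large numbers by exponential moments. -/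

section LawOfLargeNumbers

variable {Ω : Type*} [Fintype Ω] {p : Ω → ℝ}

/-- The exponential moment that controls the lower deviations of a sample mean. -/
lemma exists_exp_moment_lt_one (hp : p ∈ stdSimplex ℝ Ω) (f : Ω → ℝ) {δ : ℝ} (hδ : 0 < δ) :
    ∃ t : ℝ, 0 < t ∧
      ∑ ω, p ω * Real.exp (-(t * (f ω - (∑ ω, p ω * f ω - δ)))) < 1 := by
  set μ := ∑ ω, p ω * f ω with hμ
  obtain ⟨C, hC0, hC⟩ : ∃ C : ℝ, 0 < C ∧ ∀ ω, |f ω - μ| ≤ C := by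
    refine ⟨1 + ∑ ω, |f ω - μ|, by positivity, fun ω => ?_⟩
    have := Finset.single_le_sum (f := fun ω => |f ω - μ|) (fun _ _ => abs_nonneg _)
      (Finset.mem_univ ω)
    linarith
  -- The first bound allows exp x ≤ 1 + x + x²; the second makes t² C² at most tδ/2, which loses to
  -- the drift -tδ.
  set t := min (1 / C) (δ / (2 * C ^ 2)) with ht
  have ht0 : 0 < t := lt_min (by positivity) (by positivity)
  have ht1 : t * C ≤ 1 := by
    have := mul_le_mul_of_nonneg_right (min_le_left (1 / C) (δ / (2 * C ^ 2))) hC0.le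
    rwa [one_div_mul_cancel hC0.ne'] at this
  have ht2 : t * C ^ 2 ≤ δ / 2 := by
    have := mul_le_mul_of_nonneg_right (min_le_right (1 / C) (δ / (2 * C ^ 2)))
      (by positivity : 0 ≤ C ^ 2)
    rwa [show δ / (2 * C ^ 2) * C ^ 2 = δ / 2 by field_simp] at this
  refine ⟨t, ht0, ?_⟩
  have hpt : ∀ ω, Real.exp (-(t * (f ω - μ))) ≤ 1 - t * (f ω - μ) + t ^ 2 * C ^ 2 := by
    intro ω
    have h1 : |-(t * (f ω - μ))| ≤ t * C := by
      rw [abs_neg, abs_mul, abs_of_pos ht0]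
      exact mul_le_mul_of_nonneg_left (hC ω) ht0.le
    have h2 := Real.abs_exp_sub_one_sub_id_le (h1.trans ht1)
    have h3 : (-(t * (f ω - μ))) ^ 2 ≤ t ^ 2 * C ^ 2 := by
      rw [← mul_pow, ← sq_abs]
      exact pow_le_pow_left₀ (abs_nonneg _) h1 2
    linarith [le_abs_self (Real.exp (-(t * (f ω - μ))) - 1 - -(t * (f ω - μ)))]
  have hsum : ∑ ω, p ω * (1 - t * (f ω - μ) + t ^ 2 * C ^ 2) = 1 + t ^ 2 * C ^ 2 := by
    calc _ = ∑ ω, ((1 + t * μ + t ^ 2 * C ^ 2) * p ω - t * (p ω * f ω)) :=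
          Finset.sum_congr rfl fun ω _ => by ring
      _ = _ := by
          rw [Finset.sum_sub_distrib, ← Finset.mul_sum, ← Finset.mul_sum, hp.2, ← hμ]
          ring
  calc _ = (∑ ω, p ω * Real.exp (-(t * (f ω - μ)))) * Real.exp (-(t * δ)) := by
        rw [Finset.sum_mul]
        refine Finset.sum_congr rfl fun ω _ => ?_
        rw [mul_assoc, ← Real.exp_add]
        congr 2
        ring
    _ ≤ (1 + t ^ 2 * C ^ 2) * Real.exp (-(t * δ)) := by
        refine mul_le_mul_of_nonneg_right ?_ (Real.exp_pos _).le
        rw [← hsum]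
        exact Finset.sum_le_sum fun ω _ => mul_le_mul_of_nonneg_left (hpt ω) (hp.1 ω)
    _ ≤ Real.exp (t ^ 2 * C ^ 2) * Real.exp (-(t * δ)) :=
        mul_le_mul_of_nonneg_right (by linarith [Real.add_one_le_exp (t ^ 2 * C ^ 2)])
          (Real.exp_pos _).le
    _ < 1 := by
        rw [← Real.exp_add, Real.exp_lt_one_iff]
        have := mul_le_mul_of_nonneg_left ht2 ht0.le
        have := mul_pos ht0 hδ
        nlinarith

/-- The weak law of large numbers for lower deviations. -/
lemma eventually_deviation_le (hp : p ∈ stdSimplex ℝ Ω) (f : Ω → ℝ) {δ η : ℝ} (hδ : 0 < δ)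
    (hη : 0 < η) : ∀ᶠ n : ℕ in Filter.atTop, ∑ w, iidPmf p n w *
      ind (∑ i, f (w i) < n * (∑ ω, p ω * f ω - δ)) ≤ η := by
  obtain ⟨t, ht, hlt⟩ := exists_exp_moment_lt_one hp f hδ
  set μ := ∑ ω, p ω * f ω
  set ρ := ∑ ω, p ω * Real.exp (-(t * (f ω - (μ - δ))))
  have hρ0 : 0 ≤ ρ := Finset.sum_nonneg fun ω _ => mul_nonneg (hp.1 ω) (Real.exp_pos _).le
  filter_upwards [(tendsto_pow_atTop_nhds_zero_of_lt_one hρ0 hlt).eventually_le_const hη]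
    with n hn
  refine le_trans ?_ hn
  have h := sum_iidPmf_mul_prod p n fun _ ω => Real.exp (-(t * (f ω - (μ - δ))))
  rw [Finset.prod_const, Finset.card_univ, Fintype.card_fin] at h
  rw [← h]
  refine Finset.sum_le_sum fun w _ => mul_le_mul_of_nonneg_left ?_ ((iidPmf_mem hp n).1 w)
  rw [← Real.exp_sum]
  by_cases hw : ∑ i, f (w i) < n * (μ - δ)
  · rw [ind_true hw]
    apply Real.one_le_exp
    rw [Finset.sum_neg_distrib, ← Finset.mul_sum, Finset.sum_sub_distrib, Finset.sum_const,
      Finset.card_univ, Fintype.card_fin, nsmul_eq_mul]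
    nlinarith
  · rw [ind_false hw]
    exact (Real.exp_pos _).le

/-- Sample means of finitely many functions are typical with high probability. -/
lemma eventually_typical {ι : Type*} [Fintype ι] (hp : p ∈ stdSimplex ℝ Ω) (f : ι → Ω → ℝ)
    {δ η : ℝ} (hδ : 0 < δ) (hη : 0 < η) : ∀ᶠ n : ℕ in Filter.atTop, 1 - η ≤
      ∑ w, iidPmf p n w * ind (∀ j, n * (∑ ω, p ω * f j ω - δ) ≤ ∑ i, f j (w i)) := by
  -- Union bound with equal shares; the +1 covers an empty index type.
  have hη' : 0 < η / (Fintype.card ι + 1) := by positivity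
  filter_upwards [Filter.eventually_all.2 fun j => eventually_deviation_le hp (f j) hδ hη']
    with n hn
  have hpt : ∀ w : Fin n → Ω, 1 - ∑ j, ind (∑ i, f j (w i) < n * (∑ ω, p ω * f j ω - δ)) ≤
      ind (∀ j, n * (∑ ω, p ω * f j ω - δ) ≤ ∑ i, f j (w i)) := by
    intro w
    by_cases h : ∀ j, n * (∑ ω, p ω * f j ω - δ) ≤ ∑ i, f j (w i)
    · rw [ind_true h]
      linarith [Finset.sum_nonneg fun (j : ι) (_ : j ∈ Finset.univ) =>
        ind_nonneg (∑ i, f j (w i) < n * (∑ ω, p ω * f j ω - δ))]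
    · rw [ind_false h]
      push Not at h
      obtain ⟨j, hj⟩ := h
      have := Finset.single_le_sum (f := fun j : ι =>
        ind (∑ i, f j (w i) < n * (∑ ω, p ω * f j ω - δ))) (fun _ _ => ind_nonneg _)
        (Finset.mem_univ j)
      simp only [ind_true hj] at this
      linarith
  refine le_trans ?_ (Finset.sum_le_sum fun w _ =>
    mul_le_mul_of_nonneg_left (hpt w) ((iidPmf_mem hp n).1 w))
  have h0 : ∀ X : ι → (Fin n → Ω) → ℝ, ∑ w, iidPmf p n w * (1 - ∑ j, X j w) =
      1 - ∑ j, ∑ w, iidPmf p n w * X j w := by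
    intro X
    simp_rw [mul_sub, mul_one, Finset.sum_sub_distrib, (iidPmf_mem hp n).2, Finset.mul_sum]
    rw [Finset.sum_comm]
  rw [h0]
  have h1 := Finset.sum_le_sum fun (j : ι) (_ : j ∈ Finset.univ) => hn j
  rw [Finset.sum_const, nsmul_eq_mul, Finset.card_univ] at h1
  have h2 : Fintype.card ι * (η / (Fintype.card ι + 1)) ≤ η := by
    rw [← mul_div_assoc, div_le_iff₀ (by positivity)]
    nlinarith
  linarith

end LawOfLargeNumbers

/-! ### Memoryless channels and deterministic time sharing. -/

section BlockChannels

variable {K : ℕ} {𝒳 𝒴₀ ι : Type*} {𝒴 𝒰 : Fin K → Type*}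

/-- The memoryless channels with the given letter channels. -/
def blockChannel {n : ℕ} (V : Fin n → ∀ k, 𝒴 k → 𝒰 k → ℝ) (k : Fin K) (y : Fin n → 𝒴 k)
    (u : Fin n → 𝒰 k) : ℝ := ∏ i, V i k (y i) (u i)

/-- A sequence of outcomes as an outcome of sequences. -/
def outcomeEquiv (𝒳 𝒴₀ : Type*) (𝒴 𝒰 : Fin K → Type*) (n : ℕ) :
    (Fin n → Letter 𝒳 𝒴₀ 𝒴 × (∀ k, 𝒰 k)) ≃
      Letter (Fin n → 𝒳) (Fin n → 𝒴₀) (fun k => Fin n → 𝒴 k) × (∀ k, Fin n → 𝒰 k) where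
  toFun w := ((fun i => (w i).1.1, fun i => (w i).1.2.1, fun k i => (w i).1.2.2 k),
    fun k i => (w i).2 k)
  invFun b := fun i => ((b.1.1 i, b.1.2.1 i, fun k => b.1.2.2 k i), fun k => b.2 k i)
  left_inv _ := rfl
  right_inv _ := rfl

variable [Fintype 𝒳] [Fintype 𝒴₀] [Fintype ι] [∀ k, Fintype (𝒴 k)] [∀ k, Fintype (𝒰 k)]
variable {p₀ : 𝒳 × 𝒴₀ → ℝ} {κ : ∀ k, 𝒳 × 𝒴₀ → 𝒴 k → ℝ}

lemma isChannel_blockChannel {n : ℕ} {V : Fin n → ∀ k, 𝒴 k → 𝒰 k → ℝ}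
    (hV : ∀ i, IsChannel (V i)) : IsChannel (blockChannel V) := fun k y =>
  prod_mem_stdSimplex fun i => hV i k (y i)

lemma channelJoint_block {n : ℕ} (V : Fin n → ∀ k, 𝒴 k → 𝒰 k → ℝ)
    (w : Fin n → Letter 𝒳 𝒴₀ 𝒴 × (∀ k, 𝒰 k)) :
    channelJoint (source (blockBase p₀ n) (blockKernel κ n)) (blockChannel V)
      (outcomeEquiv 𝒳 𝒴₀ 𝒴 𝒰 n w) = ∏ i, channelJoint (source p₀ κ) (V i) (w i) := by
  simp only [channelJoint, source, blockBase, blockKernel, blockChannel, outcomeEquiv,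
    Equiv.coe_fn_mk, Finset.prod_mul_distrib]
  congr 1
  · congr 1
    rw [Finset.prod_comm]
  · rw [Finset.prod_comm]

lemma outputKernel_block {n : ℕ} (V : Fin n → ∀ k, 𝒴 k → 𝒰 k → ℝ) (k : Fin K)
    (z : (Fin n → 𝒳) × (Fin n → 𝒴₀)) (u : Fin n → 𝒰 k) :
    outputKernel (blockKernel κ n) (blockChannel V) k z u =
      ∏ i, outputKernel κ (V i) k (z.1 i, z.2 i) (u i) := by
  simp only [outputKernel, blockKernel, blockChannel]
  rw [← sum_pi_prod (fun i y => κ k (z.1 i, z.2 i) y * V i k y (u i))]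
  exact Finset.sum_congr rfl fun y _ => Finset.prod_mul_distrib.symm

lemma outputMarginal_block {n : ℕ} (V : Fin n → ∀ k, 𝒴 k → 𝒰 k → ℝ) (T : Finset (Fin K))
    (u : ∀ k, Fin n → 𝒰 k) (y₀ : Fin n → 𝒴₀) :
    outputMarginal (blockBase p₀ n) (blockKernel κ n) (blockChannel V) T u y₀ =
      ∏ i, outputMarginal p₀ κ (V i) T (fun k => u k i) (y₀ i) := by
  simp only [outputMarginal, blockBase, outputKernel_block]
  rw [← sum_pi_prod (fun i x => p₀ (x, y₀ i) *
    ∏ k ∈ T, outputKernel κ (V i) k (x, y₀ i) (u k i))]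
  refine Finset.sum_congr rfl fun x _ => ?_
  rw [Finset.prod_mul_distrib]
  congr 1
  rw [Finset.prod_comm]

/-- The joint law of the time-sharing variable and the outcome. -/
def mixtureJoint (p₀ : 𝒳 × 𝒴₀ → ℝ) (κ : ∀ k, 𝒳 × 𝒴₀ → 𝒴 k → ℝ) (pQ : ι → ℝ)
    (V : ι → ∀ k, 𝒴 k → 𝒰 k → ℝ) (s : ι × (Letter 𝒳 𝒴₀ 𝒴 × (∀ k, 𝒰 k))) : ℝ :=
  pQ s.1 * channelJoint (source p₀ κ) (V s.1) s.2

variable {pQ : ι → ℝ} {V : ι → ∀ k, 𝒴 k → 𝒰 k → ℝ}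

lemma mixtureJoint_mem (hs : IsSource p₀ κ) (hpQ : pQ ∈ stdSimplex ℝ ι)
    (hV : ∀ q, IsChannel (V q)) : mixtureJoint p₀ κ pQ V ∈
      stdSimplex ℝ (ι × (Letter 𝒳 𝒴₀ 𝒴 × (∀ k, 𝒰 k))) := by
  refine ⟨fun s => mul_nonneg (hpQ.1 _) (channelJoint_nonneg hs (hV _) _), ?_⟩
  rw [Fintype.sum_prod_type]
  simp only [mixtureJoint, ← Finset.mul_sum, sum_channelJoint hs (hV _), mul_one, hpQ.2]

/-- A likely event under the mixture is likely for some time-sharing sequence. -/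
lemma exists_timeSharing (hs : IsSource p₀ κ) (hpQ : pQ ∈ stdSimplex ℝ ι)
    (hV : ∀ q, IsChannel (V q)) {n : ℕ}
    {Typ : (Fin n → ι × (Letter 𝒳 𝒴₀ 𝒴 × (∀ k, 𝒰 k))) → Prop}
    {Good : (Fin n → ι) →
      Letter (Fin n → 𝒳) (Fin n → 𝒴₀) (fun k => Fin n → 𝒴 k) × (∀ k, Fin n → 𝒰 k) → Prop}
    (hgood : ∀ w, (∀ i, mixtureJoint p₀ κ pQ V (w i) ≠ 0) → Typ w →
      Good (fun i => (w i).1) (outcomeEquiv 𝒳 𝒴₀ 𝒴 𝒰 n fun i => (w i).2))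
    {v : ℝ} (hv : v ≤ ∑ w, iidPmf (mixtureJoint p₀ κ pQ V) n w * ind (Typ w)) :
    ∃ q : Fin n → ι, v ≤ ∑ ω,
      channelJoint (source (blockBase p₀ n) (blockKernel κ n)) (blockChannel fun i => V (q i)) ω *
        ind (Good q ω) := by
  -- The probability is an average over i.i.d. time-sharing sequences, so one fixed sequence does at
  -- least as well and can be shared by all parties.
  refine exists_le_of_le_sum_mul (prod_mem_stdSimplex fun _ : Fin n => hpQ) (hv.trans ?_)
  calc _ ≤ ∑ w, iidPmf (mixtureJoint p₀ κ pQ V) n w *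
        ind (Good (fun i => (w i).1) (outcomeEquiv 𝒳 𝒴₀ 𝒴 𝒰 n fun i => (w i).2)) := by
        refine Finset.sum_le_sum fun w _ => ?_
        by_cases h : ∀ i, mixtureJoint p₀ κ pQ V (w i) ≠ 0
        · exact mul_le_mul_of_nonneg_left (ind_mono (hgood w h))
            ((iidPmf_mem (mixtureJoint_mem hs hpQ hV) n).1 w)
        · push Not at h
          obtain ⟨i, hi⟩ := h
          have : iidPmf (mixtureJoint p₀ κ pQ V) n w = 0 :=
            Finset.prod_eq_zero (Finset.mem_univ i) hi
          rw [this, zero_mul, zero_mul]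
    _ = _ := by
        rw [← (Equiv.arrowProdEquivProdArrow (Fin n) (fun _ => ι)
          (fun _ => Letter 𝒳 𝒴₀ 𝒴 × (∀ k, 𝒰 k))).symm.sum_comp, Fintype.sum_prod_type]
        refine Finset.sum_congr rfl fun q _ => ?_
        rw [← (outcomeEquiv 𝒳 𝒴₀ 𝒴 𝒰 n).sum_comp, Finset.mul_sum]
        refine Finset.sum_congr rfl fun w _ => ?_
        rw [channelJoint_block, ← mul_assoc, ← Finset.prod_mul_distrib]
        rfl

end BlockChannels

end

end DistHT

namespace DistHT

noncomputable section

set_option linter.unusedSectionVars false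

/-! ### The densities used by the test. -/

section Densities

variable {K : ℕ} {𝒳 𝒴₀ : Type*} {𝒴 𝒰 : Fin K → Type*}
variable [Fintype 𝒳] [Fintype 𝒴₀] [∀ k, Fintype (𝒴 k)] [∀ k, Fintype (𝒰 k)]
variable {p₀ : 𝒳 × 𝒴₀ → ℝ} {κ : ∀ k, 𝒳 × 𝒴₀ → 𝒴 k → ℝ} {W : ∀ k, 𝒴 k → 𝒰 k → ℝ}

/-- The logarithm of the inverse likelihood of `U_{Sᶜ}` given `Y₀`, relative to the likelihood of
all of `U` given `(X, Y₀)`. -/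
def testDensity (p₀ : 𝒳 × 𝒴₀ → ℝ) (κ : ∀ k, 𝒳 × 𝒴₀ → 𝒴 k → ℝ) (W : ∀ k, 𝒴 k → 𝒰 k → ℝ)
    (S : Finset (Fin K)) (ω : Letter 𝒳 𝒴₀ 𝒴 × (∀ k, 𝒰 k)) : ℝ :=
  Real.log ((∏ k, outputKernel κ W k (ω.1.1, ω.1.2.1) (ω.2 k)) *
      outputMarginal p₀ κ W ∅ ω.2 ω.1.2.1 / outputMarginal p₀ κ W Sᶜ ω.2 ω.1.2.1)

/-- The output kernels of S move from the excess rates into the first term. That term depends only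
on (u, x, y₀), which the detector can evaluate; the remainder is ∑_{k∈S} H(U_k|Y_k) and concerns
single encoders. -/
lemma tradeoff_eq_testDensity (hs : IsSource p₀ κ) (hW : IsChannel W) (S : Finset (Fin K)) :
    tradeoff (source p₀ κ) W S =
      ∑ ω, channelJoint (source p₀ κ) W ω * testDensity p₀ κ W S ω -
        ∑ k ∈ S, ∑ ω, channelJoint (source p₀ κ) W ω * Real.log (W k (ω.1.2.2 k) (ω.2 k)) := by
  rw [tradeoff_eq_sum hs hW, Finset.sum_comm, ← Finset.sum_sub_distrib]
  refine Finset.sum_congr rfl fun ω _ => ?_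
  rw [← Finset.mul_sum, ← mul_sub]
  by_cases h0 : channelJoint (source p₀ κ) W ω = 0
  · rw [h0, zero_mul, zero_mul]
  obtain ⟨-, -, hWp, hV, hG⟩ := factors_pos hs hW h0
  congr 1
  rw [tradeoffDensity, testDensity, mul_div_assoc, mul_div_assoc,
    Real.log_mul (Finset.prod_pos fun k _ => hV k).ne' (div_pos (hG _) (hG _)).ne',
    Real.log_mul (Finset.prod_pos fun k _ => hV k).ne' (div_pos (hG _) (hG _)).ne',
    Real.log_prod fun k _ => (hV k).ne', Real.log_prod fun k _ => (hV k).ne',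
    Finset.sum_congr rfl fun k _ => Real.log_div (hWp k).ne' (hV k).ne', Finset.sum_sub_distrib,
    ← Finset.sum_add_sum_compl S]
  ring

lemma sum_channelJoint_single (hs : IsSource p₀ κ) (hW : IsChannel W) (k : Fin K)
    (F : 𝒴 k → 𝒰 k → ℝ) :
    ∑ ω, channelJoint (source p₀ κ) W ω * F (ω.1.2.2 k) (ω.2 k) =
      ∑ z, p₀ z * ∑ y, ∑ u, κ k z y * W k y u * F y u := by
  have h := sum_channelJoint_mul p₀ κ W (fun _ => 1)
    (Function.update (fun _ _ _ => (1 : ℝ)) k F)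
  simp only [mul_one, one_mul] at h
  refine Eq.trans (Finset.sum_congr rfl fun ω _ => ?_) (h.trans
    (Finset.sum_congr rfl fun z _ => ?_))
  · rw [Finset.prod_eq_single k (fun k' _ hk' => by simp [hk']) (by simp)]
    simp
  · rw [Finset.prod_eq_single k (fun k' _ hk' => by simp [hk', sum_local_none hs hW k' z])
      (by simp)]
    simp

/-- The conditional entropy of an output is at most the logarithm of the alphabet size. -/
lemma neg_sum_log_channel_le (hs : IsSource p₀ κ) (hW : IsChannel W) (k : Fin K)
    (hN : 0 < Fintype.card (𝒰 k)) :
    0 ≤ Real.log (Fintype.card (𝒰 k)) +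
      ∑ ω, channelJoint (source p₀ κ) W ω * Real.log (W k (ω.1.2.2 k) (ω.2 k)) := by
  set N := (Fintype.card (𝒰 k) : ℝ)
  have hN' : (0 : ℝ) < N := Nat.cast_pos.2 hN
  have h1 : Real.log N + ∑ ω, channelJoint (source p₀ κ) W ω *
      Real.log (W k (ω.1.2.2 k) (ω.2 k)) = ∑ ω, channelJoint (source p₀ κ) W ω *
      (Real.log N + Real.log (W k (ω.1.2.2 k) (ω.2 k))) := by
    simp_rw [mul_add, Finset.sum_add_distrib, ← Finset.sum_mul, sum_channelJoint hs hW, one_mul]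
  rw [h1, sum_channelJoint_single hs hW k (fun y u => Real.log N + Real.log (W k y u))]
  refine Finset.sum_nonneg fun z _ => mul_nonneg (hs.base_mem.1 z)
    (Finset.sum_nonneg fun y _ => ?_)
  simp_rw [mul_assoc, ← Finset.mul_sum]
  refine mul_nonneg ((hs.kernel_mem k z).1 y) ?_
  have h2 : ∑ u, (W k y u - 1 / N) = 0 := by
    rw [Finset.sum_sub_distrib, (hW k y).2, Finset.sum_const, Finset.card_univ, nsmul_eq_mul]
    simp only [N] at hN' ⊢
    field_simp
    ring
  rw [← h2]
  refine Finset.sum_le_sum fun u _ => ?_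
  rcases (((hW k y).1 u).eq_or_lt) with h | h
  · rw [← h, zero_mul, zero_sub]
    exact neg_nonpos.2 (by positivity)
  · rw [← Real.log_mul hN'.ne' h.ne']
    have := Real.one_sub_inv_le_log_of_pos (mul_pos hN' h)
    calc W k y u - 1 / N = W k y u * (1 - (N * W k y u)⁻¹) := by field_simp
      _ ≤ _ := mul_le_mul_of_nonneg_left this h.le

end Densities

/-! ### Bin sizes and exponents. -/

section Parameters

/-- An index set can be divided evenly into bins. -/
lemma exists_bin (L : ℕ) {M : ℕ} (hM : 0 < M) :
    ∃ bin : Fin L → Fin M, ∀ j, ∑ j', ind (j' ≠ j ∧ bin j' = bin j) ≤ (L / M : ℝ) := by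
  classical
  rcases Nat.eq_zero_or_pos L with rfl | hL
  · exact ⟨fun j => j.elim0, fun j => j.elim0⟩
  -- The ceiling of L/M. Bins are runs of B consecutive indices, and excluding the index itself
  -- leaves at most B - 1 ≤ L/M others.
  set B := (L + M - 1) / M with hB
  have hB1 : B * M ≤ L + M - 1 := Nat.div_mul_le_self _ _
  have hB2 : L ≤ M * B := by
    have := Nat.lt_div_mul_add (a := L + M - 1) hM
    rw [← hB, mul_comm B M] at this
    omega
  have hB0 : 0 < B := by
    rcases Nat.eq_zero_or_pos B with h | h
    · rw [h] at hB2; omega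
    · exact h
  refine ⟨fun j => ⟨j / B, Nat.div_lt_of_lt_mul (by rw [mul_comm]; exact j.2.trans_le hB2)⟩,
    fun j => ?_⟩
  set s : Finset (Fin L) := Finset.univ.filter fun j' => (j' : ℕ) / B = j / B with hsdef
  have hs : s.card ≤ B := by
    have := Finset.card_le_card_of_injOn (s := s) (t := Finset.range B) (fun j' => (j' : ℕ) % B)
      (fun j' _ => by simpa using Nat.mod_lt _ hB0) (fun a ha b hb hab => by
        simp only [hsdef, Finset.coe_filter, Finset.mem_univ, true_and] at ha hb
        apply Fin.ext
        rw [← Nat.div_add_mod (a : ℕ) B, ← Nat.div_add_mod (b : ℕ) B, ha.trans hb.symm]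
        exact congrArg _ hab)
    simpa using this
  have hcard : ∑ j' : Fin L, ind (j' ≠ j ∧ (⟨j' / B, Nat.div_lt_of_lt_mul (by
      rw [mul_comm]; exact j'.2.trans_le hB2)⟩ : Fin M) = ⟨j / B, Nat.div_lt_of_lt_mul (by
      rw [mul_comm]; exact j.2.trans_le hB2)⟩) = ((s.erase j).card : ℝ) := by
    rw [Finset.card_eq_sum_ones, Nat.cast_sum, ← Finset.sum_subset (Finset.subset_univ (s.erase j))]
    · refine Finset.sum_congr rfl fun j' hj' => ?_
      rw [Finset.mem_erase, hsdef, Finset.mem_filter] at hj'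
      rw [ind_true ⟨hj'.1, Fin.ext hj'.2.2⟩, Nat.cast_one]
    · intro j' _ hj'
      apply ind_false
      rintro ⟨h1, h2⟩
      exact hj' (Finset.mem_erase.2 ⟨h1, by simpa [hsdef] using h2⟩)
  rw [hcard, Finset.card_erase_of_mem (by simp [hsdef])]
  rw [le_div_iff₀ (by exact_mod_cast hM)]
  have h3 : (s.card - 1) * M ≤ L := by
    calc (s.card - 1) * M ≤ (B - 1) * M := Nat.mul_le_mul_right _ (by omega)
      _ = B * M - M := by rw [Nat.sub_mul, one_mul]
      _ ≤ L := by omega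
  exact_mod_cast h3

lemma ceil_exp_le {x : ℝ} (hx : 0 ≤ x) : (⌈Real.exp x⌉₊ : ℝ) ≤ 2 * Real.exp x := by
  have := (Nat.ceil_lt_add_one (Real.exp_pos x).le).le
  linarith [Real.one_le_exp hx]

/-- Some codeword is accepted with high probability once the codebook is larger than c by a factor
x. -/
lemma one_sub_exp_le {c x : ℝ} (hc : 1 ≤ c) {L : ℕ} (hL : x * c ≤ L) :
    1 - Real.exp (-x) ≤ 1 - (1 - 1 / c) ^ L := by
  have hc0 : 0 < c := by linarith
  have h1 : 0 ≤ 1 - 1 / c := by rw [sub_nonneg, div_le_one hc0]; exact hc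
  have h2 : (1 - 1 / c) ^ L ≤ Real.exp (-x) := by
    calc (1 - 1 / c) ^ L ≤ Real.exp (-(1 / c)) ^ L := pow_le_pow_left₀ h1
          (by linarith [Real.add_one_le_exp (-(1 / c))]) L
      _ = Real.exp (L * -(1 / c)) := by rw [← Real.exp_nat_mul]
      _ ≤ _ := by
          rw [Real.exp_le_exp, mul_neg, neg_le_neg_iff, mul_one_div, le_div_iff₀ hc0]
          exact hL
  linarith

/-- The exponents of the test for the chosen rates. -/
lemma test_bound {K : ℕ} {S : Finset (Fin K)} {n E δ m X Y : ℝ} {a b H R : Fin K → ℝ} (hn : 0 ≤ n)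
    (hδ : 0 ≤ δ) (hY : 0 ≤ Y) (ha0 : ∀ k, 0 ≤ a k) (ha : ∀ k, a k ≤ 2 * Real.exp (n * δ))
    (hb0 : ∀ k, 0 ≤ b k) (hb : ∀ k, b k ≤ 2 * Real.exp (n * (2 * δ - H k - R k)))
    (hX0 : 0 ≤ X) (hX : X ≤ Real.exp (-(n * (m - δ))) * Y)
    (hE : E ≤ m + ∑ k ∈ S, H k + ∑ k ∈ S, R k) :
    (∏ k, a k) * (∏ k ∈ S, b k) * X ≤
      4 ^ K * Real.exp (-(n * (E - (3 * K + 1) * δ))) * Y := by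
  have hcard : (S.card : ℝ) ≤ K := by
    exact_mod_cast (Finset.card_le_univ S).trans_eq (Fintype.card_fin K)
  have h1 : ∏ k, a k ≤ 2 ^ K * Real.exp (n * (K * δ)) := by
    calc ∏ k, a k ≤ ∏ _k : Fin K, 2 * Real.exp (n * δ) :=
          Finset.prod_le_prod (fun k _ => ha0 k) fun k _ => ha k
      _ = _ := by
          rw [Finset.prod_const, Finset.card_univ, Fintype.card_fin, mul_pow, ← Real.exp_nat_mul]
          congr 2
          ring
  have h2 : ∏ k ∈ S, b k ≤ 2 ^ K *
      Real.exp (n * (2 * K * δ - ∑ k ∈ S, H k - ∑ k ∈ S, R k)) := by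
    calc ∏ k ∈ S, b k ≤ ∏ k ∈ S, 2 * Real.exp (n * (2 * δ - H k - R k)) :=
          Finset.prod_le_prod (fun k _ => hb0 k) fun k _ => hb k
      _ = 2 ^ S.card * Real.exp (n * (2 * S.card * δ - ∑ k ∈ S, H k - ∑ k ∈ S, R k)) := by
          rw [Finset.prod_mul_distrib, Finset.prod_const, ← Real.exp_sum, ← Finset.mul_sum,
            Finset.sum_sub_distrib, Finset.sum_sub_distrib, Finset.sum_const, nsmul_eq_mul]
          congr 4
          ring
      _ ≤ _ := by
          have : (2 : ℝ) ^ S.card ≤ 2 ^ K :=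
            pow_le_pow_right₀ one_le_two (by exact_mod_cast hcard)
          gcongr
  -- The slack adds up to (3K + 1) δ: Kδ from the factors a, at most 2Kδ from the factors b, and δ
  -- from X.
  calc _ ≤ (2 ^ K * Real.exp (n * (K * δ))) * (2 ^ K *
        Real.exp (n * (2 * K * δ - ∑ k ∈ S, H k - ∑ k ∈ S, R k))) *
        (Real.exp (-(n * (m - δ))) * Y) := by
        have h3 : 0 ≤ ∏ k ∈ S, b k := Finset.prod_nonneg fun k _ => hb0 k
        gcongr
    _ = 4 ^ K * Real.exp (n * (K * δ) + n * (2 * K * δ - ∑ k ∈ S, H k - ∑ k ∈ S, R k) +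
        -(n * (m - δ))) * Y := by
        rw [Real.exp_add, Real.exp_add, show (4 : ℝ) = 2 * 2 by norm_num, mul_pow]
        ring
    _ ≤ _ := by
        gcongr
        nlinarith [mul_le_mul_of_nonneg_left hE hn]

end Parameters

end

end DistHT

namespace DistHT

noncomputable section

set_option linter.unusedSectionVars false

/-! ### Achievability of the single-letter region. -/

section Achievability

variable {K : ℕ} {𝒳 𝒴₀ ι : Type*} {𝒴 𝒰 : Fin K → Type*}
variable [Fintype 𝒳] [Fintype 𝒴₀] [Fintype ι] [∀ k, Fintype (𝒴 k)] [∀ k, Fintype (𝒰 k)]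
variable {p₀ : 𝒳 × 𝒴₀ → ℝ} {κ : ∀ k, 𝒳 × 𝒴₀ → 𝒴 k → ℝ}
variable {pQ : ι → ℝ} {V : ι → ∀ k, 𝒴 k → 𝒰 k → ℝ}

/-- The densities whose sample means have to be typical. -/
def mixtureDensity (p₀ : 𝒳 × 𝒴₀ → ℝ) (κ : ∀ k, 𝒳 × 𝒴₀ → 𝒴 k → ℝ)
    (V : ι → ∀ k, 𝒴 k → 𝒰 k → ℝ) :
    Finset (Fin K) ⊕ Fin K → ι × (Letter 𝒳 𝒴₀ 𝒴 × (∀ k, 𝒰 k)) → ℝ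
  | .inl S, s => testDensity p₀ κ (V s.1) S s.2
  | .inr k, s => -Real.log (V s.1 k (s.2.1.2.2 k) (s.2.2 k))

/-- The expectations of these densities. -/
def mixtureMean (p₀ : 𝒳 × 𝒴₀ → ℝ) (κ : ∀ k, 𝒳 × 𝒴₀ → 𝒴 k → ℝ) (pQ : ι → ℝ)
    (V : ι → ∀ k, 𝒴 k → 𝒰 k → ℝ) (j : Finset (Fin K) ⊕ Fin K) : ℝ :=
  ∑ s, mixtureJoint p₀ κ pQ V s * mixtureDensity p₀ κ V j s

lemma mixtureMean_eq (j : Finset (Fin K) ⊕ Fin K) : mixtureMean p₀ κ pQ V j =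
    ∑ q, pQ q * ∑ ω, channelJoint (source p₀ κ) (V q) ω * mixtureDensity p₀ κ V j (q, ω) := by
  rw [mixtureMean, Fintype.sum_prod_type]
  simp only [mixtureJoint, mul_assoc, ← Finset.mul_sum]

lemma mixtureMean_add (hs : IsSource p₀ κ) (hV : ∀ q, IsChannel (V q)) (S : Finset (Fin K)) :
    mixtureMean p₀ κ pQ V (.inl S) + ∑ k ∈ S, mixtureMean p₀ κ pQ V (.inr k) =
      ∑ q, pQ q * tradeoff (source p₀ κ) (V q) S := by
  simp_rw [mixtureMean_eq, tradeoff_eq_testDensity hs (hV _), mul_sub, Finset.sum_sub_distrib]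
  rw [sub_eq_add_neg]
  congr 1
  rw [Finset.sum_comm, ← Finset.sum_neg_distrib]
  refine Finset.sum_congr rfl fun q _ => ?_
  simp only [mixtureDensity, mul_neg, Finset.sum_neg_distrib, Finset.mul_sum]

lemma mixtureMean_inr_le (hs : IsSource p₀ κ) (hpQ : pQ ∈ stdSimplex ℝ ι)
    (hV : ∀ q, IsChannel (V q)) (k : Fin K) (hN : 0 < Fintype.card (𝒰 k)) :
    mixtureMean p₀ κ pQ V (.inr k) ≤ Real.log (Fintype.card (𝒰 k)) := by
  rw [mixtureMean_eq]
  calc _ ≤ ∑ q, pQ q * Real.log (Fintype.card (𝒰 k)) := by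
        refine Finset.sum_le_sum fun q _ => mul_le_mul_of_nonneg_left ?_ (hpQ.1 q)
        have := neg_sum_log_channel_le hs (hV q) k hN
        simp only [mixtureDensity, mul_neg, Finset.sum_neg_distrib]
        linarith
    _ = _ := by rw [← Finset.sum_mul, hpQ.2, one_mul]

lemma exp_neg_testDensity_mul {W : ∀ k, 𝒴 k → 𝒰 k → ℝ} (hs : IsSource p₀ κ) (hW : IsChannel W)
    {ω : Letter 𝒳 𝒴₀ 𝒴 × (∀ k, 𝒰 k)} (h0 : channelJoint (source p₀ κ) W ω ≠ 0)
    (S : Finset (Fin K)) :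
    Real.exp (-testDensity p₀ κ W S ω) * ∏ k, outputKernel κ W k (ω.1.1, ω.1.2.1) (ω.2 k) =
      outputMarginal p₀ κ W Sᶜ ω.2 ω.1.2.1 / outputMarginal p₀ κ W ∅ ω.2 ω.1.2.1 := by
  obtain ⟨-, -, -, hV, hG⟩ := factors_pos hs hW h0
  have hVp : 0 < ∏ k, outputKernel κ W k (ω.1.1, ω.1.2.1) (ω.2 k) :=
    Finset.prod_pos fun k _ => hV k
  have h1 := hG ∅
  have h2 := hG Sᶜ
  rw [testDensity, Real.exp_neg, Real.exp_log (by positivity)]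
  field_simp

/-- Block codes for a time-sharing mixture of test channels. -/
lemma exists_block_code (hs : IsSource p₀ κ) (hpQ : pQ ∈ stdSimplex ℝ ι)
    (hV : ∀ q, IsChannel (V q)) (hN : ∀ k, 0 < Fintype.card (𝒰 k)) {R : Fin K → ℝ} {E : ℝ}
    (hE : ∀ S, E ≤ ∑ q, pQ q * tradeoff (source p₀ κ) (V q) S + ∑ k ∈ S, R k)
    {n : ℕ} {δ η : ℝ} (hδ : 0 ≤ δ) (hη : 0 < η) (hη1 : η ≤ 1)
    (htyp : 1 - η ≤ ∑ w, iidPmf (mixtureJoint p₀ κ pQ V) n w *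
      ind (∀ j, n * (mixtureMean p₀ κ pQ V j - δ) ≤ ∑ i, mixtureDensity p₀ κ V j (w i)))
    (hθ : 1 - η ≤ (1 - Real.exp (-(n * δ))) ^ K) :
    ∃ (φ : ∀ k, (Fin n → 𝒴 k) → Fin (⌈Real.exp (n * R k)⌉₊ + 1))
      (A : Set ((∀ k, Fin (⌈Real.exp (n * R k)⌉₊ + 1)) × (Fin n → 𝒳) × (Fin n → 𝒴₀))),
      1 - 3 * η ≤ ∑ w, source (blockBase p₀ n) (blockKernel κ n) w *
        ind ((fun k => φ k (w.2.2 k), w.1, w.2.1) ∈ A) ∧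
      ∑ w, altSource (blockBase p₀ n) (blockKernel κ n) w *
        ind ((fun k => φ k (w.2.2 k), w.1, w.2.1) ∈ A) ≤
        3 * (2 ^ K * (4 ^ K * Real.exp (-(n * (E - (3 * K + 1) * δ))))) := by
  have hn : (0 : ℝ) ≤ n := Nat.cast_nonneg n
  set N : Fin K → ℝ := fun k => (Fintype.card (𝒰 k) : ℝ) with hNdef
  have hN0 : ∀ k, 0 < N k := fun k => Nat.cast_pos.2 (hN k)
  set H : Fin K → ℝ := fun k => mixtureMean p₀ κ pQ V (.inr k) with hH
  -- Codewords are uniform on the output sequences, and D is the divergence rate of the test channel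
  -- from uniform. The threshold e^{n(D+δ)} covers typical sequences, and e^{n(D+2δ)} codewords
  -- suffice for a hit. The term log N cancels against the codeword probability in the bins.
  set D : Fin K → ℝ := fun k => Real.log (N k) - H k with hD
  have hD0 : ∀ k, 0 ≤ D k := fun k => sub_nonneg.2 (mixtureMean_inr_le hs hpQ hV k (hN k))
  set c : Fin K → ℝ := fun k => Real.exp (n * (D k + δ)) with hcdef
  have hc : ∀ k, 1 ≤ c k := fun k =>
    Real.one_le_exp (mul_nonneg hn (by linarith [hD0 k]))
  set L : Fin K → ℕ := fun k => ⌈Real.exp (n * (D k + 2 * δ))⌉₊ with hLdef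
  have hL2 : ∀ k, (L k : ℝ) ≤ 2 * Real.exp (n * (D k + 2 * δ)) := fun k =>
    ceil_exp_le (mul_nonneg hn (by linarith [hD0 k]))
  set M : Fin K → ℕ := fun k => ⌈Real.exp (n * R k)⌉₊ with hMdef
  have hMe : ∀ k, Real.exp (n * R k) ≤ M k := fun k => Nat.le_ceil _
  have hM0 : ∀ k, 0 < M k := fun k => Nat.ceil_pos.2 (Real.exp_pos _)
  set r : ∀ k, (Fin n → 𝒰 k) → ℝ := fun k _ => Real.exp (-(n * Real.log (N k))) with hrdef
  have hr : ∀ k, r k ∈ stdSimplex ℝ (Fin n → 𝒰 k) := by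
    intro k
    refine ⟨fun _ => (Real.exp_pos _).le, ?_⟩
    rw [hrdef, Finset.sum_const, Finset.card_univ, Fintype.card_fun, Fintype.card_fin,
      nsmul_eq_mul, Real.exp_neg, Real.exp_nat_mul, Real.exp_log (hN0 k), Nat.cast_pow]
    exact mul_inv_cancel₀ (pow_pos (hN0 k) n).ne'
  set τ := 4 ^ K * Real.exp (-(n * (E - (3 * K + 1) * δ))) with hτdef
  have hτ : 0 < τ := by positivity
  choose bin hbin using fun k => exists_bin (L k) (hM0 k)
  -- The test is defined to be exactly the requirement of `exists_code`; what needs proof is that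
  -- typical outcomes pass it.
  set T : (Fin n → ι) → (∀ k, Fin n → 𝒰 k) → (Fin n → 𝒳) × (Fin n → 𝒴₀) → Prop := fun q u z =>
    ∀ S : Finset (Fin K), (∏ k, (L k / c k : ℝ)) * (∏ k ∈ S, (L k / M k : ℝ) * r k (u k)) *
      (outputMarginal (blockBase p₀ n) (blockKernel κ n) (blockChannel fun i => V (q i)) Sᶜ u z.2 /
        outputMarginal (blockBase p₀ n) (blockKernel κ n) (blockChannel fun i => V (q i)) ∅ u z.2) ≤
      τ * ∏ k, outputKernel (blockKernel κ n) (blockChannel fun i => V (q i)) k z (u k) with hT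
  let Good : (Fin n → ι) → Letter (Fin n → 𝒳) (Fin n → 𝒴₀) (fun k => Fin n → 𝒴 k) ×
      (∀ k, Fin n → 𝒰 k) → Prop := fun q ω => T q ω.2 (ω.1.1, ω.1.2.1) ∧
    ∀ k, blockChannel (fun i => V (q i)) k (ω.1.2.2 k) (ω.2 k) ≤ c k * r k (ω.2 k)
  have hgood : ∀ w : Fin n → ι × (Letter 𝒳 𝒴₀ 𝒴 × (∀ k, 𝒰 k)),
      (∀ i, mixtureJoint p₀ κ pQ V (w i) ≠ 0) →
      (∀ j, n * (mixtureMean p₀ κ pQ V j - δ) ≤ ∑ i, mixtureDensity p₀ κ V j (w i)) →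
      Good (fun i => (w i).1) (outcomeEquiv 𝒳 𝒴₀ 𝒴 𝒰 n fun i => (w i).2) := by
    intro w hw hty
    have hcj : ∀ i, channelJoint (source p₀ κ) (V (w i).1) (w i).2 ≠ 0 := fun i =>
      right_ne_zero_of_mul (hw i)
    refine ⟨fun S => ?_, fun k => ?_⟩
    · refine test_bound (H := H) (R := R) (m := mixtureMean p₀ κ pQ V (.inl S)) hn hδ ?_
        (fun k => ?_) (fun k => ?_) (fun k => ?_) (fun k => ?_) ?_ ?_ ?_
      · exact Finset.prod_nonneg fun k _ => Finset.sum_nonneg fun y _ => mul_nonneg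
          (((hs.block n).kernel_mem k _).1 y)
          ((isChannel_blockChannel (fun i => hV (w i).1) k y).1 _)
      · exact div_nonneg (Nat.cast_nonneg _) (zero_le_one.trans (hc k))
      · rw [div_le_iff₀ (zero_lt_one.trans_le (hc k))]
        refine (hL2 k).trans_eq ?_
        rw [hcdef, mul_assoc, ← Real.exp_add]
        congr 2
        ring
      · exact mul_nonneg (div_nonneg (Nat.cast_nonneg _) (Nat.cast_nonneg _)) (Real.exp_pos _).le
      · calc (L k / M k : ℝ) * Real.exp (-(n * Real.log (N k)))
            ≤ 2 * Real.exp (n * (D k + 2 * δ)) / Real.exp (n * R k) *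
              Real.exp (-(n * Real.log (N k))) := by
              gcongr
              · exact hL2 k
              · exact hMe k
          _ = _ := by
              rw [mul_div_assoc, ← Real.exp_sub, mul_assoc, ← Real.exp_add]
              congr 2
              simp only [hD]
              ring
      · rw [outputMarginal_block, outputMarginal_block]
        exact div_nonneg (Finset.prod_nonneg fun i _ =>
            ((factors_pos hs (hV _) (hcj i)).2.2.2.2 _).le)
          (Finset.prod_nonneg fun i _ => ((factors_pos hs (hV _) (hcj i)).2.2.2.2 _).le)
      · have h1 : outputMarginal (blockBase p₀ n) (blockKernel κ n)
              (blockChannel fun i => V (w i).1) Sᶜ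
              (outcomeEquiv 𝒳 𝒴₀ 𝒴 𝒰 n fun i => (w i).2).2
              (outcomeEquiv 𝒳 𝒴₀ 𝒴 𝒰 n fun i => (w i).2).1.2.1 /
            outputMarginal (blockBase p₀ n) (blockKernel κ n) (blockChannel fun i => V (w i).1) ∅
              (outcomeEquiv 𝒳 𝒴₀ 𝒴 𝒰 n fun i => (w i).2).2
              (outcomeEquiv 𝒳 𝒴₀ 𝒴 𝒰 n fun i => (w i).2).1.2.1 =
            Real.exp (-∑ i, mixtureDensity p₀ κ V (.inl S) (w i)) *
            ∏ k, outputKernel (blockKernel κ n) (blockChannel fun i => V (w i).1) k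
              ((outcomeEquiv 𝒳 𝒴₀ 𝒴 𝒰 n fun i => (w i).2).1.1,
                (outcomeEquiv 𝒳 𝒴₀ 𝒴 𝒰 n fun i => (w i).2).1.2.1)
              ((outcomeEquiv 𝒳 𝒴₀ 𝒴 𝒰 n fun i => (w i).2).2 k) := by
          rw [outputMarginal_block, outputMarginal_block, ← Finset.prod_div_distrib,
            ← Finset.sum_neg_distrib, Real.exp_sum]
          simp_rw [outputKernel_block]
          rw [Finset.prod_comm, ← Finset.prod_mul_distrib]
          exact Finset.prod_congr rfl fun i _ =>
            (exp_neg_testDensity_mul hs (hV _) (hcj i) S).symm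
        refine h1.le.trans (mul_le_mul_of_nonneg_right (Real.exp_le_exp.2 (neg_le_neg
          (hty (.inl S)))) ?_)
        exact Finset.prod_nonneg fun k _ => Finset.sum_nonneg fun y _ => mul_nonneg
          (((hs.block n).kernel_mem k _).1 y)
          ((isChannel_blockChannel (fun i => hV (w i).1) k y).1 _)
      · refine (hE S).trans_eq ?_
        rw [← mixtureMean_add hs hV S]
    · have h1 : blockChannel (fun i => V (w i).1) k
          ((outcomeEquiv 𝒳 𝒴₀ 𝒴 𝒰 n fun i => (w i).2).1.2.2 k)
          ((outcomeEquiv 𝒳 𝒴₀ 𝒴 𝒰 n fun i => (w i).2).2 k) =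
          Real.exp (-∑ i, mixtureDensity p₀ κ V (.inr k) (w i)) := by
        simp only [mixtureDensity, Finset.sum_neg_distrib, neg_neg]
        rw [Real.exp_sum]
        exact Finset.prod_congr rfl fun i _ =>
          (Real.exp_log ((factors_pos hs (hV _) (hcj i)).2.2.1 k)).symm
      refine h1.le.trans ?_
      simp only [hcdef, hrdef]
      rw [← Real.exp_add, Real.exp_le_exp]
      have := hty (.inr k)
      simp only [hD, hH]
      linarith
  obtain ⟨q, hq⟩ := exists_timeSharing (Good := Good) hs hpQ hV hgood htyp
  -- With t = η/(2^K τ) the penalty is exactly η, so pA - t βA ≥ (1 - η)² - η ≥ 1 - 3η. Since βA ≥ 0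
  -- and pA ≤ 1, this controls both errors at once.
  obtain ⟨φ, A, hA⟩ := exists_code (hs.block n) hc hr (fun k u => Real.exp_pos _)
    (isChannel_blockChannel fun i => hV (q i)) bin hbin (T := T q) (t := η / (2 ^ K * τ)) hτ.le
    (by positivity) (fun u z h S => h S)
  refine ⟨φ, A, ?_⟩
  set pA := ∑ w, source (blockBase p₀ n) (blockKernel κ n) w *
    ind ((fun k => φ k (w.2.2 k), w.1, w.2.1) ∈ A)
  set βA := ∑ w, altSource (blockBase p₀ n) (blockKernel κ n) w *
    ind ((fun k => φ k (w.2.2 k), w.1, w.2.1) ∈ A)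
  have hθ' : 1 - η ≤ ∏ k, (1 - (1 - 1 / c k) ^ L k) := by
    refine hθ.trans ?_
    have : (1 - Real.exp (-(n * δ))) ^ K = ∏ _k : Fin K, (1 - Real.exp (-(n * δ))) := by
      rw [Finset.prod_const, Finset.card_univ, Fintype.card_fin]
    rw [this]
    refine Finset.prod_le_prod (fun k _ => ?_) fun k _ => one_sub_exp_le (hc k) ?_
    · rw [sub_nonneg, Real.exp_le_one_iff, neg_nonpos]
      exact mul_nonneg hn hδ
    · calc n * δ * c k ≤ Real.exp (n * δ) * c k :=
            mul_le_mul_of_nonneg_right (by linarith [Real.add_one_le_exp (n * δ)])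
              (zero_le_one.trans (hc k))
        _ = Real.exp (n * (D k + 2 * δ)) := by
            rw [hcdef, ← Real.exp_add]
            congr 1
            ring
        _ ≤ L k := Nat.le_ceil _
  have hprod := mul_le_mul hθ' hq (by linarith) (by linarith)
  have ht : η / (2 ^ K * τ) * (2 ^ K * τ) = η := by field_simp
  rw [ht] at hA
  have hp1 : pA ≤ 1 := by
    rw [← sum_source (hs.block n)]
    exact Finset.sum_le_sum fun w _ =>
      mul_le_of_le_one_right (source_nonneg (hs.block n) w) (ind_le_one _)
  have hβ0 : 0 ≤ βA := Finset.sum_nonneg fun w _ =>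
    mul_nonneg (altSource_nonneg (hs.block n) w) (ind_nonneg _)
  have hsq : 1 - 2 * η ≤ (1 - η) * (1 - η) := by nlinarith
  have hβt : 0 ≤ η / (2 ^ K * τ) * βA := mul_nonneg (by positivity) hβ0
  refine ⟨by linarith, ?_⟩
  have h3 : η / (2 ^ K * τ) * βA ≤ 3 * η := by linarith
  have h4 : η * βA ≤ η * (3 * (2 ^ K * τ)) := by
    rw [div_mul_eq_mul_div, div_le_iff₀ (by positivity)] at h3
    linarith
  exact le_of_mul_le_mul_left h4 hη

lemma isAchievable_of_mixture (hs : IsSource p₀ κ) (hpQ : pQ ∈ stdSimplex ℝ ι)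
    (hV : ∀ q, IsChannel (V q)) (hN : ∀ k, 0 < Fintype.card (𝒰 k)) {R : Fin K → ℝ}
    (hR : ∀ k, 0 ≤ R k) {E : ℝ}
    (hE : ∀ S, E ≤ ∑ q, pQ q * tradeoff (source p₀ κ) (V q) S + ∑ k ∈ S, R k)
    {ε : ℝ} (hε : ε ∈ Set.Ioc 0 1) : IsAchievable (source p₀ κ) ε R E := by
  intro δ hδ
  -- The slack (3K + 1) δ' of the block code is δ/2; the other half of δ absorbs the constant 3 ·
  -- 8^K for large n.
  set δ' := δ / (2 * (3 * K + 1)) with hδ'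
  have hδ'0 : 0 < δ' := by positivity
  have hη : 0 < ε / 3 := by linarith [hε.1]
  have htyp := eventually_typical (mixtureJoint_mem hs hpQ hV) (mixtureDensity p₀ κ V) hδ'0 hη
  have hθ : ∀ᶠ n : ℕ in Filter.atTop, 1 - ε / 3 ≤ (1 - Real.exp (-(n * δ'))) ^ K := by
    have h1 : Filter.Tendsto (fun n : ℕ => (n : ℝ) * δ') Filter.atTop Filter.atTop :=
      tendsto_natCast_atTop_atTop.atTop_mul_const hδ'0
    have h2 : Filter.Tendsto (fun n : ℕ => (1 - Real.exp (-((n : ℝ) * δ'))) ^ K) Filter.atTop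
        (nhds ((1 - 0) ^ K)) :=
      (tendsto_const_nhds.sub (Real.tendsto_exp_neg_atTop_nhds_zero.comp h1)).pow K
    rw [sub_zero, one_pow] at h2
    exact h2.eventually_const_le (by linarith)
  have hrate : ∀ᶠ n : ℕ in Filter.atTop, Real.log 3 ≤ n * δ ∧
      Real.log (3 * (2 ^ K * 4 ^ K)) ≤ n * (δ / 2) :=
    ((tendsto_natCast_atTop_atTop.atTop_mul_const hδ).eventually_ge_atTop _).and
      ((tendsto_natCast_atTop_atTop.atTop_mul_const (half_pos hδ)).eventually_ge_atTop _)
  filter_upwards [htyp, hθ, hrate, Filter.eventually_gt_atTop 0] with n h1 h2 h3 hn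
  have hn' : (0 : ℝ) < n := Nat.cast_pos.2 hn
  obtain ⟨φ, A, hp, hβ⟩ := exists_block_code hs hpQ hV hN hE hδ'0.le hη (by linarith [hε.2]) h1 h2
  refine ⟨_, φ, A, 3 * (2 ^ K * (4 ^ K * Real.exp (-(n * (E - (3 * K + 1) * δ'))))),
    by positivity, ?_, ?_, fun k => ?_, ?_⟩
  · have e0 := prob_iidPmf_eq _ _ (iidPmf_source (p₀ := p₀) (κ := κ) n) φ Aᶜ
    refine e0.le.trans ?_
    have : ∀ w, source (blockBase p₀ n) (blockKernel κ n) w *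
        ind ((fun k => φ k (w.2.2 k), w.1, w.2.1) ∈ Aᶜ) =
        source (blockBase p₀ n) (blockKernel κ n) w -
        source (blockBase p₀ n) (blockKernel κ n) w *
        ind ((fun k => φ k (w.2.2 k), w.1, w.2.1) ∈ A) := by
      intro w
      rw [Set.mem_compl_iff, ind_not]
      ring
    simp_rw [this, Finset.sum_sub_distrib]
    rw [sum_source (hs.block n)]
    linarith
  · rw [altPmf_source hs, prob_iidPmf_eq _ _ (iidPmf_altSource (p₀ := p₀) (κ := κ) n) φ A]
    exact hβ
  · have hM : ((⌈Real.exp (n * R k)⌉₊ + 1 : ℕ) : ℝ) ≤ 3 * Real.exp (n * R k) := by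
      push_cast
      linarith [ceil_exp_le (mul_nonneg hn'.le (hR k)),
        Real.one_le_exp (mul_nonneg hn'.le (hR k))]
    have hlog := Real.log_le_log (by positivity) hM
    rw [Real.log_mul (by norm_num) (Real.exp_pos _).ne', Real.log_exp] at hlog
    rw [one_div, inv_mul_le_iff₀ hn']
    linarith [h3.1]
  · have hlog : Real.log (3 * (2 ^ K * (4 ^ K * Real.exp (-(n * (E - (3 * K + 1) * δ')))))) =
        Real.log (3 * (2 ^ K * 4 ^ K)) - n * (E - (3 * K + 1) * δ') := by
      rw [← mul_assoc (2 ^ K : ℝ), ← mul_assoc (3 : ℝ), Real.log_mul (by positivity)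
        (Real.exp_pos _).ne', Real.log_exp]
      ring
    rw [hlog, ge_iff_le, neg_mul, ← mul_neg, one_div, le_inv_mul_iff₀ hn']
    have hδδ : (3 * K + 1) * δ' = δ / 2 := by rw [hδ']; field_simp
    rw [hδδ]
    linarith [h3.2]

/-- The direct part. -/
lemma singleLetterRegion_subset {𝒴 : Fin K → Type*} [∀ k, Fintype (𝒴 k)]
    {κ : ∀ k, 𝒳 × 𝒴₀ → 𝒴 k → ℝ} (hs : IsSource p₀ κ) :
    singleLetterRegion (source p₀ κ) ⊆ rateExponentRegion (source p₀ κ) := by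
  rintro ⟨R, E⟩ ⟨hR, hE, a, ha⟩
  refine ⟨hR, hE, fun ε hε => ?_⟩
  -- A pmf cannot live on an empty type: total mass one makes the alphabets of (X,Y₀), Y_k and Q
  -- nonempty, and then that of U_k.
  have hN : ∀ k, 0 < Fintype.card (Fin (a.cardU k)) := by
    intro k
    by_contra h0
    have h1 : a.cardU k = 0 := by simpa using h0
    have hz : Nonempty (𝒳 × 𝒴₀) := by
      by_contra hne
      rw [not_nonempty_iff] at hne
      have := hs.base_mem.2
      simp at this
    have hy : Nonempty (𝒴 k) := by
      by_contra hne
      rw [not_nonempty_iff] at hne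
      have := (hs.kernel_mem k (Classical.choice hz)).2
      simp at this
    have hq : Nonempty (Fin a.cardQ) := by
      by_contra hne
      rw [not_nonempty_iff] at hne
      have := a.pQ_mem.2
      simp at this
    have hu := (a.pU_mem k (Classical.choice hy) (Classical.choice hq)).2
    have : IsEmpty (Fin (a.cardU k)) := by rw [h1]; infer_instance
    simp at hu
  exact isAchievable_of_mixture hs a.pQ_mem a.isChannel hN hR
    (fun S => (ha S).trans_eq (a.tradeoff_eq _ R S)) hε

end Achievability

end

end DistHT

theorem theorem1 {K : ℕ} {𝒳 𝒴₀ : Type*} {𝒴 : Fin K → Type*}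
    [Fintype 𝒳] [Fintype 𝒴₀] [∀ k, Fintype (𝒴 k)]
    (P : DistHT.Letter 𝒳 𝒴₀ 𝒴 → ℝ)
    (hP : P ∈ stdSimplex ℝ (DistHT.Letter 𝒳 𝒴₀ 𝒴))
    (hnull : DistHT.CondIndepObservations P) :
    DistHT.rateExponentRegion P = DistHT.singleLetterRegion P ∧
      DistHT.rateExponentRegion P = DistHT.quantizeBinTestRegion P := by
  obtain ⟨p₀, κ, hs, rfl⟩ := DistHT.exists_source hP hnull
  have h := Set.Subset.antisymm (DistHT.rateExponentRegion_subset hs)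
    (DistHT.singleLetterRegion_subset hs)
  exact ⟨h, h.trans (DistHT.singleLetterRegion_eq_quantizeBinTestRegion hs)⟩
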